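/- Let $(M,\langle\cdot,\cdot\rangle,I)$ be an almost Hermitian manifold of dimension $2n$, $n\ge 2$ (a smooth Riemannian manifold with a smooth orthogonal almost complex structure), with Kähler form $\omega(X,Y)=\langle X,IY\rangle$ and Levi-Civita connection $\nabla$. Let $\xi_XY=-\tfrac12 I(\nabla_XI)Y$ be the intrinsic torsion, $\widetilde\nabla=\nabla+\xi$ the minimal $U(n)$-connection, and $\xi=\xi_1+\xi_2+\xi_3+\xi_4$ the decomposition of $\xi$ into its components in the Gray–Hervella modules $\mathcal W_1,\dots,\mathcal W_4$ of tensors $\zeta$ with every $\zeta_X$ skew-symmetric and anticommuting with $I$: in $\mathcal W_1$, $\zeta_XX=0$; in $\mathcal W_2$, the cyclic sum of $\langle\zeta_XY,IZ\rangle$ vanishes; in $\mathcal W_3$, $\zeta_{IX}IY=\zeta_XY$ and $\zeta_{e_i}e_i=0$; in $\mathcal W_4$, $\zeta_XY=\langle X,Y\rangle\theta-\langle\theta,Y\rangle X+\langle X,IY\rangle I\theta-\langle\theta,IY\rangle IX$ for some vector $\theta$. Here and below $(e_i)$ is any orthonormal basis of the tangent space at the given point and repeated indices are summed. Write $[[\lambda^{2,0}]]$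 for the space of $2$-forms $b$ with $b(IX,IY)=-b(X,Y)$, and define the $[[\lambda^{2,0}]]$-component of a $4$-form $\beta$ as $\tfrac12\bigl(c(X,Y)-c(IX,IY)\bigr)$, where $c(X,Y)=\omega(e_i,e_j)\,\beta(e_i,e_j,X,Y)$. Consider the eight terms $$t_1=\langle(\widetilde\nabla_{e_i}\xi_1)_{e_i}X,Y\rangle,\quad t_2=\langle(\widetilde\nabla_{e_i}\xi_3)_{e_i}X,Y\rangle,\quad t_3=\langle(\widetilde\nabla_{e_i}\xi_4)_{e_i}X,Y\rangle,$$ $$t_4=\langle{\xi_3}_Xe_i,{\xi_1}_{e_i}Y\rangle-\langle{\xi_3}_Ye_i,{\xi_1}_{e_i}X\rangle,\quad t_5=\langle{\xi_1}_{{\xi_4}_{e_i}e_i}X,Y\rangle,$$ $$t_6=\langle{\xi_3}_Xe_i,{\xi_2}_{e_i}Y\rangle-\langle{\xi_3}_Ye_i,{\xi_2}_{e_i}X\rangle,\quad t_7=\langle{\xi_2}_{{\xi_4}_{e_i}e_i}X,Y\rangle,\quad t_8=\langle{\xi_3}_{{\xi_4}_{e_i}e_i}X,Y\rangle,$$ which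 come from $\widetilde\nabla\xi_1$, $\widetilde\nabla\xi_3$, $\widetilde\nabla\xi_4$, $\xi_1\odot\xi_3$, $\xi_1\odot\xi_4$, $\xi_2\odot\xi_3$, $\xi_2\odot\xi_4$ and $\xi_3\odot\xi_4$, respectively. Each of them lies in $[[\lambda^{2,0}]]$. At every point of $M$, $d^2\omega=0$, the $[[\lambda^{2,0}]]$-component of $d^2\omega$ equals $4$ times the right-hand side below, and therefore $$0=3t_1-t_2+(n-2)\,t_3+t_4-\frac{n-5}{n-1}\,t_5+t_6-\frac{n-2}{n-1}\,t_7+t_8 .$$ For $n\ge3$ no coefficient of this relation vanishes, with the single exception of the coefficient of $t_5$ when $n=5$; a term whose coefficient is not zero is thereby a linear combination of the other seven. Moreover, put $t_0=\langle(\widetilde\nabla_{e_i}\xi_2)_{e_i}X,Y\rangle$ and let $A$ and $B$ be the two expressions (used for the anti-Hermitian part of the $*$-Ricci curvature, hence for the $\mathcal C_6$-component of the curvature) $$A(X,Y)=\tfrac12\bigl(a(X,Y)-a(Y,X)-a(IX,IY)+a(IY,IX)\bigr),$$ $$a(X,Y)=\langle(\widetilde\nabla_{e_i}\xi)_XY,e_i\rangle-\langle(\widetilde\nabla_X\xi)_{e_i}Y,e_i\rangle-\langle\xi_{\xi_Xe_i}Y,e_i\rangle,$$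 $$B(X,Y)=\langle(\widetilde\nabla_{e_i}\xi)_{Ie_i}IX,Y\rangle-\langle\xi_{I\xi_{e_i}e_i}IX,Y\rangle .$$ Then $$A=-t_0+2t_1+(n-1)t_3+t_4+\tfrac{4}{n-1}t_5+t_6+\tfrac1{n-1}t_7,\qquad B=-t_0-t_1+t_2+t_3+t_5+t_7-t_8 ,$$ the difference of these two expansions is, coefficient by coefficient, the right-hand side of the relation, so that $A=B$; and eliminating $t_1$ from $A$ by the relation gives $$A=-t_0+\tfrac23t_2+\tfrac{n+1}3t_3+\tfrac13t_4+\tfrac{2(n+1)}{3(n-1)}t_5+\tfrac13t_6+\tfrac{2n-1}{3(n-1)}t_7-\tfrac23t_8 ,$$ in which no displayed coefficient vanishes. -/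

import Mathlib

open Bundle Manifold
open scoped ContDiff

noncomputable section

namespace AlmostHermitian

/-! ### Linear algebra on one tangent space

`V` is a Euclidean vector space and `J` an endomorphism of it (later an orthogonal complex
structure).  A tensor `T : V →ₗ[ℝ] V →ₗ[ℝ] V` is read as `T u v = T_u v`. -/

section LinearAlgebra

variable {V : Type*} [NormedAddCommGroup V] [InnerProductSpace ℝ V]

/-- The space `V* ⊗ 𝔲(n)^⊥`: every `T_u` is skew-symmetric and anticommutes with `J`. -/
def torsionSpace (J : V →ₗ[ℝ] V) : Submodule ℝ (V →ₗ[ℝ] V →ₗ[ℝ] V) where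
  carrier := {T | (∀ u v w, inner ℝ (T u v) w = -inner ℝ v (T u w)) ∧
    ∀ u v, T u (J v) = -J (T u v)}
  zero_mem' := by simp
  add_mem' := by
    rintro S T ⟨h1, h2⟩ ⟨h3, h4⟩
    refine ⟨fun u v w ↦ ?_, fun u v ↦ ?_⟩
    · simp only [LinearMap.add_apply, inner_add_left, inner_add_right, h1, h3]; ring
    · simp only [LinearMap.add_apply, map_add, h2, h4]; abel
  smul_mem' := by
    rintro c T ⟨h1, h2⟩
    refine ⟨fun u v w ↦ ?_, fun u v ↦ ?_⟩
    · simp only [LinearMap.smul_apply, real_inner_smul_left, real_inner_smul_right, h1]; ring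
    · simp only [LinearMap.smul_apply, map_smul, h2, smul_neg]

/-- The Gray-Hervella module `𝒲₁`: `T_u u = 0`. -/
def W₁ (J : V →ₗ[ℝ] V) : Set (V →ₗ[ℝ] V →ₗ[ℝ] V) :=
  {T | T ∈ torsionSpace J ∧ ∀ u, T u u = 0}

/-- The Gray-Hervella module `𝒲₂`: the cyclic sum of `⟨T_u v, J w⟩` vanishes. -/
def W₂ (J : V →ₗ[ℝ] V) : Set (V →ₗ[ℝ] V →ₗ[ℝ] V) :=
  {T | T ∈ torsionSpace J ∧
    ∀ u v w, inner ℝ (T u v) (J w) + inner ℝ (T v w) (J u) + inner ℝ (T w u) (J v) = 0}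

/-- The vector `∑ i, T_{e_i} e_i`, for an orthonormal basis `e`. -/
def traceVector [FiniteDimensional ℝ V] (T : V →ₗ[ℝ] V →ₗ[ℝ] V) : V :=
  ∑ i, T (stdOrthonormalBasis ℝ V i) (stdOrthonormalBasis ℝ V i)

/-- The Gray-Hervella module `𝒲₃`: `T_{J u} J v = T_u v` and `∑ i, T_{e_i} e_i = 0`. -/
def W₃ [FiniteDimensional ℝ V] (J : V →ₗ[ℝ] V) : Set (V →ₗ[ℝ] V →ₗ[ℝ] V) :=
  {T | T ∈ torsionSpace J ∧ (∀ u v, T (J u) (J v) = T u v) ∧ traceVector T = 0}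

/-- The tensor of type `𝒲₄` determined by the vector `θ`:
`(u, v) ↦ ⟨u, v⟩ θ - ⟨θ, v⟩ u + ⟨u, J v⟩ J θ - ⟨θ, J v⟩ J u`. -/
def vectorTensor (J : V →ₗ[ℝ] V) (θ : V) : V →ₗ[ℝ] V →ₗ[ℝ] V :=
  LinearMap.mk₂ ℝ
    (fun u v ↦ inner ℝ u v • θ - inner ℝ θ v • u + inner ℝ u (J v) • J θ - inner ℝ θ (J v) • J u)
    (fun u u' v ↦ by simp only [inner_add_left, map_add]; module)
    (fun c u v ↦ by simp only [real_inner_smul_left, map_smul]; module)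
    (fun u v v' ↦ by simp only [inner_add_right, map_add]; module)
    (fun c u v ↦ by simp only [real_inner_smul_right, map_smul]; module)

/-- The Gray-Hervella module `𝒲₄`. -/
def W₄ (J : V →ₗ[ℝ] V) : Set (V →ₗ[ℝ] V →ₗ[ℝ] V) :=
  {T | ∃ θ : V, T = vectorTensor J θ}

/-- The part of `T` with `T_{J u} J v = -T_u v`, i.e. the component in `𝒲₁ + 𝒲₂`. -/
def part₁₂ (J : V →ₗ[ℝ] V) (T : V →ₗ[ℝ] V →ₗ[ℝ] V) : V →ₗ[ℝ] V →ₗ[ℝ] V :=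
  (1 / 2 : ℝ) • (T - T.compl₁₂ J J)

/-- The part of `T` with `T_{J u} J v = T_u v`, i.e. the component in `𝒲₃ + 𝒲₄`. -/
def part₃₄ (J : V →ₗ[ℝ] V) (T : V →ₗ[ℝ] V →ₗ[ℝ] V) : V →ₗ[ℝ] V →ₗ[ℝ] V :=
  (1 / 2 : ℝ) • (T + T.compl₁₂ J J)

/-- Total skew-symmetrisation of a tensor with all `T_u` skew: the tensor `A` with
`⟨A_u v, w⟩ = (⟨T_u v, w⟩ + ⟨T_v w, u⟩ + ⟨T_w u, v⟩) / 3`. -/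
def cyclicPart [FiniteDimensional ℝ V] (T : V →ₗ[ℝ] V →ₗ[ℝ] V) : V →ₗ[ℝ] V →ₗ[ℝ] V :=
  LinearMap.mk₂ ℝ (fun u v ↦ (1 / 3 : ℝ) • (T u v - T v u + LinearMap.adjoint (T.flip u) v))
    (fun u u' v ↦ by simp only [map_add, LinearMap.add_apply]; module)
    (fun c u v ↦ by
      simp only [map_smulₛₗ, LinearMap.smul_apply, RingHom.id_apply, conj_trivial]
      module)
    (fun u v v' ↦ by simp only [map_add, LinearMap.add_apply]; module)
    (fun c u v ↦ by simp only [map_smul, LinearMap.smul_apply]; module)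

/-- The component of `T` in `𝒲₁`. -/
def comp₁ [FiniteDimensional ℝ V] (J : V →ₗ[ℝ] V) (T : V →ₗ[ℝ] V →ₗ[ℝ] V) :
    V →ₗ[ℝ] V →ₗ[ℝ] V :=
  cyclicPart (part₁₂ J T)

/-- The component of `T` in `𝒲₂`. -/
def comp₂ [FiniteDimensional ℝ V] (J : V →ₗ[ℝ] V) (T : V →ₗ[ℝ] V →ₗ[ℝ] V) :
    V →ₗ[ℝ] V →ₗ[ℝ] V :=
  part₁₂ J T - comp₁ J T

/-- The component of `T` in `𝒲₄`, where `dim V = 2 n`. -/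
def comp₄ [FiniteDimensional ℝ V] (n : ℕ) (J : V →ₗ[ℝ] V) (T : V →ₗ[ℝ] V →ₗ[ℝ] V) :
    V →ₗ[ℝ] V →ₗ[ℝ] V :=
  (1 / (2 * ((n : ℝ) - 1))) • vectorTensor J (traceVector T)

/-- The component of `T` in `𝒲₃`, where `dim V = 2 n`. -/
def comp₃ [FiniteDimensional ℝ V] (n : ℕ) (J : V →ₗ[ℝ] V) (T : V →ₗ[ℝ] V →ₗ[ℝ] V) :
    V →ₗ[ℝ] V →ₗ[ℝ] V :=
  part₃₄ J T - comp₄ n J T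

/-- `⟦λ^{2,0}⟧`: the bilinear forms that are skew-symmetric and lie in the `(-1)`-eigenspace of
`b ↦ b(J ·, J ·)`. -/
def IsLambda20 (J : V →ₗ[ℝ] V) (b : V → V → ℝ) : Prop :=
  (∀ u v, b u v = -b v u) ∧ ∀ u v, b (J u) (J v) = -b u v

/-- The `⟦λ^{2,0}⟧`-component of a `4`-form: contract the first two arguments with
`ω(u, v) = ⟨u, J v⟩` and project to the `(-1)`-eigenspace of `b ↦ b(J ·, J ·)`. -/
def lambda20Part {ι : Type*} [Fintype ι] (J : V →ₗ[ℝ] V) (e : OrthonormalBasis ι ℝ V)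
    (β : V → V → V → V → ℝ) (u v : V) : ℝ :=
  1 / 2 * (∑ i, ∑ j, inner ℝ (e i) (J (e j)) * β (e i) (e j) u v
    - ∑ i, ∑ j, inner ℝ (e i) (J (e j)) * β (e i) (e j) (J u) (J v))

/-- `∑ i, ⟨(D_{e_i})_{e_i} X, Y⟩`, where `D u v w = (D_u)_v w`. -/
def divTerm {ι : Type*} [Fintype ι] (e : OrthonormalBasis ι ℝ V) (D : V → V → V → V)
    (X Y : V) : ℝ :=
  ∑ i, inner ℝ (D (e i) (e i) X) Y

/-- `∑ i, (⟨A_X e_i, B_{e_i} Y⟩ - ⟨A_Y e_i, B_{e_i} X⟩)`. -/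
def mixedTerm {ι : Type*} [Fintype ι] (e : OrthonormalBasis ι ℝ V) (A B : V →ₗ[ℝ] V →ₗ[ℝ] V)
    (X Y : V) : ℝ :=
  ∑ i, (inner ℝ (A X (e i)) (B (e i) Y) - inner ℝ (A Y (e i)) (B (e i) X))

/-- `∑ i, ⟨A_{B_{e_i} e_i} X, Y⟩`. -/
def traceTerm {ι : Type*} [Fintype ι] (e : OrthonormalBasis ι ℝ V) (A B : V →ₗ[ℝ] V →ₗ[ℝ] V)
    (X Y : V) : ℝ :=
  ∑ i, inner ℝ (A (B (e i) (e i)) X) Y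

/-- `∑ i, (⟨(D_{e_i})_X Y, e_i⟩ - ⟨(D_X)_{e_i} Y, e_i⟩ - ⟨T_{T_X e_i} Y, e_i⟩)`. -/
def ricciTerm {ι : Type*} [Fintype ι] (e : OrthonormalBasis ι ℝ V) (D : V → V → V → V)
    (T : V →ₗ[ℝ] V →ₗ[ℝ] V) (X Y : V) : ℝ :=
  ∑ i, (inner ℝ (D (e i) X Y) (e i) - inner ℝ (D X (e i) Y) (e i)
    - inner ℝ (T (T X (e i)) Y) (e i))

/-- With `D = ∇̃ξ` and `T = ξ`: the first of two expressions used for the anti-Hermitian part of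
the `*`-Ricci curvature, i.e. for the `𝒞₆`-component of the Riemannian curvature. -/
def ricciStarExpr {ι : Type*} [Fintype ι] (J : V →ₗ[ℝ] V) (e : OrthonormalBasis ι ℝ V)
    (D : V → V → V → V) (T : V →ₗ[ℝ] V →ₗ[ℝ] V) (X Y : V) : ℝ :=
  1 / 2 * (ricciTerm e D T X Y - ricciTerm e D T Y X
    - ricciTerm e D T (J X) (J Y) + ricciTerm e D T (J Y) (J X))

/-- With `D = ∇̃ξ` and `T = ξ`: the second of two expressions used for the anti-Hermitian part of
the `*`-Ricci curvature, i.e. for the `𝒞₆`-component of the Riemannian curvature. -/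
def ricciStarExpr' {ι : Type*} [Fintype ι] (J : V →ₗ[ℝ] V) (e : OrthonormalBasis ι ℝ V)
    (D : V → V → V → V) (T : V →ₗ[ℝ] V →ₗ[ℝ] V) (X Y : V) : ℝ :=
  ∑ i, (inner ℝ (D (e i) (J (e i)) (J X)) Y - inner ℝ (T (J (T (e i) (e i))) (J X)) Y)

end LinearAlgebra

/-- The coefficients of the relation among the eight terms of `relationTerm`. -/
def relationCoeff (n : ℕ) : Fin 8 → ℝ :=
  ![3, -1, (n : ℝ) - 2, 1, -(((n : ℝ) - 5) / ((n : ℝ) - 1)), 1,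
    -(((n : ℝ) - 2) / ((n : ℝ) - 1)), 1]

/-- The coefficients of the eight terms of `relationTerm` in `ricciStarExpr`. -/
def ricciStarCoeff (n : ℕ) : Fin 8 → ℝ :=
  ![2, 0, (n : ℝ) - 1, 1, 4 / ((n : ℝ) - 1), 1, 1 / ((n : ℝ) - 1), 0]

/-- The coefficients of the eight terms of `relationTerm` in `ricciStarExpr'`. -/
def ricciStarCoeff' : Fin 8 → ℝ :=
  ![-1, 1, 1, 0, 1, 0, 1, -1]

/-- The coefficients of the eight terms of `relationTerm` in `ricciStarExpr` after the
`∇̃ξ_1`-term has been eliminated by the relation. -/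
def ricciStarCoeffElim (n : ℕ) : Fin 8 → ℝ :=
  ![0, 2 / 3, ((n : ℝ) + 1) / 3, 1 / 3, 2 * ((n : ℝ) + 1) / (3 * ((n : ℝ) - 1)), 1 / 3,
    (2 * (n : ℝ) - 1) / (3 * ((n : ℝ) - 1)), -(2 / 3)]

/-! ### Almost Hermitian manifolds -/

section Geometry

variable {E : Type*} [NormedAddCommGroup E] [NormedSpace ℝ E]
  {H : Type*} [TopologicalSpace H] {I : ModelWithCorners ℝ E H}
  {M : Type*} [TopologicalSpace M] [ChartedSpace H M]

/-- The exterior derivative of a `2`-form, by the invariant formula applied to local extensions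
of the tangent vectors. -/
def extDeriv₂ [IsManifold I 1 M]
    (α : ∀ x : M, TangentSpace I x → TangentSpace I x → ℝ) (x : M)
    (u v w : TangentSpace I x) : ℝ :=
  let U := FiberBundle.extend E u
  let V := FiberBundle.extend E v
  let W := FiberBundle.extend E w
  mvfderiv I (fun y ↦ α y (V y) (W y)) x u
    - mvfderiv I (fun y ↦ α y (U y) (W y)) x v
    + mvfderiv I (fun y ↦ α y (U y) (V y)) x w
    - α x (VectorField.mlieBracket I U V x) w
    + α x (VectorField.mlieBracket I U W x) v
    - α x (VectorField.mlieBracket I V W x) u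

/-- The exterior derivative of a `3`-form, by the invariant formula applied to local extensions
of the tangent vectors. -/
def extDeriv₃ [IsManifold I 1 M]
    (α : ∀ x : M, TangentSpace I x → TangentSpace I x → TangentSpace I x → ℝ) (x : M)
    (t u v w : TangentSpace I x) : ℝ :=
  let T := FiberBundle.extend E t
  let U := FiberBundle.extend E u
  let V := FiberBundle.extend E v
  let W := FiberBundle.extend E w
  mvfderiv I (fun y ↦ α y (U y) (V y) (W y)) x t
    - mvfderiv I (fun y ↦ α y (T y) (V y) (W y)) x u
    + mvfderiv I (fun y ↦ α y (T y) (U y) (W y)) x v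
    - mvfderiv I (fun y ↦ α y (T y) (U y) (V y)) x w
    - α x (VectorField.mlieBracket I T U x) v w
    + α x (VectorField.mlieBracket I T V x) u w
    - α x (VectorField.mlieBracket I T W x) u v
    - α x (VectorField.mlieBracket I U V x) t w
    + α x (VectorField.mlieBracket I U W x) t v
    - α x (VectorField.mlieBracket I V W x) t u

/-- For a connection `D` on `TM` and a tensor field `S`, the value `(D_u S)_v w`, i.e.
`D_u (S_V W) - S_{D_u V} w - S_v (D_u W)` for local extensions `V`, `W` of `v`, `w`. -/
def tensorDeriv [IsManifold I 1 M] (D : CovariantDerivative I E (TangentSpace I : M → Type _))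
    (S : ∀ x : M, TangentSpace I x →ₗ[ℝ] TangentSpace I x →ₗ[ℝ] TangentSpace I x) (x : M)
    (u v w : TangentSpace I x) : TangentSpace I x :=
  let V := FiberBundle.extend E v
  let W := FiberBundle.extend E w
  D (fun y ↦ S y (V y) (W y)) x u - S x (D V x u) w - S x v (D W x u)

variable [FiniteDimensional ℝ E] [IsManifold I ∞ M]
  [RiemannianBundle (fun x : M ↦ TangentSpace I x)]

/-- Tangent spaces, with the metric given by the Riemannian structure, are finite-dimensional. -/
instance finiteDimensional_tangentSpace (x : M) :
    @FiniteDimensional ℝ (TangentSpace I x) _ _ (InnerProductSpace.toNormedSpace (𝕜 := ℝ)).toModule :=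
  inferInstanceAs (FiniteDimensional ℝ E)

variable (I M) in
/-- A smooth almost complex structure, orthogonal for the Riemannian metric of `M`. -/
structure OrthogonalComplexStructure where
  /-- The endomorphism of each tangent space. -/
  toFun : ∀ x : M, TangentSpace I x →L[ℝ] TangentSpace I x
  contMDiff : ContMDiff I (I.prod 𝓘(ℝ, E →L[ℝ] E)) ∞
    (fun x ↦ TotalSpace.mk' (E →L[ℝ] E) (E := fun x : M ↦ TangentSpace I x →L[ℝ] TangentSpace I x)
      x (toFun x))
  sq : ∀ (x : M) (v : TangentSpace I x), toFun x (toFun x v) = -v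
  orthogonal : ∀ (x : M) (v w : TangentSpace I x), inner ℝ (toFun x v) (toFun x w) = inner ℝ v w

variable (J : OrthogonalComplexStructure I M)

/-- `J` at the point `x`, as a linear map. -/
def OrthogonalComplexStructure.at (x : M) : TangentSpace I x →ₗ[ℝ] TangentSpace I x :=
  (J.toFun x).toLinearMap

/-- The Kähler form `ω(u, v) = ⟨u, J v⟩`. -/
def kahlerForm (x : M) (u v : TangentSpace I x) : ℝ := inner ℝ u (J.toFun x v)

/-- The Levi-Civita connection: `d⟨σ, τ⟩(u) = ⟨∇_u σ, τ⟩ + ⟨σ, ∇_u τ⟩` and no torsion. -/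
structure IsLeviCivita (nabla : CovariantDerivative I E (TangentSpace I : M → Type _)) : Prop where
  metric : ∀ (σ τ : ∀ x : M, TangentSpace I x) (x : M), MDiffAt (T% σ) x → MDiffAt (T% τ) x →
    ∀ u : TangentSpace I x, mvfderiv I (fun y ↦ (inner ℝ (σ y) (τ y) : ℝ)) x u
      = inner ℝ (nabla σ x u) (τ x) + inner ℝ (σ x) (nabla τ x u)
  torsion_free : nabla.torsion = 0

variable (nabla : CovariantDerivative I E (TangentSpace I : M → Type _))

/-- The operation `Y ↦ (X ↦ -½ J (∇_X J) Y)`, with `(∇_X J) Y = ∇_X (J Y) - J (∇_X Y)`. -/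
def torsionOp (Y : ∀ x : M, TangentSpace I x) (x : M) :
    TangentSpace I x →L[ℝ] TangentSpace I x :=
  (-(1 / 2) : ℝ) • (J.toFun x ∘L (nabla (fun y ↦ J.toFun y (Y y)) x - J.toFun x ∘L nabla Y x))

theorem tensorialAt_torsionOp (x : M) :
    TensorialAt I E (fun Y ↦ torsionOp J nabla Y x) x := by
  have key : ∀ {Y : ∀ x : M, TangentSpace I x}, MDiffAt (T% Y) x →
      MDiffAt (T% (fun y ↦ J.toFun y (Y y))) x := by
    intro Y hY
    exact MDifferentiableAt.clm_bundle_apply (F₁ := E) (F₂ := E)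
      ((J.contMDiff x).mdifferentiableAt (by simp)) hY
  constructor
  · intro f Y hf hY
    have h1 : (fun y ↦ J.toFun y ((f • Y) y)) = f • (fun y ↦ J.toFun y (Y y)) := by
      funext y; simp
    simp only [torsionOp]
    rw [h1, nabla.isCovariantDerivativeOnUniv.leibniz hY hf,
      nabla.isCovariantDerivativeOnUniv.leibniz (key hY) hf]
    ext u
    simp
    module
  · intro Y Z hY hZ
    have h1 : (fun y ↦ J.toFun y ((Y + Z) y))
        = (fun y ↦ J.toFun y (Y y)) + (fun y ↦ J.toFun y (Z y)) := by
      funext y; simp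
    simp only [torsionOp]
    rw [h1, nabla.isCovariantDerivativeOnUniv.add hY hZ,
      nabla.isCovariantDerivativeOnUniv.add (key hY) (key hZ)]
    ext u
    simp
    module

/-- The intrinsic torsion as an endomorphism-valued one-form, with arguments in the order
`Y`, `X`: `torsionForm J ∇ x Y X = ξ_X Y = -½ J (∇_X J) Y`. -/
def torsionForm (x : M) :
    TangentSpace I x →L[ℝ] TangentSpace I x →L[ℝ] TangentSpace I x :=
  TensorialAt.mkHom (fun Y ↦ torsionOp J nabla Y x) x (tensorialAt_torsionOp J nabla x)

/-- The intrinsic torsion `ξ`, with `intrinsicTorsion J ∇ x X Y = ξ_X Y`. -/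
def intrinsicTorsion (x : M) :
    TangentSpace I x →ₗ[ℝ] TangentSpace I x →ₗ[ℝ] TangentSpace I x :=
  LinearMap.mk₂ ℝ (fun u v ↦ torsionForm J nabla x v u)
    (fun _ _ _ ↦ by simp) (fun _ _ _ ↦ by simp) (fun _ _ _ ↦ by simp) (fun _ _ _ ↦ by simp)

/-- The minimal `U(n)`-connection `∇̃ = ∇ + ξ`. -/
def minimalConnection : CovariantDerivative I E (TangentSpace I : M → Type _) :=
  nabla.addOneForm (torsionForm J nabla)

/-- The component `ξ_1` of the intrinsic torsion in `𝒲₁`. -/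
def xi₁ (x : M) :
    TangentSpace I x →ₗ[ℝ] TangentSpace I x →ₗ[ℝ] TangentSpace I x :=
  comp₁ (J.at x) (intrinsicTorsion J nabla x)

/-- The component `ξ_2` of the intrinsic torsion in `𝒲₂`. -/
def xi₂ (x : M) :
    TangentSpace I x →ₗ[ℝ] TangentSpace I x →ₗ[ℝ] TangentSpace I x :=
  comp₂ (J.at x) (intrinsicTorsion J nabla x)

/-- The component `ξ_3` of the intrinsic torsion in `𝒲₃`, where `dim M = 2 n`. -/
def xi₃ (n : ℕ) (x : M) :
    TangentSpace I x →ₗ[ℝ] TangentSpace I x →ₗ[ℝ] TangentSpace I x :=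
  comp₃ n (J.at x) (intrinsicTorsion J nabla x)

/-- The component `ξ_4` of the intrinsic torsion in `𝒲₄`, where `dim M = 2 n`. -/
def xi₄ (n : ℕ) (x : M) :
    TangentSpace I x →ₗ[ℝ] TangentSpace I x →ₗ[ℝ] TangentSpace I x :=
  comp₄ n (J.at x) (intrinsicTorsion J nabla x)

/-- The eight `⟦λ^{2,0}⟧`-terms, on a manifold of dimension `2 n`, coming from
`∇̃ξ_1`, `∇̃ξ_3`, `∇̃ξ_4`, `ξ_1 ⊙ ξ_3`, `ξ_1 ⊙ ξ_4`, `ξ_2 ⊙ ξ_3`, `ξ_2 ⊙ ξ_4`, `ξ_3 ⊙ ξ_4`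
in this order. -/
def relationTerm {ι : Type*} [Fintype ι] (n : ℕ) (x : M)
    (e : OrthonormalBasis ι ℝ (TangentSpace I x)) :
    Fin 8 → TangentSpace I x → TangentSpace I x → ℝ :=
  ![divTerm e (tensorDeriv (minimalConnection J nabla) (xi₁ J nabla) x),
    divTerm e (tensorDeriv (minimalConnection J nabla) (xi₃ J nabla n) x),
    divTerm e (tensorDeriv (minimalConnection J nabla) (xi₄ J nabla n) x),
    mixedTerm e (xi₃ J nabla n x) (xi₁ J nabla x),
    traceTerm e (xi₁ J nabla x) (xi₄ J nabla n x),
    mixedTerm e (xi₃ J nabla n x) (xi₂ J nabla x),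
    traceTerm e (xi₂ J nabla x) (xi₄ J nabla n x),
    traceTerm e (xi₃ J nabla n x) (xi₄ J nabla n x)]

/-- The `⟦λ^{2,0}⟧`-term `∑ i, ⟨(∇̃_{e_i} ξ_2)_{e_i} X, Y⟩` coming from `∇̃ξ_2`. -/
def divXi₂ {ι : Type*} [Fintype ι] (x : M) (e : OrthonormalBasis ι ℝ (TangentSpace I x)) :
    TangentSpace I x → TangentSpace I x → ℝ :=
  divTerm e (tensorDeriv (minimalConnection J nabla) (xi₂ J nabla) x)

end Geometry

end AlmostHermitian

end

open AlmostHermitian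

/-!
The minimal connection `∇̃ = ∇ + ξ` preserves the metric and `J`, and its torsion is
`(u, v) ↦ ξ_u v - ξ_v u`.  Hence `dω` is twice the cyclic sum of `⟨ξ_u v, J w⟩`, and `d²ω` is the
same expression in `∇̃ξ` plus terms quadratic in `ξ`.  As `∇̃` commutes with the projections
`ξ ↦ ξᵢ`, the value of `d²ω` at a point is determined by linear algebra in one tangent space.

There `ξ₁ + ξ₂` satisfies `T_{J u} J v = -T_u v` and `ξ₃ + ξ₄` satisfies `T_{J u} J v = T_u v`.
After contracting with `ω` and projecting to `⟦λ^{2,0}⟧`, a quadratic term either contains the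
vector `∑ i, ξ_{e_i} e_i`, to which only `ξ₄` contributes, or is a contraction
`∑ i, ⟨P_{Q_X e_i} e_i, Y⟩`.  The contraction vanishes for `P` in `ξ₃ + ξ₄`, and the projection
cancels it for `P` and `Q` both in `ξ₁ + ξ₂`, so only `P` in `ξ₁ + ξ₂` with `Q` in `ξ₃ + ξ₄`
remains.

That `d²ω = 0` for forms evaluated on vector fields extending tangent vectors comes from choosing
the extensions constant in a chart: their brackets vanish, so iterated derivatives commute.
-/

noncomputable section

namespace AlmostHermitian

/-! ### Metric traces -/

section MetricTrace

variable {V : Type*} [NormedAddCommGroup V] [InnerProductSpace ℝ V]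
  {W : Type*} [AddCommGroup W] [Module ℝ W] {ι : Type*} [Fintype ι]

theorem sum_inner_smul_map (e : OrthonormalBasis ι ℝ V) (f : V →ₗ[ℝ] W) (u : V) :
    ∑ i, inner ℝ (e i) u • f (e i) = f u := by
  conv_rhs => rw [← e.sum_repr' u]
  simp only [map_sum, map_smul]

theorem sum_inner_mul_inner_map (e : OrthonormalBasis ι ℝ V) (f : V →ₗ[ℝ] V) (u w : V) :
    ∑ i, inner ℝ (e i) u * inner ℝ (f (e i)) w = inner ℝ (f u) w := by
  simp only [← sum_inner_smul_map e f u, sum_inner, real_inner_smul_left]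

theorem sum_apply_adjoint_pair (e : OrthonormalBasis ι ℝ V) {κ : Type*} [Fintype κ]
    (b : OrthonormalBasis κ ℝ V) {a a' : V →ₗ[ℝ] V}
    (h : ∀ v w, inner ℝ (a v) w = inner ℝ v (a' w)) (f : V →ₗ[ℝ] V →ₗ[ℝ] W) :
    ∑ i, f (a (e i)) (e i) = ∑ k, f (b k) (a' (b k)) := by
  have expand_left : ∀ i, f (a (e i)) (e i) = ∑ k, inner ℝ (b k) (a (e i)) • f (b k) (e i) :=
    fun i ↦ (sum_inner_smul_map b (f.flip (e i)) (a (e i))).symm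
  have collect_right : ∀ k, ∑ i, inner ℝ (b k) (a (e i)) • f (b k) (e i) = f (b k) (a' (b k)) := by
    intro k
    simp only [real_inner_comm (a _), h, sum_inner_smul_map e (f (b k))]
  simp only [expand_left]
  rw [Finset.sum_comm]
  exact Finset.sum_congr rfl fun k _ ↦ collect_right k

theorem sum_apply_skew_variation_eq_zero (e : OrthonormalBasis ι ℝ V) {d : ι → V}
    (h : ∀ i j, (inner ℝ (d i) (e j) : ℝ) = -inner ℝ (d j) (e i)) (f : V →ₗ[ℝ] V →ₗ[ℝ] W) :
    ∑ i, (f (d i) (e i) + f (e i) (d i)) = 0 := by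
  have expand_left : ∀ i, f (d i) (e i) = ∑ j, inner ℝ (e j) (d i) • f (e j) (e i) :=
    fun i ↦ (sum_inner_smul_map e (f.flip (e i)) (d i)).symm
  have collect_right : ∀ j, ∑ i, inner ℝ (e j) (d i) • f (e j) (e i) = -f (e j) (d j) := by
    intro j
    simp only [real_inner_comm (d _), h _ j, neg_smul, Finset.sum_neg_distrib]
    simp only [real_inner_comm _ (d j), sum_inner_smul_map e (f (e j))]
  rw [Finset.sum_add_distrib]
  simp only [expand_left]
  rw [Finset.sum_comm]
  simp only [collect_right, Finset.sum_neg_distrib, neg_add_cancel]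

variable [FiniteDimensional ℝ V]

/-- The trace of a vector-valued bilinear map with respect to the metric: the sum of the
`f (e i) (e i)` over an orthonormal basis `e`. -/
def metricTrace : (V →ₗ[ℝ] V →ₗ[ℝ] W) →ₗ[ℝ] W where
  toFun f := ∑ i, f (stdOrthonormalBasis ℝ V i) (stdOrthonormalBasis ℝ V i)
  map_add' f g := by simp only [LinearMap.add_apply, Finset.sum_add_distrib]
  map_smul' c f := by simp only [LinearMap.smul_apply, Finset.smul_sum, RingHom.id_apply]

theorem metricTrace_eq_sum (e : OrthonormalBasis ι ℝ V) (f : V →ₗ[ℝ] V →ₗ[ℝ] W) :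
    metricTrace f = ∑ i, f (e i) (e i) :=
  sum_apply_adjoint_pair (stdOrthonormalBasis ℝ V) e (a := .id) (a' := .id) (fun _ _ ↦ rfl) f

theorem metricTrace_comp_eq_compl₂ {a a' : V →ₗ[ℝ] V}
    (h : ∀ v w, inner ℝ (a v) w = inner ℝ v (a' w)) (f : V →ₗ[ℝ] V →ₗ[ℝ] W) :
    metricTrace (f ∘ₗ a) = metricTrace (f.compl₂ a') :=
  sum_apply_adjoint_pair (stdOrthonormalBasis ℝ V) (stdOrthonormalBasis ℝ V) h f

theorem metricTrace_compr₂ {W' : Type*} [AddCommGroup W'] [Module ℝ W'] (g : W →ₗ[ℝ] W')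
    (f : V →ₗ[ℝ] V →ₗ[ℝ] W) : metricTrace (f.compr₂ g) = g (metricTrace f) := by
  simp only [metricTrace_eq_sum (stdOrthonormalBasis ℝ V), LinearMap.compr₂_apply, map_sum]

theorem metricTrace_comp_smulRight_innerₗ (f : V →ₗ[ℝ] V →ₗ[ℝ] W) (u θ : V) :
    metricTrace (f ∘ₗ (innerₗ V u).smulRight θ) = f θ u := by
  have h := sum_inner_smul_map (stdOrthonormalBasis ℝ V) (f θ) u
  simp only [real_inner_comm u] at h
  rw [metricTrace_eq_sum (stdOrthonormalBasis ℝ V), ← h]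
  simp only [LinearMap.comp_apply, LinearMap.smulRight_apply, innerₗ_apply_apply, map_smul,
    LinearMap.smul_apply]

theorem inner_metricTrace (e : OrthonormalBasis ι ℝ V) (f : V →ₗ[ℝ] V →ₗ[ℝ] V) (w : V) :
    inner ℝ (metricTrace f) w = ∑ i, inner ℝ (f (e i) (e i)) w := by
  rw [metricTrace_eq_sum e, sum_inner]

theorem traceVector_eq_metricTrace (T : V →ₗ[ℝ] V →ₗ[ℝ] V) : traceVector T = metricTrace T := rfl

end MetricTrace

/-! ### Orthogonal complex structures -/

section OrthogonalComplex

variable {V : Type*} [NormedAddCommGroup V] [InnerProductSpace ℝ V] {J : V →ₗ[ℝ] V}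

/-- `J` is an orthogonal complex structure on the Euclidean vector space `V`. -/
structure IsOrthogonalComplex (J : V →ₗ[ℝ] V) : Prop where
  sq : ∀ v, J (J v) = -v
  inner_map : ∀ v w, inner ℝ (J v) (J w) = inner ℝ v w

namespace IsOrthogonalComplex

theorem inner_map_left (hJ : IsOrthogonalComplex J) (v w : V) :
    inner ℝ (J v) w = -inner ℝ v (J w) := by
  rw [← hJ.inner_map v, hJ.sq, inner_neg_right, neg_neg]

theorem inner_map_self (hJ : IsOrthogonalComplex J) (v : V) : inner ℝ v (J v) = 0 := by
  have h := hJ.inner_map_left v v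
  rw [real_inner_comm] at h
  linarith

variable {W : Type*} [AddCommGroup W] [Module ℝ W]

theorem sum_map_left (hJ : IsOrthogonalComplex J) {ι : Type*} [Fintype ι]
    (e : OrthonormalBasis ι ℝ V) {f : V → V → W} (hf₁ : ∀ v, IsLinearMap ℝ fun u ↦ f u v)
    (hf₂ : ∀ u, IsLinearMap ℝ (f u)) : ∑ i, f (J (e i)) (e i) = -∑ i, f (e i) (J (e i)) := by
  have h := sum_apply_adjoint_pair e e (a := J) (a' := -J)
    (fun v w ↦ by rw [hJ.inner_map_left, LinearMap.neg_apply, inner_neg_right])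
    (LinearMap.mk₂ ℝ f (fun u u' v ↦ (hf₁ v).map_add u u') (fun c u v ↦ (hf₁ v).map_smul c u)
      (fun u ↦ (hf₂ u).map_add) (fun c u v ↦ (hf₂ u).map_smul c v))
  simpa only [LinearMap.mk₂_apply, LinearMap.neg_apply, (hf₂ _).map_neg, Finset.sum_neg_distrib]
    using h

variable [FiniteDimensional ℝ V]

theorem metricTrace_comp (hJ : IsOrthogonalComplex J) (f : V →ₗ[ℝ] V →ₗ[ℝ] W) :
    metricTrace (f ∘ₗ J) = -metricTrace (f.compl₂ J) := by
  rw [metricTrace_comp_eq_compl₂ (a' := -J) (fun v w ↦ by simp [hJ.inner_map_left]), ← map_neg]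
  congr 1
  ext u v
  simp

theorem metricTrace_compl₁₂ (hJ : IsOrthogonalComplex J) (f : V →ₗ[ℝ] V →ₗ[ℝ] W) :
    metricTrace (f.compl₁₂ J J) = metricTrace f := by
  have h : f.compl₁₂ J J = (f.compl₂ J) ∘ₗ J := rfl
  rw [h, hJ.metricTrace_comp, ← map_neg]
  congr 1
  ext u v
  simp [hJ.sq]

end IsOrthogonalComplex

end OrthogonalComplex

/-! ### The Gray-Hervella decomposition -/

section Symmetries

variable {V : Type*} [NormedAddCommGroup V] [InnerProductSpace ℝ V] {J : V →ₗ[ℝ] V}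
  {S T : V →ₗ[ℝ] V →ₗ[ℝ] V}

/-- `T` is a one-form with values in the skew-symmetric endomorphisms. -/
def IsSkew (T : V →ₗ[ℝ] V →ₗ[ℝ] V) : Prop :=
  ∀ u v w, inner ℝ (T u v) w = -inner ℝ v (T u w)

/-- `T_{J u} J v = T_u v`, the symmetry of the tensors in `𝒲₃ + 𝒲₄`. -/
def IsInvariant (J : V →ₗ[ℝ] V) (T : V →ₗ[ℝ] V →ₗ[ℝ] V) : Prop :=
  ∀ u v, T (J u) (J v) = T u v

/-- `T_{J u} J v = -T_u v`, the symmetry of the tensors in `𝒲₁ + 𝒲₂`. -/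
def IsAntiInvariant (J : V →ₗ[ℝ] V) (T : V →ₗ[ℝ] V →ₗ[ℝ] V) : Prop :=
  ∀ u v, T (J u) (J v) = -T u v

theorem IsSkew.inner_apply_swap (hT : IsSkew T) (u v w : V) :
    inner ℝ (T u v) w = -inner ℝ (T u w) v := by
  rw [hT u v w, real_inner_comm]

theorem IsInvariant.map_left (hJ : IsOrthogonalComplex J) (hT : IsInvariant J T) (u v : V) :
    T (J u) v = -T u (J v) := by
  rw [← hT u (J v), hJ.sq, map_neg, neg_neg]

theorem IsAntiInvariant.map_left (hJ : IsOrthogonalComplex J) (hT : IsAntiInvariant J T)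
    (u v : V) : T (J u) v = T u (J v) := by
  rw [← neg_neg (T u (J v)), ← hT u (J v), hJ.sq, map_neg, neg_neg]

theorem IsInvariant.sub (hS : IsInvariant J S) (hT : IsInvariant J T) : IsInvariant J (S - T) :=
  fun u v ↦ by rw [LinearMap.sub_apply, LinearMap.sub_apply, LinearMap.sub_apply,
    LinearMap.sub_apply, hS, hT]

theorem IsInvariant.smul (c : ℝ) (hT : IsInvariant J T) : IsInvariant J (c • T) :=
  fun u v ↦ by simp only [LinearMap.smul_apply, hT u v]

theorem IsAntiInvariant.sub (hS : IsAntiInvariant J S) (hT : IsAntiInvariant J T) :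
    IsAntiInvariant J (S - T) := fun u v ↦ by
  simp only [LinearMap.sub_apply, hS u v, hT u v]
  abel

theorem inner_apply_map_right (hJ : IsOrthogonalComplex J) (hT : T ∈ torsionSpace J) (u v w : V) :
    inner ℝ (T u v) (J w) = inner ℝ (T u (J v)) w := by
  rw [hT.2, inner_neg_left, hJ.inner_map_left, neg_neg]

theorem compl₁₂_mem_torsionSpace (hJ : IsOrthogonalComplex J) (hT : T ∈ torsionSpace J) :
    T.compl₁₂ J J ∈ torsionSpace J := by
  refine ⟨fun u v w ↦ ?_, fun u v ↦ ?_⟩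
  · simp only [LinearMap.compl₁₂_apply]
    rw [hT.1, hT.2, inner_neg_right, hJ.inner_map_left]
  · simp only [LinearMap.compl₁₂_apply, hT.2, map_neg]

theorem part₁₂_apply (u v : V) : part₁₂ J T u v = (1 / 2 : ℝ) • (T u v - T (J u) (J v)) := rfl

theorem part₃₄_apply (u v : V) : part₃₄ J T u v = (1 / 2 : ℝ) • (T u v + T (J u) (J v)) := rfl

theorem part₁₂_add_part₃₄ : part₁₂ J T + part₃₄ J T = T := by
  rw [part₁₂, part₃₄]
  module

theorem part₁₂_mem_torsionSpace (hJ : IsOrthogonalComplex J) (hT : T ∈ torsionSpace J) :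
    part₁₂ J T ∈ torsionSpace J :=
  Submodule.smul_mem _ _ (Submodule.sub_mem _ hT (compl₁₂_mem_torsionSpace hJ hT))

theorem part₃₄_mem_torsionSpace (hJ : IsOrthogonalComplex J) (hT : T ∈ torsionSpace J) :
    part₃₄ J T ∈ torsionSpace J :=
  Submodule.smul_mem _ _ (Submodule.add_mem _ hT (compl₁₂_mem_torsionSpace hJ hT))

theorem isAntiInvariant_part₁₂ (hJ : IsOrthogonalComplex J) : IsAntiInvariant J (part₁₂ J T) := by
  intro u v
  simp only [part₁₂_apply, hJ.sq, map_neg, LinearMap.neg_apply, neg_neg]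
  module

theorem isInvariant_part₃₄ (hJ : IsOrthogonalComplex J) : IsInvariant J (part₃₄ J T) := by
  intro u v
  simp only [part₃₄_apply, hJ.sq, map_neg, LinearMap.neg_apply, neg_neg]
  module

theorem vectorTensor_apply (θ u v : V) :
    vectorTensor J θ u v = inner ℝ u v • θ - inner ℝ θ v • u + inner ℝ u (J v) • J θ
      - inner ℝ θ (J v) • J u := rfl

theorem vectorTensor_mem_torsionSpace (hJ : IsOrthogonalComplex J) (θ : V) :
    vectorTensor J θ ∈ torsionSpace J := by
  refine ⟨fun u v w ↦ ?_, fun u v ↦ ?_⟩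
  · simp only [vectorTensor_apply, inner_add_left, inner_sub_left, real_inner_smul_left,
      real_inner_comm _ v, hJ.inner_map_left]
    ring
  · simp only [vectorTensor_apply, map_add, map_sub, map_smul, hJ.sq, inner_neg_right]
    module

theorem isInvariant_vectorTensor (hJ : IsOrthogonalComplex J) (θ : V) :
    IsInvariant J (vectorTensor J θ) := by
  intro u v
  simp only [vectorTensor_apply, hJ.sq, inner_neg_right, hJ.inner_map, hJ.inner_map_left u v]
  module

theorem vectorTensor_self (θ u : V) : vectorTensor J θ θ u = 0 := by
  simp only [vectorTensor_apply]
  module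

theorem vectorTensor_smul (c : ℝ) (θ : V) : vectorTensor J (c • θ) = c • vectorTensor J θ := by
  ext u v
  simp only [vectorTensor_apply, LinearMap.smul_apply, real_inner_smul_left, map_smul]
  module

end Symmetries

section Components

variable {V : Type*} [NormedAddCommGroup V] [InnerProductSpace ℝ V] [FiniteDimensional ℝ V]
  {J : V →ₗ[ℝ] V} {T : V →ₗ[ℝ] V →ₗ[ℝ] V}

theorem inner_cyclicPart (hT : IsSkew T) (u v w : V) :
    inner ℝ (cyclicPart T u v) w
      = 1 / 3 * (inner ℝ (T u v) w + inner ℝ (T v w) u + inner ℝ (T w u) v) := by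
  simp only [cyclicPart, LinearMap.mk₂_apply, real_inner_smul_left, inner_add_left, inner_sub_left,
    LinearMap.adjoint_inner_left, LinearMap.flip_apply]
  rw [hT.inner_apply_swap v u w, real_inner_comm v]
  ring

theorem inner_cyclicPart_rotate (hT : IsSkew T) (u v w : V) :
    inner ℝ (cyclicPart T u v) w = inner ℝ (cyclicPart T v w) u := by
  rw [inner_cyclicPart hT, inner_cyclicPart hT]
  ring

theorem isSkew_cyclicPart (hT : IsSkew T) : IsSkew (cyclicPart T) := by
  intro u v w
  rw [real_inner_comm _ v, inner_cyclicPart hT, inner_cyclicPart hT, hT.inner_apply_swap u v w,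
    hT.inner_apply_swap v w u, hT.inner_apply_swap w u v]
  ring

theorem cyclicPart_self (hT : IsSkew T) (u : V) : cyclicPart T u u = 0 := by
  refine ext_inner_right ℝ fun w ↦ ?_
  have h := (isSkew_cyclicPart hT).inner_apply_swap w u u
  rw [inner_zero_left, ← inner_cyclicPart_rotate hT]
  linarith

theorem inner_cyclicPart_map_right (hJ : IsOrthogonalComplex J) (hT : T ∈ torsionSpace J)
    (h : IsAntiInvariant J T) (u v w : V) :
    inner ℝ (cyclicPart T u v) (J w) = inner ℝ (cyclicPart T u (J v)) w := by
  rw [inner_cyclicPart hT.1, inner_cyclicPart hT.1, inner_apply_map_right hJ hT u v w,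
    h.map_left hJ v w, h.map_left hJ w u, inner_apply_map_right hJ hT w u v]

theorem cyclicPart_mem_torsionSpace (hJ : IsOrthogonalComplex J) (hT : T ∈ torsionSpace J)
    (h : IsAntiInvariant J T) : cyclicPart T ∈ torsionSpace J := by
  refine ⟨isSkew_cyclicPart hT.1, fun u v ↦ ext_inner_right ℝ fun w ↦ ?_⟩
  rw [← inner_cyclicPart_map_right hJ hT h, inner_neg_left, hJ.inner_map_left, neg_neg]

theorem isAntiInvariant_cyclicPart (hJ : IsOrthogonalComplex J) (hT : T ∈ torsionSpace J)
    (h : IsAntiInvariant J T) : IsAntiInvariant J (cyclicPart T) := by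
  refine fun u v ↦ ext_inner_right ℝ fun w ↦ ?_
  rw [inner_neg_left, ← inner_cyclicPart_map_right hJ hT h, inner_cyclicPart_rotate hT.1,
    ← inner_cyclicPart_map_right hJ hT h, hJ.sq, inner_neg_right, ← inner_cyclicPart_rotate hT.1]

theorem comp₁_mem_torsionSpace (hJ : IsOrthogonalComplex J) (hT : T ∈ torsionSpace J) :
    comp₁ J T ∈ torsionSpace J :=
  cyclicPart_mem_torsionSpace hJ (part₁₂_mem_torsionSpace hJ hT) (isAntiInvariant_part₁₂ hJ)

theorem isAntiInvariant_comp₁ (hJ : IsOrthogonalComplex J) (hT : T ∈ torsionSpace J) :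
    IsAntiInvariant J (comp₁ J T) :=
  isAntiInvariant_cyclicPart hJ (part₁₂_mem_torsionSpace hJ hT) (isAntiInvariant_part₁₂ hJ)

theorem inner_comp₁_rotate (hJ : IsOrthogonalComplex J) (hT : T ∈ torsionSpace J) (u v w : V) :
    inner ℝ (comp₁ J T u v) w = inner ℝ (comp₁ J T v w) u :=
  inner_cyclicPart_rotate (part₁₂_mem_torsionSpace hJ hT).1 u v w

theorem comp₁_mem_W₁ (hJ : IsOrthogonalComplex J) (hT : T ∈ torsionSpace J) : comp₁ J T ∈ W₁ J :=
  ⟨comp₁_mem_torsionSpace hJ hT, cyclicPart_self (part₁₂_mem_torsionSpace hJ hT).1⟩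

theorem comp₂_mem_torsionSpace (hJ : IsOrthogonalComplex J) (hT : T ∈ torsionSpace J) :
    comp₂ J T ∈ torsionSpace J :=
  Submodule.sub_mem _ (part₁₂_mem_torsionSpace hJ hT) (comp₁_mem_torsionSpace hJ hT)

theorem isAntiInvariant_comp₂ (hJ : IsOrthogonalComplex J) (hT : T ∈ torsionSpace J) :
    IsAntiInvariant J (comp₂ J T) :=
  (isAntiInvariant_part₁₂ hJ).sub (isAntiInvariant_comp₁ hJ hT)

theorem cyclicSum_inner_comp₂ (hJ : IsOrthogonalComplex J) (hT : T ∈ torsionSpace J)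
    (u v w : V) :
    inner ℝ (comp₂ J T u v) w + inner ℝ (comp₂ J T v w) u + inner ℝ (comp₂ J T w u) v = 0 := by
  simp only [comp₂, LinearMap.sub_apply, inner_sub_left, comp₁,
    inner_cyclicPart (part₁₂_mem_torsionSpace hJ hT).1]
  ring

theorem comp₂_mem_W₂ (hJ : IsOrthogonalComplex J) (hT : T ∈ torsionSpace J) :
    comp₂ J T ∈ W₂ J := by
  have hmem := comp₂_mem_torsionSpace hJ hT
  refine ⟨hmem, fun u v w ↦ ?_⟩
  rw [inner_apply_map_right hJ hmem v w u, inner_apply_map_right hJ hmem w u v,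
    ← (isAntiInvariant_comp₂ hJ hT).map_left hJ w u]
  exact cyclicSum_inner_comp₂ hJ hT u v (J w)

theorem traceVector_vectorTensor (hJ : IsOrthogonalComplex J) (θ : V) :
    traceVector (vectorTensor J θ) = ((Module.finrank ℝ V : ℝ) - 2) • θ := by
  have hθ := sum_inner_smul_map (stdOrthonormalBasis ℝ V) LinearMap.id θ
  have hJθ := sum_inner_smul_map (stdOrthonormalBasis ℝ V) J (J θ)
  simp only [LinearMap.id_apply, real_inner_comm θ] at hθ
  simp only [hJ.sq, real_inner_comm (J θ), hJ.inner_map_left θ, neg_smul,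
    Finset.sum_neg_distrib, neg_inj] at hJθ
  simp only [traceVector, vectorTensor_apply, hJ.inner_map_self, zero_smul, add_zero,
    Finset.sum_sub_distrib, hθ, hJθ, real_inner_self_eq_norm_sq, OrthonormalBasis.norm_eq_one,
    one_pow, one_smul, Finset.sum_const, Finset.card_univ, Fintype.card_fin,
    ← Nat.cast_smul_eq_nsmul ℝ]
  module

theorem traceVector_part₃₄ (hJ : IsOrthogonalComplex J) :
    traceVector (part₃₄ J T) = traceVector T := by
  rw [traceVector_eq_metricTrace, part₃₄, map_smul, map_add, hJ.metricTrace_compl₁₂,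
    traceVector_eq_metricTrace]
  module

variable {n : ℕ}

theorem comp₄_mem_torsionSpace (hJ : IsOrthogonalComplex J) : comp₄ n J T ∈ torsionSpace J :=
  Submodule.smul_mem _ _ (vectorTensor_mem_torsionSpace hJ _)

theorem isInvariant_comp₄ (hJ : IsOrthogonalComplex J) : IsInvariant J (comp₄ n J T) :=
  (isInvariant_vectorTensor hJ _).smul _

theorem comp₄_mem_W₄ : comp₄ n J T ∈ W₄ J :=
  ⟨(1 / (2 * ((n : ℝ) - 1))) • traceVector T, (vectorTensor_smul _ _).symm⟩

theorem traceVector_comp₄ (hJ : IsOrthogonalComplex J) (hn : n ≠ 1)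
    (hV : Module.finrank ℝ V = 2 * n) : traceVector (comp₄ n J T) = traceVector T := by
  have hn' : (n : ℝ) - 1 ≠ 0 := sub_ne_zero.2 (mod_cast hn)
  have hc : 1 / (2 * ((n : ℝ) - 1)) * (2 * n - 2) = 1 := by
    field_simp
  rw [traceVector_eq_metricTrace, comp₄, map_smul, ← traceVector_eq_metricTrace,
    traceVector_vectorTensor hJ, hV, smul_smul, Nat.cast_mul, Nat.cast_ofNat, hc, one_smul]

theorem comp₃_mem_torsionSpace (hJ : IsOrthogonalComplex J) (hT : T ∈ torsionSpace J) :
    comp₃ n J T ∈ torsionSpace J :=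
  Submodule.sub_mem _ (part₃₄_mem_torsionSpace hJ hT) (comp₄_mem_torsionSpace hJ)

theorem isInvariant_comp₃ (hJ : IsOrthogonalComplex J) : IsInvariant J (comp₃ n J T) :=
  (isInvariant_part₃₄ hJ).sub (isInvariant_comp₄ hJ)

theorem comp₃_mem_W₃ (hJ : IsOrthogonalComplex J) (hT : T ∈ torsionSpace J) (hn : n ≠ 1)
    (hV : Module.finrank ℝ V = 2 * n) : comp₃ n J T ∈ W₃ J := by
  refine ⟨comp₃_mem_torsionSpace hJ hT, isInvariant_comp₃ hJ, ?_⟩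
  rw [traceVector_eq_metricTrace, comp₃, map_sub, ← traceVector_eq_metricTrace,
    ← traceVector_eq_metricTrace, traceVector_part₃₄ hJ, traceVector_comp₄ hJ hn hV, sub_self]

theorem comp₁_add_comp₂ : comp₁ J T + comp₂ J T = part₁₂ J T := add_sub_cancel _ _

theorem comp₃_add_comp₄ : comp₃ n J T + comp₄ n J T = part₃₄ J T := sub_add_cancel _ _

theorem eq_sum_comp : T = comp₁ J T + comp₂ J T + comp₃ n J T + comp₄ n J T := by
  rw [comp₁_add_comp₂, add_assoc, comp₃_add_comp₄, part₁₂_add_part₃₄]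

end Components

/-! ### Contractions of two torsion tensors -/

section Contraction

variable {V : Type*} [NormedAddCommGroup V] [InnerProductSpace ℝ V]
  {J : V →ₗ[ℝ] V} {P Q A B T : V →ₗ[ℝ] V →ₗ[ℝ] V} {ι : Type*} [Fintype ι]
  (e : OrthonormalBasis ι ℝ V) (X Y : V)

theorem vectorTensor_eq_smulRight (hJ : IsOrthogonalComplex J) (θ : V) :
    vectorTensor J θ X = (innerₗ V X).smulRight θ - (innerₗ V θ).smulRight X
      - (innerₗ V (J X)).smulRight (J θ) + (innerₗ V (J θ)).smulRight (J X) := by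
  ext v
  simp only [vectorTensor_apply, LinearMap.add_apply, LinearMap.sub_apply,
    LinearMap.smulRight_apply, innerₗ_apply_apply, hJ.inner_map_left]
  module

theorem divTerm_vectorTensor (hJ : IsOrthogonalComplex J) (t : V →ₗ[ℝ] V) :
    divTerm e (fun u v w ↦ vectorTensor J (t u) v w) X Y
      = inner ℝ (t X) Y - inner ℝ (t Y) X
        - inner ℝ (t (J X)) (J Y) + inner ℝ (t (J Y)) (J X) := by
  have h : ∀ i, inner ℝ (vectorTensor J (t (e i)) (e i) X) Y
      = inner ℝ (e i) X * inner ℝ (t (e i)) Y - inner ℝ (e i) Y * inner ℝ (t (e i)) X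
        - inner ℝ (e i) (J X) * inner ℝ (t (e i)) (J Y)
        + inner ℝ (e i) (J Y) * inner ℝ (t (e i)) (J X) := by
    intro i
    simp only [vectorTensor_apply, real_inner_smul_left, inner_add_left, inner_sub_left,
      hJ.inner_map_left]
    ring
  simp only [divTerm, h, Finset.sum_add_distrib, Finset.sum_sub_distrib,
    sum_inner_mul_inner_map]

variable [FiniteDimensional ℝ V]

theorem sum_inner_apply_apply_comm (hT : IsSkew T) :
    ∑ i, inner ℝ (T (T (e i) X) (e i)) Y = ∑ i, inner ℝ (T (T (e i) Y) (e i)) X := by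
  have eq_neg_trace : ∀ X Y, ∑ i, inner ℝ (T (T (e i) X) (e i)) Y
      = -LinearMap.trace ℝ V (T.flip Y ∘ₗ T.flip X) := by
    intro X Y
    rw [LinearMap.trace_eq_sum_inner _ e, ← Finset.sum_neg_distrib]
    exact Finset.sum_congr rfl fun i _ ↦ hT _ _ _
  rw [eq_neg_trace, eq_neg_trace, LinearMap.trace_comp_comm']

/-- The contraction `∑ i, ⟨P_{Q_X e_i} e_i, Y⟩` of two torsion tensors, through which all terms
quadratic in the torsion are compared. -/
def contraction (P Q : V →ₗ[ℝ] V →ₗ[ℝ] V) (X Y : V) : ℝ :=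
  inner ℝ (metricTrace (P ∘ₗ Q X)) Y

theorem contraction_eq_sum :
    contraction P Q X Y = ∑ i, inner ℝ (P (Q X (e i)) (e i)) Y :=
  inner_metricTrace e _ Y

theorem contraction_add_left (P P' Q : V →ₗ[ℝ] V →ₗ[ℝ] V) :
    contraction (P + P') Q X Y = contraction P Q X Y + contraction P' Q X Y := by
  rw [contraction, LinearMap.add_comp, map_add, inner_add_left, contraction, contraction]

theorem contraction_add_right (P Q Q' : V →ₗ[ℝ] V →ₗ[ℝ] V) :
    contraction P (Q + Q') X Y = contraction P Q X Y + contraction P Q' X Y := by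
  rw [contraction, LinearMap.add_apply, LinearMap.comp_add, map_add, inner_add_left, contraction,
    contraction]

theorem contraction_smul_right (c : ℝ) (P Q : V →ₗ[ℝ] V →ₗ[ℝ] V) :
    contraction P (c • Q) X Y = c * contraction P Q X Y := by
  rw [contraction, LinearMap.smul_apply, LinearMap.comp_smul, map_smul, real_inner_smul_left,
    contraction]

theorem metricTrace_comp_comp_map (hJ : IsOrthogonalComplex J) (hP : P ∈ torsionSpace J)
    (a : V →ₗ[ℝ] V) : metricTrace (P ∘ₗ a ∘ₗ J) = J (metricTrace (P ∘ₗ a)) := by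
  have h : (P ∘ₗ a).compl₂ J = -(P ∘ₗ a).compr₂ J := by
    ext u v
    exact hP.2 _ _
  rw [← LinearMap.comp_assoc, hJ.metricTrace_comp, h, map_neg, neg_neg, metricTrace_compr₂]

theorem contraction_map_map_of_isAntiInvariant (hJ : IsOrthogonalComplex J)
    (hP : P ∈ torsionSpace J) (hQ : IsAntiInvariant J Q) :
    contraction P Q (J X) (J Y) = contraction P Q X Y := by
  have h : Q (J X) = Q X ∘ₗ J := LinearMap.ext (hQ.map_left hJ X)
  rw [contraction, h, metricTrace_comp_comp_map hJ hP, hJ.inner_map, contraction]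

theorem contraction_map_map_of_isInvariant (hJ : IsOrthogonalComplex J)
    (hP : P ∈ torsionSpace J) (hQ : IsInvariant J Q) :
    contraction P Q (J X) (J Y) = -contraction P Q X Y := by
  have h : Q (J X) = -(Q X ∘ₗ J) := LinearMap.ext (hQ.map_left hJ X)
  rw [contraction, h, LinearMap.comp_neg, map_neg, inner_neg_left,
    metricTrace_comp_comp_map hJ hP, hJ.inner_map, contraction]

theorem contraction_eq_zero_of_isInvariant (hJ : IsOrthogonalComplex J) (hP : IsInvariant J P)
    (hQ : Q ∈ torsionSpace J) : contraction P Q X Y = 0 := by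
  have h : (P ∘ₗ Q X).compl₁₂ J J = -(P ∘ₗ Q X) := by
    ext u v
    simp only [LinearMap.compl₁₂_apply, LinearMap.comp_apply, hQ.2, map_neg, LinearMap.neg_apply,
      hP _ _]
  have htrace := hJ.metricTrace_compl₁₂ (P ∘ₗ Q X)
  rw [h, map_neg] at htrace
  have hzero := congrArg (inner ℝ · Y) htrace
  simp only [inner_neg_left] at hzero
  rw [contraction]
  linarith

theorem sum_inner_eq_contraction (hA : IsSkew A) (hB : IsSkew B) :
    ∑ i, inner ℝ (A X (e i)) (B (e i) Y) = contraction B A X Y := by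
  have h := metricTrace_comp_eq_compl₂ (a := A X) (a' := -A X) (fun v w ↦ by
    rw [hA, LinearMap.neg_apply, inner_neg_right]) B
  rw [contraction, h, inner_metricTrace e]
  refine Finset.sum_congr rfl fun i _ ↦ ?_
  rw [LinearMap.compl₂_apply, LinearMap.neg_apply, map_neg, inner_neg_left, hB, neg_neg]

theorem mixedTerm_eq_contraction (hA : IsSkew A) (hB : IsSkew B) :
    mixedTerm e A B X Y = contraction B A X Y - contraction B A Y X := by
  rw [mixedTerm, Finset.sum_sub_distrib, sum_inner_eq_contraction e _ _ hA hB,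
    sum_inner_eq_contraction e _ _ hA hB]

theorem contraction_vectorTensor (hJ : IsOrthogonalComplex J) (hP : IsAntiInvariant J P)
    (θ : V) :
    contraction P (vectorTensor J θ) X Y = 2 * (inner ℝ (P θ X) Y - inner ℝ (P X θ) Y) := by
  have h : metricTrace (P ∘ₗ vectorTensor J θ X) = (2 : ℝ) • (P θ X - P X θ) := by
    rw [vectorTensor_eq_smulRight X hJ, LinearMap.comp_add, LinearMap.comp_sub, LinearMap.comp_sub,
      map_add, map_sub, map_sub]
    simp only [metricTrace_comp_smulRight_innerₗ, hP _ _]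
    module
  rw [contraction, h, real_inner_smul_left, inner_sub_left]

end Contraction

section Expansion

variable {V : Type*} [NormedAddCommGroup V] [InnerProductSpace ℝ V] [FiniteDimensional ℝ V]
  {J : V →ₗ[ℝ] V} {T : V →ₗ[ℝ] V →ₗ[ℝ] V} {D : V →ₗ[ℝ] V →ₗ[ℝ] V →ₗ[ℝ] V}
  {ι : Type*} [Fintype ι] (e : OrthonormalBasis ι ℝ V) {n : ℕ} (X Y : V)

theorem traceTerm_eq_inner (A B : V →ₗ[ℝ] V →ₗ[ℝ] V) :
    traceTerm e A B X Y = inner ℝ (A (traceVector B) X) Y := by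
  rw [traceVector_eq_metricTrace, metricTrace_eq_sum e, map_sum, LinearMap.sum_apply, sum_inner,
    traceTerm]

theorem divTerm_comp₄ (hJ : IsOrthogonalComplex J) (hn : n ≠ 1) :
    2 * ((n : ℝ) - 1) * divTerm e (fun u v w ↦ comp₄ n J (D u) v w) X Y
      = inner ℝ (traceVector (D X)) Y - inner ℝ (traceVector (D Y)) X
        - inner ℝ (traceVector (D (J X))) (J Y) + inner ℝ (traceVector (D (J Y))) (J X) := by
  have hn' : (n : ℝ) - 1 ≠ 0 := sub_ne_zero.2 (mod_cast hn)
  have h := divTerm_vectorTensor e X Y hJ (metricTrace ∘ₗ D)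
  simp only [LinearMap.comp_apply, ← traceVector_eq_metricTrace] at h
  rw [← h, divTerm, divTerm, Finset.mul_sum]
  refine Finset.sum_congr rfl fun i _ ↦ ?_
  rw [comp₄, LinearMap.smul_apply, LinearMap.smul_apply, real_inner_smul_left]
  field_simp

theorem contraction_part₁₂_part₃₄_sub_swap (hJ : IsOrthogonalComplex J)
    (hT : T ∈ torsionSpace J) (hn : n ≠ 1) (hV : Module.finrank ℝ V = 2 * n) :
    contraction (part₁₂ J T) (part₃₄ J T) X Y - contraction (part₁₂ J T) (part₃₄ J T) Y X
      = mixedTerm e (comp₃ n J T) (comp₁ J T) X Y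
        + 4 / ((n : ℝ) - 1) * traceTerm e (comp₁ J T) (comp₄ n J T) X Y
        + mixedTerm e (comp₃ n J T) (comp₂ J T) X Y
        + 1 / ((n : ℝ) - 1) * traceTerm e (comp₂ J T) (comp₄ n J T) X Y := by
  have hn' : (n : ℝ) - 1 ≠ 0 := sub_ne_zero.2 (mod_cast hn)
  have mem₁ := comp₁_mem_torsionSpace hJ hT
  have mem₂ := comp₂_mem_torsionSpace hJ hT
  have mem₃ := comp₃_mem_torsionSpace (n := n) hJ hT
  have rotate₁ := inner_comp₁_rotate hJ hT (traceVector T) X Y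
  have rotate₁' := inner_comp₁_rotate hJ hT X Y (traceVector T)
  have cyclic₂ := cyclicSum_inner_comp₂ hJ hT (traceVector T) X Y
  rw [← comp₁_add_comp₂, ← comp₃_add_comp₄ (n := n)]
  simp only [mixedTerm_eq_contraction e _ _ mem₃.1 mem₁.1,
    mixedTerm_eq_contraction e _ _ mem₃.1 mem₂.1, traceTerm_eq_inner, traceVector_comp₄ hJ hn hV]
  simp only [contraction_add_left, contraction_add_right, comp₄, contraction_smul_right,
    contraction_vectorTensor _ _ hJ (isAntiInvariant_comp₁ hJ hT),
    contraction_vectorTensor _ _ hJ (isAntiInvariant_comp₂ hJ hT)]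
  have swap₁ := IsSkew.inner_apply_swap mem₁.1
  have swap₂ := IsSkew.inner_apply_swap mem₂.1
  field_simp
  linarith [swap₁ X Y (traceVector T), swap₂ X Y (traceVector T), swap₁ (traceVector T) X Y,
    swap₂ (traceVector T) X Y]

theorem inner_apply_map_traceVector (hJ : IsOrthogonalComplex J) (hT : T ∈ torsionSpace J)
    (hn : n ≠ 1) (hV : Module.finrank ℝ V = 2 * n) :
    inner ℝ (T (J (traceVector T)) X) (J Y)
      = -traceTerm e (comp₁ J T) (comp₄ n J T) X Y - traceTerm e (comp₂ J T) (comp₄ n J T) X Y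
        + traceTerm e (comp₃ n J T) (comp₄ n J T) X Y := by
  have h₄ : comp₄ n J T (traceVector T) X = 0 := by
    rw [comp₄, LinearMap.smul_apply, LinearMap.smul_apply, vectorTensor_self, smul_zero]
  rw [inner_apply_map_right hJ hT]
  nth_rewrite 1 [eq_sum_comp (T := T) (J := J) (n := n)]
  simp only [traceTerm_eq_inner, traceVector_comp₄ hJ hn hV, LinearMap.add_apply,
    isAntiInvariant_comp₁ hJ hT _ _, isAntiInvariant_comp₂ hJ hT _ _, isInvariant_comp₃ hJ _ _,
    isInvariant_comp₄ hJ _ _, h₄, inner_add_left, inner_neg_left, inner_zero_left]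
  ring

theorem contraction_part₁₂_sub_map_map (hJ : IsOrthogonalComplex J) (hT : T ∈ torsionSpace J) :
    contraction (part₁₂ J T) T X Y - contraction (part₁₂ J T) T (J X) (J Y)
      = 2 * contraction (part₁₂ J T) (part₃₄ J T) X Y := by
  have hP := part₁₂_mem_torsionSpace hJ hT
  have hsplit : ∀ X Y, contraction (part₁₂ J T) T X Y
      = contraction (part₁₂ J T) (part₁₂ J T) X Y + contraction (part₁₂ J T) (part₃₄ J T) X Y :=
    fun X Y ↦ by rw [← contraction_add_right, part₁₂_add_part₃₄]
  rw [hsplit, hsplit, contraction_map_map_of_isAntiInvariant X Y hJ hP (isAntiInvariant_part₁₂ hJ),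
    contraction_map_map_of_isInvariant X Y hJ hP (isInvariant_part₃₄ hJ)]
  ring

theorem contraction_part₃₄_self (hJ : IsOrthogonalComplex J) (hT : T ∈ torsionSpace J) :
    contraction (part₃₄ J T) T X Y = 0 :=
  contraction_eq_zero_of_isInvariant X Y hJ (isInvariant_part₃₄ hJ) hT

theorem contraction_self (hJ : IsOrthogonalComplex J) (hT : T ∈ torsionSpace J) :
    contraction T T X Y = contraction (part₁₂ J T) T X Y := by
  conv_lhs => enter [1]; rw [← part₁₂_add_part₃₄ (J := J) (T := T)]
  rw [contraction_add_left, contraction_part₃₄_self X Y hJ hT, add_zero]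

/-! ### The two expressions for the `*`-Ricci curvature -/

theorem ricciTerm_eq_contraction (hT : IsSkew T) (hD : ∀ u, IsSkew (D u)) :
    ricciTerm e (fun u v w ↦ D u v w) T X Y
      = ∑ i, inner ℝ (D (e i) X Y) (e i) + inner ℝ (traceVector (D X)) Y
        + contraction T T X Y := by
  rw [ricciTerm, traceVector_eq_metricTrace, inner_metricTrace e, contraction_eq_sum e,
    ← Finset.sum_add_distrib, ← Finset.sum_add_distrib]
  refine Finset.sum_congr rfl fun i _ ↦ ?_
  rw [(hD X).inner_apply_swap (e i) Y, hT.inner_apply_swap _ Y]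
  ring

theorem inner_part₁₂_sub_swap (hJ : IsOrthogonalComplex J) (hT : T ∈ torsionSpace J) (u : V) :
    inner ℝ (part₁₂ J T X Y) u - inner ℝ (part₁₂ J T Y X) u
      = 2 * inner ℝ (comp₁ J T u X) Y - inner ℝ (comp₂ J T u X) Y := by
  have rotate₁ := inner_comp₁_rotate hJ hT u X Y
  have rotate₁' := inner_comp₁_rotate hJ hT Y u X
  have swap₁ := IsSkew.inner_apply_swap (comp₁_mem_torsionSpace hJ hT).1 Y X u
  have cyclic₂ := cyclicSum_inner_comp₂ hJ hT u X Y
  have swap₂ := IsSkew.inner_apply_swap (comp₂_mem_torsionSpace hJ hT).1 Y X u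
  simp only [← comp₁_add_comp₂, LinearMap.add_apply, inner_add_left]
  linarith

theorem sum_inner_part₁₂_sub_swap (hJ : IsOrthogonalComplex J)
    (hD : ∀ u, D u ∈ torsionSpace J) :
    ∑ i, inner ℝ (D (e i) X Y) (e i) - ∑ i, inner ℝ (D (e i) Y X) (e i)
      - ∑ i, inner ℝ (D (e i) (J X) (J Y)) (e i) + ∑ i, inner ℝ (D (e i) (J Y) (J X)) (e i)
      = 4 * divTerm e (fun u v w ↦ comp₁ J (D u) v w) X Y
        - 2 * divTerm e (fun u v w ↦ comp₂ J (D u) v w) X Y := by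
  simp only [divTerm, Finset.mul_sum, ← Finset.sum_sub_distrib, ← Finset.sum_add_distrib]
  refine Finset.sum_congr rfl fun i _ ↦ ?_
  have h := inner_part₁₂_sub_swap X Y hJ (hD (e i)) (e i)
  simp only [part₁₂_apply, real_inner_smul_left, inner_sub_left] at h
  linarith

theorem ricciStarExpr_eq (hJ : IsOrthogonalComplex J) (hT : T ∈ torsionSpace J)
    (hD : ∀ u, D u ∈ torsionSpace J) (hn : n ≠ 1) (hV : Module.finrank ℝ V = 2 * n) :
    ricciStarExpr J e (fun u v w ↦ D u v w) T X Y
      = -divTerm e (fun u v w ↦ comp₂ J (D u) v w) X Y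
        + 2 * divTerm e (fun u v w ↦ comp₁ J (D u) v w) X Y
        + ((n : ℝ) - 1) * divTerm e (fun u v w ↦ comp₄ n J (D u) v w) X Y
        + mixedTerm e (comp₃ n J T) (comp₁ J T) X Y
        + 4 / ((n : ℝ) - 1) * traceTerm e (comp₁ J T) (comp₄ n J T) X Y
        + mixedTerm e (comp₃ n J T) (comp₂ J T) X Y
        + 1 / ((n : ℝ) - 1) * traceTerm e (comp₂ J T) (comp₄ n J T) X Y := by
  simp only [ricciStarExpr, ricciTerm_eq_contraction e _ _ hT.1 fun u ↦ (hD u).1,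
    contraction_self _ _ hJ hT]
  linarith [contraction_part₁₂_part₃₄_sub_swap e X Y hJ hT hn hV,
    divTerm_comp₄ (D := D) e X Y hJ hn, contraction_part₁₂_sub_map_map X Y hJ hT,
    contraction_part₁₂_sub_map_map Y X hJ hT, sum_inner_part₁₂_sub_swap e X Y hJ hD]

theorem inner_apply_map_map (hJ : IsOrthogonalComplex J) (hT : T ∈ torsionSpace J) (u : V) :
    inner ℝ (T (J u) (J X)) Y = -inner ℝ (comp₂ J T u X) Y - inner ℝ (comp₁ J T u X) Y
      + inner ℝ (comp₃ n J T u X) Y + inner ℝ (comp₄ n J T u X) Y := by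
  nth_rewrite 1 [eq_sum_comp (T := T) (J := J) (n := n)]
  simp only [LinearMap.add_apply, isAntiInvariant_comp₁ hJ hT _ _,
    isAntiInvariant_comp₂ hJ hT _ _, isInvariant_comp₃ hJ _ _, isInvariant_comp₄ hJ _ _,
    inner_add_left, inner_neg_left]
  ring

theorem ricciStarExpr'_eq (hJ : IsOrthogonalComplex J) (hT : T ∈ torsionSpace J)
    (hD : ∀ u, D u ∈ torsionSpace J) (hn : n ≠ 1) (hV : Module.finrank ℝ V = 2 * n) :
    ricciStarExpr' J e (fun u v w ↦ D u v w) T X Y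
      = -divTerm e (fun u v w ↦ comp₂ J (D u) v w) X Y
        - divTerm e (fun u v w ↦ comp₁ J (D u) v w) X Y
        + divTerm e (fun u v w ↦ comp₃ n J (D u) v w) X Y
        + divTerm e (fun u v w ↦ comp₄ n J (D u) v w) X Y
        + traceTerm e (comp₁ J T) (comp₄ n J T) X Y + traceTerm e (comp₂ J T) (comp₄ n J T) X Y
        - traceTerm e (comp₃ n J T) (comp₄ n J T) X Y := by
  have htrace : ∑ i, inner ℝ (T (J (T (e i) (e i))) (J X)) Y
      = inner ℝ (T (J (traceVector T)) X) (J Y) := by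
    rw [inner_apply_map_right hJ hT, traceVector_eq_metricTrace, metricTrace_eq_sum e, map_sum,
      map_sum, LinearMap.sum_apply, sum_inner]
  rw [ricciStarExpr', Finset.sum_sub_distrib, htrace,
    inner_apply_map_traceVector e X Y hJ hT hn hV]
  simp only [inner_apply_map_map (n := n) X Y hJ (hD (e _)), Finset.sum_add_distrib,
    Finset.sum_sub_distrib, Finset.sum_neg_distrib, divTerm]
  ring

end Expansion

/-! ### The exterior derivatives of the Kähler form, algebraically -/

section CyclicForm

variable {V : Type*} [NormedAddCommGroup V] [InnerProductSpace ℝ V]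
  {J : V →ₗ[ℝ] V} {S T : V →ₗ[ℝ] V →ₗ[ℝ] V} {D : V →ₗ[ℝ] V →ₗ[ℝ] V →ₗ[ℝ] V}
  {ι : Type*} [Fintype ι] (e : OrthonormalBasis ι ℝ V)

/-- Twice the cyclic sum of `⟨S_u v, J w⟩`; for the intrinsic torsion this is the exterior
derivative of the Kähler form. -/
def cyclicForm (J : V →ₗ[ℝ] V) (S : V →ₗ[ℝ] V →ₗ[ℝ] V) (u v w : V) : ℝ :=
  2 * (inner ℝ (S u v) (J w) + inner ℝ (S v w) (J u) + inner ℝ (S w u) (J v))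

/-- The exterior derivative of the `3`-form `cyclicForm J T` in terms of a connection with torsion
`(a, b) ↦ T_a b - T_b a` for which the derivative of `T` is `D`. -/
def cyclicFormDeriv (J : V →ₗ[ℝ] V) (D : V →ₗ[ℝ] V →ₗ[ℝ] V →ₗ[ℝ] V) (T : V →ₗ[ℝ] V →ₗ[ℝ] V)
    (t u v w : V) : ℝ :=
  cyclicForm J (D t) u v w - cyclicForm J (D u) t v w
    + cyclicForm J (D v) t u w - cyclicForm J (D w) t u v
    + cyclicForm J T (T t u - T u t) v w - cyclicForm J T (T t v - T v t) u w
    + cyclicForm J T (T t w - T w t) u v + cyclicForm J T (T u v - T v u) t w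
    - cyclicForm J T (T u w - T w u) t v + cyclicForm J T (T v w - T w v) t u

theorem cyclicForm_rotate (u v w : V) : cyclicForm J S u v w = cyclicForm J S v w u := by
  rw [cyclicForm, cyclicForm]
  ring

theorem inner_apply_map_swap (hJ : IsOrthogonalComplex J) (hS : S ∈ torsionSpace J) (u v w : V) :
    inner ℝ (S u v) (J w) = -inner ℝ (S u w) (J v) := by
  rw [inner_apply_map_right hJ hS, hS.1, real_inner_comm]

theorem cyclicForm_swap (hJ : IsOrthogonalComplex J) (hS : S ∈ torsionSpace J) (u v w : V) :
    cyclicForm J S u v w = -cyclicForm J S v u w := by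
  rw [cyclicForm, cyclicForm, inner_apply_map_swap hJ hS v u w, inner_apply_map_swap hJ hS u w v,
    inner_apply_map_swap hJ hS w v u]
  ring

theorem cyclicForm_add (S S' : V →ₗ[ℝ] V →ₗ[ℝ] V) (u v w : V) :
    cyclicForm J (S + S') u v w = cyclicForm J S u v w + cyclicForm J S' u v w := by
  simp only [cyclicForm, LinearMap.add_apply, inner_add_left]
  ring

theorem isLinearMap_cyclicForm_tensor (u v w : V) : IsLinearMap ℝ (cyclicForm J · u v w) where
  map_add S S' := cyclicForm_add S S' u v w
  map_smul c S := by
    simp only [cyclicForm, LinearMap.smul_apply, real_inner_smul_left, smul_eq_mul]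
    ring

theorem isLinearMap_cyclicForm (v w : V) : IsLinearMap ℝ (cyclicForm J S · v w) where
  map_add u u' := by
    simp only [cyclicForm, map_add, LinearMap.add_apply, inner_add_left, inner_add_right]
    ring
  map_smul c u := by
    simp only [cyclicForm, map_smul, LinearMap.smul_apply, real_inner_smul_left,
      real_inner_smul_right, smul_eq_mul]
    ring

theorem isLinearMap_cyclicFormDeriv (u v w : V) :
    IsLinearMap ℝ (cyclicFormDeriv J D T · u v w) where
  map_add t t' := by
    simp only [cyclicFormDeriv, cyclicForm, map_add, map_sub, LinearMap.add_apply,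
      LinearMap.sub_apply, inner_add_left, inner_sub_left, inner_add_right, inner_sub_right]
    ring
  map_smul c t := by
    simp only [cyclicFormDeriv, cyclicForm, map_smul, map_sub, LinearMap.smul_apply,
      LinearMap.sub_apply, inner_sub_left, inner_sub_right, real_inner_smul_left,
      real_inner_smul_right, smul_eq_mul]
    ring

theorem sum_cyclicForm_map_left (hJ : IsOrthogonalComplex J) (X Y : V) :
    ∑ i, cyclicForm J (D (J (e i))) (e i) X Y = -∑ i, cyclicForm J (D (e i)) (J (e i)) X Y :=
  hJ.sum_map_left e (f := fun a b ↦ cyclicForm J (D a) b X Y)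
    (fun b ↦ ((isLinearMap_cyclicForm_tensor b X Y).mk' _ ∘ₗ D).isLinear)
    (fun _ ↦ isLinearMap_cyclicForm X Y)

theorem sum_cyclicForm_torsion_map_left (hJ : IsOrthogonalComplex J) (X Y : V) :
    ∑ i, cyclicForm J T (T (J (e i)) X - T X (J (e i))) (e i) Y
      = -∑ i, cyclicForm J T (T (e i) X - T X (e i)) (J (e i)) Y := by
  refine hJ.sum_map_left e (f := fun a b ↦ cyclicForm J T (T a X - T X a) b Y)
    (fun b ↦ ((isLinearMap_cyclicForm b Y).mk' _ ∘ₗ (T.flip X - T X)).isLinear) fun a ↦ ?_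
  simp only [cyclicForm_rotate (T a X - T X a)]
  exact isLinearMap_cyclicForm Y _

theorem sum_torsion_map_left (hJ : IsOrthogonalComplex J) (hT : T ∈ torsionSpace J) :
    ∑ i, (T (J (e i)) (e i) - T (e i) (J (e i))) = (2 : ℝ) • J (∑ i, T (e i) (e i)) := by
  have hrotate := hJ.sum_map_left e (f := fun a b ↦ T a b) (fun b ↦ (T.flip b).isLinear)
    (fun a ↦ (T a).isLinear)
  rw [Finset.sum_sub_distrib, hrotate, map_sum, two_smul]
  simp only [hT.2, Finset.sum_neg_distrib]
  abel

theorem sum_sum_inner_mul (f : V → V →ₗ[ℝ] ℝ) :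
    ∑ i, ∑ j, inner ℝ (e i) (J (e j)) * f (e j) (e i) = ∑ j, f (e j) (J (e j)) := by
  rw [Finset.sum_comm]
  exact Finset.sum_congr rfl fun j _ ↦ sum_inner_smul_map e (f (e j)) (J (e j))

theorem cyclicForm_part₃₄_map_sub (hJ : IsOrthogonalComplex J) (hS : S ∈ torsionSpace J)
    (u X Y : V) :
    cyclicForm J (part₃₄ J S) (J u) X Y - cyclicForm J (part₃₄ J S) (J u) (J X) (J Y)
      = 4 * inner ℝ (part₃₄ J S u X) Y := by
  have hQ := part₃₄_mem_torsionSpace hJ hS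
  have invariant := isInvariant_part₃₄ hJ (T := S)
  rw [cyclicForm, cyclicForm, inner_apply_map_right hJ hQ (J u) X,
    inner_apply_map_right hJ hQ Y]
  simp only [invariant _ _, hJ.sq, inner_neg_right, map_neg, inner_neg_left]
  ring

theorem cyclicForm_torsion_map (hJ : IsOrthogonalComplex J) (hT : T ∈ torsionSpace J)
    (u X Y : V) :
    cyclicForm J T (T u X - T X u) (J u) Y
      = 2 * (-inner ℝ (T (T u X) u) Y + inner ℝ (T (T X u) u) Y
        + inner ℝ (T (J u) (J Y)) (T u X)
        + (inner ℝ (T X u) (part₁₂ J T u Y) - inner ℝ (T X u) (part₃₄ J T u Y))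
        + inner ℝ (T Y u) (T u X) - inner ℝ (T Y u) (T X u)) := by
  have first : ∀ a, inner ℝ (T a (J u)) (J Y) = -inner ℝ (T a u) Y := fun a ↦ by
    rw [inner_apply_map_right hJ hT, hJ.sq, map_neg, inner_neg_left]
  have second : ∀ a, inner ℝ (T (J u) Y) (J a) = inner ℝ (T (J u) (J Y)) a :=
    inner_apply_map_right hJ hT _ _
  have third : ∀ a, inner ℝ (T Y a) (J (J u)) = inner ℝ (T Y u) a := fun a ↦ by
    rw [hJ.sq, inner_neg_right, IsSkew.inner_apply_swap hT.1 Y a, neg_neg]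
  have parts : inner ℝ (T X u) (part₁₂ J T u Y) - inner ℝ (T X u) (part₃₄ J T u Y)
      = -inner ℝ (T (J u) (J Y)) (T X u) := by
    rw [part₁₂_apply, part₃₄_apply, real_inner_comm (T X u) (T (J u) (J Y))]
    simp only [real_inner_smul_right, inner_sub_right, inner_add_right]
    ring
  rw [cyclicForm, first, second, third, parts, map_sub, LinearMap.sub_apply, inner_sub_left,
    inner_sub_right, inner_sub_right]
  ring

theorem sum_inner_map_map_comm (hJ : IsOrthogonalComplex J) (hT : T ∈ torsionSpace J)
    (X Y : V) :
    ∑ i, inner ℝ (T (J (e i)) (J Y)) (T (e i) X)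
      = ∑ i, inner ℝ (T (J (e i)) (J X)) (T (e i) Y) := by
  have h := hJ.sum_map_left e (f := fun a b ↦ inner ℝ (T a (J Y)) (T b X))
    (fun b ↦ ((innerₗ V).flip (T b X) ∘ₗ T.flip (J Y)).isLinear)
    (fun a ↦ (innerₗ V (T a (J Y)) ∘ₗ T.flip X).isLinear)
  rw [h, ← Finset.sum_neg_distrib]
  refine Finset.sum_congr rfl fun i _ ↦ ?_
  rw [← inner_apply_map_right hJ hT, real_inner_comm, hT.2, inner_neg_left]

theorem isLambda20_inner (hJ : IsOrthogonalComplex J) (hS : S ∈ torsionSpace J) (u : V) :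
    IsLambda20 J fun X Y ↦ inner ℝ (S u X) Y :=
  ⟨IsSkew.inner_apply_swap hS.1 u, fun X Y ↦ by
    beta_reduce
    rw [inner_apply_map_right hJ hS, hJ.sq, map_neg, inner_neg_left]⟩

theorem isLambda20_sum {b : ι → V → V → ℝ} (h : ∀ i, IsLambda20 J (b i)) :
    IsLambda20 J fun X Y ↦ ∑ i, b i X Y := by
  refine ⟨fun X Y ↦ ?_, fun X Y ↦ ?_⟩ <;> simp only [← Finset.sum_neg_distrib]
  · exact Finset.sum_congr rfl fun i _ ↦ (h i).1 X Y
  · exact Finset.sum_congr rfl fun i _ ↦ (h i).2 X Y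

theorem isLambda20_divTerm (hJ : IsOrthogonalComplex J) {D : V → V →ₗ[ℝ] V →ₗ[ℝ] V}
    (hD : ∀ u, D u ∈ torsionSpace J) : IsLambda20 J (divTerm e fun u v w ↦ D u v w) :=
  isLambda20_sum fun i ↦ isLambda20_inner hJ (hD (e i)) (e i)

theorem isLambda20_traceTerm (hJ : IsOrthogonalComplex J) (hS : S ∈ torsionSpace J)
    (B : V →ₗ[ℝ] V →ₗ[ℝ] V) : IsLambda20 J (traceTerm e S B) :=
  isLambda20_sum fun i ↦ isLambda20_inner hJ hS (B (e i) (e i))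

variable [FiniteDimensional ℝ V] {n : ℕ}

theorem isLambda20_mixedTerm (hJ : IsOrthogonalComplex J) (hS : IsSkew S)
    (hS' : IsInvariant J S) (hT : T ∈ torsionSpace J) : IsLambda20 J (mixedTerm e S T) := by
  refine ⟨fun X Y ↦ ?_, fun X Y ↦ ?_⟩ <;>
    simp only [mixedTerm_eq_contraction e _ _ hS hT.1,
      contraction_map_map_of_isInvariant _ _ hJ hT hS'] <;> ring

/-! ### The `⟦λ^{2,0}⟧`-component of the second derivative -/

theorem cyclicForm_part₁₂_map (hJ : IsOrthogonalComplex J) (hS : S ∈ torsionSpace J)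
    (u X Y : V) : cyclicForm J (part₁₂ J S) (J u) X Y = -6 * inner ℝ (comp₁ J S u X) Y := by
  have hP := part₁₂_mem_torsionSpace hJ hS
  rw [comp₁, inner_cyclicPart hP.1, cyclicForm, inner_apply_map_right hJ hP (J u),
    inner_apply_map_right hJ hP Y, isAntiInvariant_part₁₂ hJ, hJ.sq, map_neg, inner_neg_left,
    inner_neg_left, inner_neg_right]
  ring

theorem cyclicForm_map_sub (hJ : IsOrthogonalComplex J) (hS : S ∈ torsionSpace J) (u X Y : V) :
    cyclicForm J S (J u) X Y - cyclicForm J S (J u) (J X) (J Y)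
      = 4 * inner ℝ (part₃₄ J S u X) Y - 12 * inner ℝ (comp₁ J S u X) Y := by
  have hsplit : ∀ X Y, cyclicForm J S (J u) X Y
      = -6 * inner ℝ (comp₁ J S u X) Y + cyclicForm J (part₃₄ J S) (J u) X Y := fun X Y ↦ by
    rw [← cyclicForm_part₁₂_map hJ hS, ← cyclicForm_add, part₁₂_add_part₃₄]
  have hcomp : inner ℝ (comp₁ J S u (J X)) (J Y) = -inner ℝ (comp₁ J S u X) Y := by
    rw [inner_apply_map_right hJ (comp₁_mem_torsionSpace hJ hS), hJ.sq, map_neg, inner_neg_left]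
  rw [hsplit X Y, hsplit (J X) (J Y), hcomp]
  linarith [cyclicForm_part₃₄_map_sub hJ hS u X Y]

theorem sum_cyclicForm_torsion_map_sub_swap (hJ : IsOrthogonalComplex J)
    (hT : T ∈ torsionSpace J) (X Y : V) :
    ∑ i, cyclicForm J T (T (e i) X - T X (e i)) (J (e i)) Y
        - ∑ i, cyclicForm J T (T (e i) Y - T Y (e i)) (J (e i)) X
      = 2 * (contraction (part₁₂ J T) T X Y - contraction (part₁₂ J T) T Y X) := by
  have hP := sum_inner_eq_contraction e (hA := hT.1) (hB := (part₁₂_mem_torsionSpace hJ hT).1)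
  have hQ := sum_inner_eq_contraction e (hA := hT.1) (hB := (part₃₄_mem_torsionSpace hJ hT).1)
  simp only [cyclicForm_torsion_map hJ hT, ← Finset.mul_sum, Finset.sum_add_distrib,
    Finset.sum_sub_distrib, Finset.sum_neg_distrib, hP, hQ, contraction_part₃₄_self _ _ hJ hT,
    sum_inner_eq_contraction e _ _ hT.1 hT.1, ← contraction_eq_sum e,
    sum_inner_apply_apply_comm e X Y hT.1, sum_inner_map_map_comm e hJ hT X Y,
    real_inner_comm (T X (e _)) (T Y (e _))]
  ring

theorem sum_cyclicForm_map_self (hJ : IsOrthogonalComplex J) (hS : S ∈ torsionSpace J) (Y : V) :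
    ∑ i, cyclicForm J S (J (e i)) (e i) Y = 4 * inner ℝ (traceVector S) Y := by
  have term : ∀ i, cyclicForm J S (J (e i)) (e i) Y
      = 2 * (inner ℝ (S.compl₁₂ J J (e i) (e i)) Y + inner ℝ (S (e i) (e i)) Y) := by
    intro i
    have hzero := IsSkew.inner_apply_swap hS.1 Y (J (e i)) (J (e i))
    rw [cyclicForm, inner_apply_map_right hJ hS, hJ.sq, inner_neg_right,
      IsSkew.inner_apply_swap hS.1 (e i) Y (e i), self_eq_neg.1 hzero, LinearMap.compl₁₂_apply]
    ring
  simp only [term, ← Finset.mul_sum, Finset.sum_add_distrib, ← inner_metricTrace e,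
    hJ.metricTrace_compl₁₂, traceVector_eq_metricTrace]
  ring

theorem sum_cyclicFormDeriv (hJ : IsOrthogonalComplex J) (hT : T ∈ torsionSpace J)
    (hD : ∀ u, D u ∈ torsionSpace J) (X Y : V) :
    ∑ i, cyclicFormDeriv J D T (J (e i)) (e i) X Y
      = -2 * ∑ i, cyclicForm J (D (e i)) (J (e i)) X Y
        + 4 * inner ℝ (traceVector (D X)) Y - 4 * inner ℝ (traceVector (D Y)) X
        + 4 * inner ℝ (T (J (traceVector T)) X) (J Y)
        + 4 * (contraction (part₁₂ J T) T X Y - contraction (part₁₂ J T) T Y X) := by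
  have torsion_trace : ∑ i, cyclicForm J T (T (J (e i)) (e i) - T (e i) (J (e i))) X Y
      = 2 * cyclicForm J T (J (traceVector T)) X Y := by
    have h := map_sum ((isLinearMap_cyclicForm (J := J) (S := T) X Y).mk' _)
      (fun i ↦ T (J (e i)) (e i) - T (e i) (J (e i))) Finset.univ
    rw [sum_torsion_map_left e hJ hT, map_smul, ← metricTrace_eq_sum e,
      ← traceVector_eq_metricTrace] at h
    exact h.symm
  have trace_terms : 2 * cyclicForm J T (J (traceVector T)) X Y
        + 4 * inner ℝ (traceVector T) (T X Y - T Y X)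
      = 4 * inner ℝ (T (J (traceVector T)) X) (J Y) := by
    rw [cyclicForm, hJ.sq, inner_neg_right, inner_sub_right, inner_apply_map_right hJ hT Y,
      hJ.sq, map_neg, inner_neg_left, IsSkew.inner_apply_swap hT.1 Y (traceVector T) X,
      real_inner_comm (T X Y), real_inner_comm (T Y X)]
    ring
  have rotate : ∀ i, cyclicForm J T (T X Y - T Y X) (J (e i)) (e i)
      = cyclicForm J T (J (e i)) (e i) (T X Y - T Y X) := fun i ↦ cyclicForm_rotate _ _ _
  simp only [cyclicFormDeriv, Finset.sum_add_distrib, Finset.sum_sub_distrib, rotate]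
  linarith [sum_cyclicForm_torsion_map_left (T := T) e hJ X Y,
    sum_cyclicForm_torsion_map_left (T := T) e hJ Y X, sum_cyclicForm_map_left (D := D) e hJ X Y,
    sum_cyclicForm_map_self e hJ (hD X) Y, sum_cyclicForm_map_self e hJ (hD Y) X,
    sum_cyclicForm_map_self e hJ hT (T X Y - T Y X),
    sum_cyclicForm_torsion_map_sub_swap e hJ hT X Y]

theorem sum_cyclicForm_map_sub (hJ : IsOrthogonalComplex J) (hD : ∀ u, D u ∈ torsionSpace J)
    (X Y : V) :
    ∑ i, cyclicForm J (D (e i)) (J (e i)) X Y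
        - ∑ i, cyclicForm J (D (e i)) (J (e i)) (J X) (J Y)
      = 4 * (divTerm e (fun u v w ↦ comp₃ n J (D u) v w) X Y
          + divTerm e (fun u v w ↦ comp₄ n J (D u) v w) X Y)
        - 12 * divTerm e (fun u v w ↦ comp₁ J (D u) v w) X Y := by
  simp only [divTerm, ← Finset.sum_sub_distrib, ← Finset.sum_add_distrib, Finset.mul_sum,
    cyclicForm_map_sub hJ (hD _), ← inner_add_left, ← LinearMap.add_apply, comp₃_add_comp₄]

theorem lambda20Part_cyclicFormDeriv (hJ : IsOrthogonalComplex J) (hT : T ∈ torsionSpace J)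
    (hD : ∀ u, D u ∈ torsionSpace J) (hn : n ≠ 1) (hV : Module.finrank ℝ V = 2 * n) (X Y : V) :
    lambda20Part J e (cyclicFormDeriv J D T) X Y
      = 4 * (3 * divTerm e (fun u v w ↦ comp₁ J (D u) v w) X Y
        - divTerm e (fun u v w ↦ comp₃ n J (D u) v w) X Y
        + ((n : ℝ) - 2) * divTerm e (fun u v w ↦ comp₄ n J (D u) v w) X Y
        + mixedTerm e (comp₃ n J T) (comp₁ J T) X Y
        - ((n : ℝ) - 5) / ((n : ℝ) - 1) * traceTerm e (comp₁ J T) (comp₄ n J T) X Y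
        + mixedTerm e (comp₃ n J T) (comp₂ J T) X Y
        - ((n : ℝ) - 2) / ((n : ℝ) - 1) * traceTerm e (comp₂ J T) (comp₄ n J T) X Y
        + traceTerm e (comp₃ n J T) (comp₄ n J T) X Y) := by
  have hn' : (n : ℝ) - 1 ≠ 0 := sub_ne_zero.2 (mod_cast hn)
  have omega_trace : ∀ X Y,
      ∑ i, ∑ j, inner ℝ (e i) (J (e j)) * cyclicFormDeriv J D T (e i) (e j) X Y
        = ∑ i, cyclicFormDeriv J D T (J (e i)) (e i) X Y := fun X Y ↦
    sum_sum_inner_mul e fun u ↦ (isLinearMap_cyclicFormDeriv u X Y).mk' _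
  have coeff₅ : ((n : ℝ) - 5) / ((n : ℝ) - 1) = 1 - 4 / ((n : ℝ) - 1) := by field_simp; ring
  have coeff₇ : ((n : ℝ) - 2) / ((n : ℝ) - 1) = 1 - 1 / ((n : ℝ) - 1) := by field_simp; ring
  have trace_map : inner ℝ (T (J (traceVector T)) (J X)) (J (J Y))
      = -inner ℝ (T (J (traceVector T)) X) (J Y) := by
    rw [hJ.sq, inner_neg_right, ← inner_apply_map_right hJ hT]
  rw [lambda20Part, omega_trace, omega_trace, sum_cyclicFormDeriv e hJ hT hD,
    sum_cyclicFormDeriv e hJ hT hD, trace_map, coeff₅, coeff₇]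
  linarith [sum_cyclicForm_map_sub (n := n) e hJ hD X Y, divTerm_comp₄ (D := D) e X Y hJ hn,
    contraction_part₁₂_part₃₄_sub_swap e X Y hJ hT hn hV,
    inner_apply_map_traceVector e X Y hJ hT hn hV, contraction_part₁₂_sub_map_map X Y hJ hT,
    contraction_part₁₂_sub_map_map Y X hJ hT]

end CyclicForm

/-! ### The minimal connection -/

section Connection

variable {E : Type*} [NormedAddCommGroup E] [NormedSpace ℝ E]
  {H : Type*} [TopologicalSpace H] {I : ModelWithCorners ℝ E H}
  {M : Type*} [TopologicalSpace M] [ChartedSpace H M]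
  [IsManifold I ∞ M]
  [RiemannianBundle (fun x : M ↦ TangentSpace I x)]
  {J : OrthogonalComplexStructure I M}
  {nabla : CovariantDerivative I E (TangentSpace I : M → Type _)} {x : M}
  {Y : ∀ y : M, TangentSpace I y}

theorem OrthogonalComplexStructure.isOrthogonalComplex_at (J : OrthogonalComplexStructure I M)
    (x : M) : IsOrthogonalComplex (J.at x) :=
  ⟨J.sq x, J.orthogonal x⟩

theorem OrthogonalComplexStructure.at_apply (J : OrthogonalComplexStructure I M)
    (v : TangentSpace I x) : J.at x v = J.toFun x v := rfl

theorem OrthogonalComplexStructure.inner_toFun_left (J : OrthogonalComplexStructure I M)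
    (v w : TangentSpace I x) : inner ℝ (J.toFun x v) w = -inner ℝ v (J.toFun x w) :=
  (J.isOrthogonalComplex_at x).inner_map_left v w

theorem OrthogonalComplexStructure.mdifferentiableAt_toFun (J : OrthogonalComplexStructure I M)
    (hY : MDiffAt (T% Y) x) : MDiffAt (T% (fun y ↦ J.toFun y (Y y))) x :=
  MDifferentiableAt.clm_bundle_apply (F₁ := E) (F₂ := E)
    ((J.contMDiff x).mdifferentiableAt (by simp)) hY

theorem OrthogonalComplexStructure.contMDiffAt_toFun (J : OrthogonalComplexStructure I M)
    (hY : CMDiffAt ∞ (T% Y) x) : CMDiffAt ∞ (T% (fun y ↦ J.toFun y (Y y))) x :=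
  ContMDiffAt.clm_bundle_apply (F₁ := E) (F₂ := E) (J.contMDiff x) hY

theorem covariantDerivative_toFun_toFun (u : TangentSpace I x) (hY : MDiffAt (T% Y) x) :
    nabla (fun y ↦ J.toFun y (J.toFun y (Y y))) x u = -nabla Y x u := by
  have hsq : (fun y ↦ J.toFun y (J.toFun y (Y y))) = (-1 : ℝ) • Y := by
    funext y; simp [J.sq]
  rw [hsq, nabla.isCovariantDerivativeOnUniv.smul_const _ hY, smul_apply, neg_one_smul]

variable [FiniteDimensional ℝ E]

theorem intrinsicTorsion_apply (u : TangentSpace I x) (hY : MDiffAt (T% Y) x) :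
    intrinsicTorsion J nabla x u (Y x)
      = (-(1 / 2) : ℝ) • (J.toFun x (nabla (fun y ↦ J.toFun y (Y y)) x u) + nabla Y x u) := by
  change torsionForm J nabla x (Y x) u = _
  rw [torsionForm, TensorialAt.mkHom_apply _ hY]
  simp only [torsionOp, smul_apply, ContinuousLinearMap.comp_apply, sub_apply, map_sub, J.sq,
    sub_neg_eq_add]

theorem minimalConnection_eq_add (u : TangentSpace I x) :
    minimalConnection J nabla Y x u = nabla Y x u + intrinsicTorsion J nabla x u (Y x) := rfl

theorem minimalConnection_apply (u : TangentSpace I x) (hY : MDiffAt (T% Y) x) :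
    minimalConnection J nabla Y x u
      = (1 / 2 : ℝ) • (nabla Y x u - J.toFun x (nabla (fun y ↦ J.toFun y (Y y)) x u)) := by
  rw [minimalConnection_eq_add, intrinsicTorsion_apply u hY]
  module

/-- The covariant derivative `D` preserves the metric. -/
def IsMetricConnection (D : CovariantDerivative I E (TangentSpace I : M → Type _)) : Prop :=
  ∀ (σ τ : ∀ x : M, TangentSpace I x) (x : M), MDiffAt (T% σ) x → MDiffAt (T% τ) x →
    ∀ u : TangentSpace I x, mvfderiv I (fun y ↦ (inner ℝ (σ y) (τ y) : ℝ)) x u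
      = inner ℝ (D σ x u) (τ x) + inner ℝ (σ x) (D τ x u)

/-- The covariant derivative `D` preserves the almost complex structure `J`. -/
def IsComplexConnection (J : OrthogonalComplexStructure I M)
    (D : CovariantDerivative I E (TangentSpace I : M → Type _)) : Prop :=
  ∀ (σ : ∀ x : M, TangentSpace I x) (x : M), MDiffAt (T% σ) x →
    ∀ u : TangentSpace I x, D (fun y ↦ J.toFun y (σ y)) x u = J.toFun x (D σ x u)

theorem IsMetricConnection.minimalConnection (h : IsMetricConnection nabla) :
    IsMetricConnection (minimalConnection J nabla) := by
  intro σ τ x hσ hτ u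
  have hστ := h σ τ x hσ hτ u
  have hJστ := h _ _ x (J.mdifferentiableAt_toFun hσ) (J.mdifferentiableAt_toFun hτ) u
  simp only [J.orthogonal] at hJστ
  have hleft := J.inner_toFun_left (nabla (fun y ↦ J.toFun y (σ y)) x u) (τ x)
  have hright := J.inner_toFun_left (σ x) (nabla (fun y ↦ J.toFun y (τ y)) x u)
  rw [minimalConnection_apply u hσ, minimalConnection_apply u hτ]
  simp only [real_inner_smul_left, real_inner_smul_right, inner_sub_left, inner_sub_right]
  linarith

theorem isComplexConnection_minimalConnection :
    IsComplexConnection J (minimalConnection J nabla) := by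
  intro σ x hσ u
  rw [minimalConnection_apply u hσ, minimalConnection_apply u (J.mdifferentiableAt_toFun hσ),
    covariantDerivative_toFun_toFun u hσ, map_smul, map_sub, J.sq, map_neg]
  module

theorem isSkew_intrinsicTorsion (h : IsMetricConnection nabla) (x : M) :
    IsSkew (intrinsicTorsion J nabla x) := by
  intro u v w
  have hv := FiberBundle.mdifferentiableAt_extend I E (V := TangentSpace I) v
  have hw := FiberBundle.mdifferentiableAt_extend I E (V := TangentSpace I) w
  have hmin := h.minimalConnection (J := J) _ _ x hv hw u
  rw [h _ _ x hv hw u] at hmin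
  simp only [minimalConnection_eq_add, FiberBundle.extend_apply_self, inner_add_left,
    inner_add_right] at hmin
  linarith

theorem intrinsicTorsion_toFun (u v : TangentSpace I x) :
    intrinsicTorsion J nabla x u (J.toFun x v) = -J.toFun x (intrinsicTorsion J nabla x u v) := by
  have hv := FiberBundle.mdifferentiableAt_extend I E (V := TangentSpace I) v
  have h := intrinsicTorsion_apply (J := J) (nabla := nabla) u hv
  have hJ := intrinsicTorsion_apply (J := J) (nabla := nabla) u (J.mdifferentiableAt_toFun hv)
  rw [covariantDerivative_toFun_toFun u hv] at hJ
  simp only [FiberBundle.extend_apply_self] at h hJ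
  rw [h, hJ, map_neg, map_smul, map_add, J.sq]
  module

theorem intrinsicTorsion_mem_torsionSpace (h : IsMetricConnection nabla) (x : M) :
    intrinsicTorsion J nabla x ∈ torsionSpace (J.at x) :=
  ⟨isSkew_intrinsicTorsion h x, intrinsicTorsion_toFun⟩

theorem IsLeviCivita.mlieBracket_eq (h : IsLeviCivita nabla) {X : ∀ y : M, TangentSpace I y}
    (hX : MDiffAt (T% X) x) (hY : MDiffAt (T% Y) x) :
    VectorField.mlieBracket I X Y x = nabla Y x (X x) - nabla X x (Y x) :=
  ((nabla.torsion_eq_zero_iff.1 h.torsion_free) hX hY).symm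

end Connection

/-! ### Orthonormal frames -/

section Smooth

open Filter Topology

variable {E : Type*} [NormedAddCommGroup E] [NormedSpace ℝ E]
  {H : Type*} [TopologicalSpace H] {I : ModelWithCorners ℝ E H}
  {M : Type*} [TopologicalSpace M] [ChartedSpace H M] {x : M}

theorem eventually_mdifferentiableAt {E' : Type*} [NormedAddCommGroup E'] [NormedSpace ℝ E']
    {H' : Type*} [TopologicalSpace H'] {I' : ModelWithCorners ℝ E' H'}
    {M' : Type*} [TopologicalSpace M'] [ChartedSpace H' M'] [IsManifold I 1 M] [IsManifold I' 1 M']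
    {f : M → M'} (hf : ContMDiffAt I I' ∞ f x) :
    ∀ᶠ y in 𝓝 x, MDifferentiableAt I I' f y := by
  have hf₁ : ContMDiffAt I I' 1 f x := hf.of_le (by simp)
  filter_upwards [(contMDiffAt_iff_contMDiffAt_nhds (by simp)).1 hf₁] with y hy
  exact hy.mdifferentiableAt (by simp)

theorem mvfderiv_congr {f g : M → ℝ} (h : f =ᶠ[𝓝 x] g) : mvfderiv I f x = mvfderiv I g x := by
  ext u
  simp only [mvfderiv, h.mfderiv_eq]
  rfl

variable [IsManifold I ∞ M]

theorem contMDiffAt_mvfderiv {f : M → ℝ} {X : ∀ y : M, TangentSpace I y} (hf : CMDiffAt ∞ f x)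
    (hX : CMDiffAt ∞ (T% X) x) : CMDiffAt ∞ (fun y ↦ mvfderiv I f y (X y)) x := by
  let t := trivializationAt E (TangentSpace I : M → Type _) x
  have ht : t.baseSet ∈ 𝓝 x :=
    t.open_baseSet.mem_nhds (FiberBundle.mem_baseSet_trivializationAt' x)
  have hcoord := (hf.mfderiv_const (m := ∞) (by simp)).clm_apply ((contMDiffAt_section x).1 hX)
  refine hcoord.congr_of_eventuallyEq ?_
  filter_upwards [ht] with y hy
  have hy' : f y ∈ (trivializationAt ℝ (TangentSpace 𝓘(ℝ, ℝ)) (f x)).baseSet := by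
    simp only [TangentBundle.trivializationAt_baseSet, chartAt_self_eq,
      OpenPartialHomeomorph.refl_source, Set.mem_univ]
  have hin : inTangentCoordinates I 𝓘(ℝ, ℝ) id f (mfderiv I 𝓘(ℝ, ℝ) f) x y = _ :=
    ContinuousLinearMap.inCoordinates_eq hy hy'
  rw [hin]
  simp only [mvfderiv, ContinuousLinearMap.comp_apply, ContinuousLinearEquiv.coe_coe,
    Trivialization.continuousLinearEquivAt_symm_apply, t.symm_apply_apply_mk hy,
    Trivialization.continuousLinearEquivAt_apply, trivializationAt_model_space_apply, t]
  rfl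

variable [CompleteSpace E]

theorem contMDiffAt_mlieBracket {X Y : ∀ y : M, TangentSpace I y} (hX : CMDiffAt ∞ (T% X) x)
    (hY : CMDiffAt ∞ (T% Y) x) : CMDiffAt ∞ (T% (VectorField.mlieBracket I X Y)) x := by
  have : IsManifold I (minSmoothness ℝ 2) M := by
    rw [minSmoothness_of_isRCLikeNormedField]; infer_instance
  have : IsManifold I (((⊤ : ℕ∞) : ℕ∞ω) + 1) M := by
    change IsManifold I ∞ M; infer_instance
  exact ContMDiffAt.mlieBracket_vectorField (m := ⊤) (n := ⊤) hX hY
    (by rw [minSmoothness_of_isRCLikeNormedField]; rfl)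

end Smooth

section Frame

open Filter Topology InnerProductSpace

variable {E : Type*} [NormedAddCommGroup E] [NormedSpace ℝ E]
  {H : Type*} [TopologicalSpace H] {I : ModelWithCorners ℝ E H}
  {M : Type*} [TopologicalSpace M] [ChartedSpace H M] [IsManifold I ∞ M]
  [RiemannianBundle (fun x : M ↦ TangentSpace I x)] {x : M}

variable {κ : Type*} [Fintype κ] {F : κ → ∀ y : M, TangentSpace I y}

/-- `F` is a family of vector fields that is smooth at `x` and an orthonormal basis of every
tangent space near `x`. -/
structure IsOrthonormalFrameAt (F : κ → ∀ y : M, TangentSpace I y) (x : M) : Prop where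
  contMDiffAt : ∀ i, CMDiffAt ∞ (T% (F i)) x
  basis : ∀ᶠ y in 𝓝 x, ∃ b : OrthonormalBasis κ ℝ (TangentSpace I y), ∀ i, b i = F i y

namespace IsOrthonormalFrameAt

theorem mdifferentiableAt_apply (hF : IsOrthonormalFrameAt F x) (i : κ) : MDiffAt (T% (F i)) x :=
  (hF.contMDiffAt i).mdifferentiableAt (by simp)

theorem eventually_sum_inner_smul (hF : IsOrthonormalFrameAt F x) :
    ∀ᶠ y in 𝓝 x, ∀ v : TangentSpace I y, ∑ i, (inner ℝ (F i y) v : ℝ) • F i y = v := by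
  filter_upwards [hF.basis] with y ⟨b, hb⟩ v
  simp_rw [← hb]
  exact b.sum_repr' v

theorem eventually_inner_eq_ite [DecidableEq κ] (hF : IsOrthonormalFrameAt F x) (i j : κ) :
    ∀ᶠ y in 𝓝 x, (inner ℝ (F i y) (F j y) : ℝ) = if i = j then 1 else 0 := by
  filter_upwards [hF.basis] with y ⟨b, hb⟩
  rw [← hb, ← hb, b.inner_eq_ite]

theorem eventually_mvfderiv_inner_eq_zero (hF : IsOrthonormalFrameAt F x) (i j : κ) :
    ∀ᶠ y in 𝓝 x, mvfderiv I (fun z ↦ (inner ℝ (F i z) (F j z) : ℝ)) y = 0 := by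
  classical
  filter_upwards [(hF.eventually_inner_eq_ite i j).eventually_nhds] with y hy
  rw [mvfderiv_congr hy, mvfderiv_const]

theorem mdifferentiableAt_of_inner (hF : IsOrthonormalFrameAt F x)
    {σ : ∀ y : M, TangentSpace I y} (h : ∀ i, MDiffAt (fun y ↦ (inner ℝ (F i y) (σ y) : ℝ)) x) :
    MDiffAt (T% σ) x := by
  have hsum : MDiffAt (T% (fun y ↦ ∑ i, (inner ℝ (F i y) (σ y) : ℝ) • F i y)) x :=
    MDifferentiableAt.sum_section fun i _ ↦ (h i).smul_section (hF.mdifferentiableAt_apply i)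
  refine hsum.congr_of_eventuallyEq ?_
  filter_upwards [hF.eventually_sum_inner_smul] with y hy
  exact congrArg _ (hy (σ y)).symm

theorem contMDiffAt_of_inner (hF : IsOrthonormalFrameAt F x)
    {σ : ∀ y : M, TangentSpace I y} (h : ∀ i, CMDiffAt ∞ (fun y ↦ (inner ℝ (F i y) (σ y) : ℝ)) x) :
    CMDiffAt ∞ (T% σ) x := by
  have hsum : CMDiffAt ∞ (T% (fun y ↦ ∑ i, (inner ℝ (F i y) (σ y) : ℝ) • F i y)) x :=
    ContMDiffAt.sum_section fun i _ ↦ (h i).smul_section (hF.contMDiffAt i)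
  refine hsum.congr_of_eventuallyEq ?_
  filter_upwards [hF.eventually_sum_inner_smul] with y hy
  exact congrArg _ (hy (σ y)).symm

end IsOrthonormalFrameAt

theorem IsMetricConnection.eventually_inner_frame_eq_neg
    {D : CovariantDerivative I E (TangentSpace I : M → Type _)} (hD : IsMetricConnection D)
    (hF : IsOrthonormalFrameAt F x) (i j : κ) :
    ∀ᶠ y in 𝓝 x, ∀ u : TangentSpace I y,
      (inner ℝ (D (F i) y u) (F j y) : ℝ) = -inner ℝ (D (F j) y u) (F i y) := by
  filter_upwards [hF.eventually_mvfderiv_inner_eq_zero i j,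
    eventually_mdifferentiableAt (hF.contMDiffAt i),
    eventually_mdifferentiableAt (hF.contMDiffAt j)] with y hij hi hj u
  have h := hD (F i) (F j) y hi hj u
  rw [hij, zero_apply, real_inner_comm (D (F j) y u)] at h
  exact eq_neg_of_add_eq_zero_left h.symm

/-- The field `S` of bilinear maps takes vector fields differentiable at `x` to a vector field
differentiable at `x`. This stands in for differentiability of `S` as a section of a tensor
bundle. -/
def IsDiffTensorAt
    (S : ∀ x : M, TangentSpace I x →ₗ[ℝ] TangentSpace I x →ₗ[ℝ] TangentSpace I x) (x : M) : Prop :=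
  ∀ V W : ∀ y : M, TangentSpace I y, MDiffAt (T% V) x → MDiffAt (T% W) x →
    MDiffAt (T% (fun y ↦ S y (V y) (W y))) x

variable [IsContMDiffRiemannianBundle I ∞ E (fun x : M ↦ TangentSpace I x)]

theorem contMDiffAt_inner {X Y : ∀ y : M, TangentSpace I y} (hX : CMDiffAt ∞ (T% X) x)
    (hY : CMDiffAt ∞ (T% Y) x) : CMDiffAt ∞ (fun y ↦ (inner ℝ (X y) (Y y) : ℝ)) x :=
  ContMDiffAt.inner_bundle hX hY

theorem mdifferentiableAt_inner {X Y : ∀ y : M, TangentSpace I y} (hX : MDiffAt (T% X) x)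
    (hY : MDiffAt (T% Y) x) : MDiffAt (fun y ↦ (inner ℝ (X y) (Y y) : ℝ)) x :=
  MDifferentiableAt.inner_bundle (F := E) (E := fun x : M ↦ TangentSpace I x) (IB := I) hX hY

section GramSchmidt

variable {N : ℕ} {s : Fin N → ∀ y : M, TangentSpace I y}

theorem contMDiffAt_gramSchmidt (hs : ∀ i, CMDiffAt ∞ (T% (s i)) x)
    (hli : LinearIndependent ℝ fun i ↦ s i x) (i : Fin N) :
    CMDiffAt ∞ (T% (fun y ↦ gramSchmidt ℝ (fun j ↦ s j y) i)) x := by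
  induction i using WellFoundedLT.induction with
  | ind i ih =>
  have hrec : ∀ y, gramSchmidt ℝ (fun j ↦ s j y) i = s i y - ∑ j ∈ Finset.Iio i,
      (inner ℝ (gramSchmidt ℝ (fun j ↦ s j y) j) (s i y)
        / inner ℝ (gramSchmidt ℝ (fun j ↦ s j y) j) (gramSchmidt ℝ (fun j ↦ s j y) j) : ℝ)
        • gramSchmidt ℝ (fun j ↦ s j y) j := by
    intro y
    rw [gramSchmidt_def]
    simp only [Submodule.starProjection_singleton, real_inner_self_eq_norm_sq]
    rfl
  refine ContMDiffAt.congr_of_eventuallyEq ?_ (.of_forall fun y ↦ congrArg _ (hrec y))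
  refine (hs i).sub_section (ContMDiffAt.sum_section fun j hj ↦ ?_)
  have hj' := ih j (Finset.mem_Iio.1 hj)
  refine ContMDiffAt.smul_section (ContMDiffAt.div₀ (contMDiffAt_inner hj' (hs i))
    (contMDiffAt_inner hj' hj') ?_) hj'
  rw [inner_self_ne_zero]
  exact gramSchmidt_ne_zero j hli

theorem contMDiffAt_gramSchmidtNormed (hs : ∀ i, CMDiffAt ∞ (T% (s i)) x)
    (hli : LinearIndependent ℝ fun i ↦ s i x) (i : Fin N) :
    CMDiffAt ∞ (T% (fun y ↦ gramSchmidtNormed ℝ (fun j ↦ s j y) i)) x := by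
  have hG := contMDiffAt_gramSchmidt hs hli i
  have hpos : (0 : ℝ) <
      inner ℝ (gramSchmidt ℝ (fun j ↦ s j x) i) (gramSchmidt ℝ (fun j ↦ s j x) i) :=
    real_inner_self_pos.2 (gramSchmidt_ne_zero i hli)
  have hnormed : ∀ y, gramSchmidtNormed ℝ (fun j ↦ s j y) i =
      (√(inner ℝ (gramSchmidt ℝ (fun j ↦ s j y) i) (gramSchmidt ℝ (fun j ↦ s j y) i) : ℝ))⁻¹
        • gramSchmidt ℝ (fun j ↦ s j y) i := by
    intro y
    rw [real_inner_self_eq_norm_sq, Real.sqrt_sq (norm_nonneg _)]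
    rfl
  have hsqrt := (Real.contDiffAt_sqrt (n := ∞) hpos.ne').inv (Real.sqrt_ne_zero'.2 hpos)
  refine ContMDiffAt.congr_of_eventuallyEq ?_ (.of_forall fun y ↦ congrArg _ (hnormed y))
  exact ContMDiffAt.smul_section (ContMDiffAt.comp (g := fun r : ℝ ↦ (√r)⁻¹) x
    hsqrt.contMDiffAt (contMDiffAt_inner hG hG)) hG

end GramSchmidt

theorem exists_isOrthonormalFrameAt [FiniteDimensional ℝ E] (x : M) :
    ∃ F : Fin (Module.finrank ℝ E) → ∀ y : M, TangentSpace I y, IsOrthonormalFrameAt F x := by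
  let t := trivializationAt E (TangentSpace I : M → Type _) x
  have hx : x ∈ t.baseSet := FiberBundle.mem_baseSet_trivializationAt' x
  let b := Module.finBasis ℝ E
  let s := t.localFrame b
  have hli : ∀ y ∈ t.baseSet, LinearIndependent ℝ fun i ↦ s i y := fun y hy ↦
    (t.isLocalFrameOn_localFrame_baseSet I ∞ b).linearIndependent hy
  have hs : ∀ i, CMDiffAt ∞ (T% (s i)) x := fun i ↦ contMDiffAt_localFrame_of_mem ∞ t b i hx
  refine ⟨fun i y ↦ gramSchmidtNormed ℝ (fun j ↦ s j y) i,
    contMDiffAt_gramSchmidtNormed hs (hli x hx), ?_⟩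
  filter_upwards [t.open_baseSet.mem_nhds hx] with y hy
  have ho := gramSchmidtNormed_orthonormal (hli y hy)
  have hcard : Fintype.card (Fin (Module.finrank ℝ E)) = Module.finrank ℝ (TangentSpace I y) := by
    rw [Fintype.card_fin]; rfl
  exact ⟨OrthonormalBasis.mk ho
    (ho.linearIndependent.span_eq_top_of_card_eq_finrank' hcard).ge, fun i ↦ by simp⟩

variable {nabla : CovariantDerivative I E (TangentSpace I : M → Type _)}

theorem IsLeviCivita.contMDiffAt_frame_frame [FiniteDimensional ℝ E] (h : IsLeviCivita nabla)
    (hF : IsOrthonormalFrameAt F x) (i j : κ) :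
    CMDiffAt ∞ (T% (fun y ↦ nabla (F j) y (F i y))) x := by
  refine hF.contMDiffAt_of_inner fun k ↦ ?_
  have hbracket : ∀ i j k, CMDiffAt ∞
      (fun y ↦ (inner ℝ (VectorField.mlieBracket I (F i) (F j) y) (F k y) : ℝ)) x := fun i j k ↦
    contMDiffAt_inner (contMDiffAt_mlieBracket (hF.contMDiffAt i) (hF.contMDiffAt j))
      (hF.contMDiffAt k)
  -- Koszul's formula, in which the derivatives of the constants `⟨F i, F j⟩` drop out
  refine ((contMDiffAt_const (c := (1 / 2 : ℝ))).mul (((hbracket i j k).sub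
    (hbracket i k j)).sub (hbracket j k i))).congr_of_eventuallyEq ?_
  have hskew : ∀ i j, _ := (IsMetricConnection.eventually_inner_frame_eq_neg h.metric hF)
  filter_upwards [eventually_mdifferentiableAt (hF.contMDiffAt i),
    eventually_mdifferentiableAt (hF.contMDiffAt j),
    eventually_mdifferentiableAt (hF.contMDiffAt k), hskew j k, hskew i k, hskew i j]
    with y hi hj hk hjk hik hij
  change _ = 1 / 2 * (inner ℝ (VectorField.mlieBracket I (F i) (F j) y) _
    - inner ℝ (VectorField.mlieBracket I (F i) (F k) y) _
    - inner ℝ (VectorField.mlieBracket I (F j) (F k) y) _)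
  rw [h.mlieBracket_eq hi hj, h.mlieBracket_eq hi hk, h.mlieBracket_eq hj hk,
    real_inner_comm (nabla (F j) y (F i y))]
  simp only [inner_sub_left]
  linarith [hjk (F i y), hik (F j y), hij (F k y)]

theorem IsLeviCivita.contMDiffAt_apply_frame [FiniteDimensional ℝ E] (h : IsLeviCivita nabla)
    (hF : IsOrthonormalFrameAt F x) {Y : ∀ y : M, TangentSpace I y} (hY : CMDiffAt ∞ (T% Y) x)
    (i : κ) : CMDiffAt ∞ (T% (fun y ↦ nabla Y y (F i y))) x := by
  refine hF.contMDiffAt_of_inner fun k ↦ ?_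
  have hderiv := contMDiffAt_mvfderiv (contMDiffAt_inner hY (hF.contMDiffAt k)) (hF.contMDiffAt i)
  have hcoef := contMDiffAt_inner hY (h.contMDiffAt_frame_frame hF i k)
  refine (hderiv.sub hcoef).congr_of_eventuallyEq ?_
  filter_upwards [eventually_mdifferentiableAt hY,
    eventually_mdifferentiableAt (hF.contMDiffAt k)] with y hy hk
  rw [h.metric _ _ y hy hk, real_inner_comm]
  ring

theorem IsOrthonormalFrameAt.isDiffTensorAt
    {S : ∀ x : M, TangentSpace I x →ₗ[ℝ] TangentSpace I x →ₗ[ℝ] TangentSpace I x}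
    (hF : IsOrthonormalFrameAt F x) (h : ∀ i j, MDiffAt (T% (fun y ↦ S y (F i y) (F j y))) x) :
    IsDiffTensorAt S x := by
  intro V W hV hW
  have hd := hF.mdifferentiableAt_apply
  have hsum : MDiffAt (T% (fun y ↦ ∑ i, (inner ℝ (F i y) (V y) : ℝ) •
      ∑ j, (inner ℝ (F j y) (W y) : ℝ) • S y (F i y) (F j y))) x :=
    MDifferentiableAt.sum_section fun i _ ↦ (mdifferentiableAt_inner (hd i) hV).smul_section <|
      MDifferentiableAt.sum_section fun j _ ↦
        (mdifferentiableAt_inner (hd j) hW).smul_section (h i j)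
  refine hsum.congr_of_eventuallyEq ?_
  filter_upwards [hF.eventually_sum_inner_smul] with y hy
  refine congrArg _ ?_
  conv_lhs => rw [← hy (V y), ← hy (W y)]
  simp only [map_sum, map_smul, LinearMap.sum_apply, LinearMap.smul_apply, Finset.smul_sum]
  rw [Finset.sum_comm]
  exact Finset.sum_congr rfl fun i _ ↦ Finset.sum_congr rfl fun j _ ↦ smul_comm ..

theorem IsLeviCivita.isDiffTensorAt_intrinsicTorsion [FiniteDimensional ℝ E]
    {J : OrthogonalComplexStructure I M} (h : IsLeviCivita nabla) (x : M) :
    IsDiffTensorAt (intrinsicTorsion J nabla) x := by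
  obtain ⟨F, hF⟩ := exists_isOrthonormalFrameAt (I := I) x
  refine hF.isDiffTensorAt fun i j ↦ ?_
  have hJ := J.contMDiffAt_toFun (h.contMDiffAt_apply_frame hF
    (J.contMDiffAt_toFun (hF.contMDiffAt j)) i)
  have hsum := ((hJ.add_section (h.contMDiffAt_apply_frame hF
    (hF.contMDiffAt j) i)).const_smul_section (a := (-(1 / 2) : ℝ)))
  refine (hsum.mdifferentiableAt (by simp)).congr_of_eventuallyEq ?_
  filter_upwards [eventually_mdifferentiableAt (hF.contMDiffAt j)] with y hy
  exact congrArg _ (intrinsicTorsion_apply _ hy)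

end Frame

/-! ### Covariant derivatives of vector and tensor fields -/

section TensorCalculus

open Filter Topology

variable {E : Type*} [NormedAddCommGroup E] [NormedSpace ℝ E]
  {H : Type*} [TopologicalSpace H] {I : ModelWithCorners ℝ E H}
  {M : Type*} [TopologicalSpace M] [ChartedSpace H M] [IsManifold I ∞ M]
  {D : CovariantDerivative I E (TangentSpace I : M → Type _)} {x : M}
  {σ τ : ∀ y : M, TangentSpace I y} {σ' τ' : TangentSpace I x → TangentSpace I x}

/-- The vector field `σ` is differentiable at `x`, with `D_u σ = σ' u` there. -/
structure HasCovDerivAt (D : CovariantDerivative I E (TangentSpace I : M → Type _))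
    (σ : ∀ y : M, TangentSpace I y) (x : M) (σ' : TangentSpace I x → TangentSpace I x) :
    Prop where
  mdifferentiableAt : MDiffAt (T% σ) x
  eq : ∀ u, D σ x u = σ' u

theorem hasCovDerivAt (h : MDiffAt (T% σ) x) : HasCovDerivAt D σ x (fun u ↦ D σ x u) :=
  ⟨h, fun _ ↦ rfl⟩

namespace HasCovDerivAt

theorem add (hσ : HasCovDerivAt D σ x σ') (hτ : HasCovDerivAt D τ x τ') :
    HasCovDerivAt D (fun y ↦ σ y + τ y) x (fun u ↦ σ' u + τ' u) :=
  ⟨mdifferentiableAt_add_section hσ.1 hτ.1, fun u ↦ by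
    rw [← hσ.2, ← hτ.2]
    exact congrArg (· u) (D.isCovariantDerivativeOnUniv.add hσ.1 hτ.1)⟩

theorem smul {f : M → ℝ} (hf : MDiffAt f x) (hσ : HasCovDerivAt D σ x σ') :
    HasCovDerivAt D (fun y ↦ f y • σ y) x (fun u ↦ f x • σ' u + mvfderiv I f x u • σ x) :=
  ⟨hf.smul_section hσ.1, fun u ↦ by
    rw [← hσ.2]
    exact congrArg (· u) (D.isCovariantDerivativeOnUniv.leibniz hσ.1 hf)⟩

theorem const_smul (c : ℝ) (hσ : HasCovDerivAt D σ x σ') :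
    HasCovDerivAt D (fun y ↦ c • σ y) x (fun u ↦ c • σ' u) :=
  ⟨hσ.1.smul_const_section, fun u ↦ by
    rw [← hσ.2]
    exact congrArg (· u) (D.isCovariantDerivativeOnUniv.smul_const c hσ.1)⟩

theorem congr_deriv (hσ : HasCovDerivAt D σ x σ') (h : ∀ u, σ' u = τ' u) :
    HasCovDerivAt D σ x τ' :=
  ⟨hσ.1, fun u ↦ (hσ.2 u).trans (h u)⟩

theorem sub (hσ : HasCovDerivAt D σ x σ') (hτ : HasCovDerivAt D τ x τ') :
    HasCovDerivAt D (fun y ↦ σ y - τ y) x (fun u ↦ σ' u - τ' u) := by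
  simpa only [neg_one_smul, ← sub_eq_add_neg] using hσ.add (hτ.const_smul (-1))

theorem congr (hσ : HasCovDerivAt D σ x σ') (h : ∀ᶠ y in 𝓝 x, τ y = σ y) :
    HasCovDerivAt D τ x σ' := by
  have hτ : MDiffAt (T% τ) x :=
    hσ.1.congr_of_eventuallyEq (h.mono fun y hy ↦ congrArg _ hy)
  refine ⟨hτ, fun u ↦ ?_⟩
  rw [← hσ.2]
  exact congrArg (· u) (D.isCovariantDerivativeOnUniv.congr_of_eventuallyEq hτ hσ.1 univ_mem h)

theorem sum {κ : Type*} (s : Finset κ) {σ : κ → ∀ y : M, TangentSpace I y}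
    {σ' : κ → TangentSpace I x → TangentSpace I x} (h : ∀ i, HasCovDerivAt D (σ i) x (σ' i)) :
    HasCovDerivAt D (fun y ↦ ∑ i ∈ s, σ i y) x (fun u ↦ ∑ i ∈ s, σ' i u) := by
  classical
  induction s using Finset.induction_on with
  | empty =>
    refine ⟨mdifferentiableAt_zeroSection .., fun u ↦ ?_⟩
    simp only [Finset.sum_empty]
    exact congrArg (· u) (D.isCovariantDerivativeOnUniv.zero (x := x))
  | insert a s ha ih =>
    simp only [Finset.sum_insert ha]
    exact (h a).add ih

section Riemannian

variable [RiemannianBundle (fun x : M ↦ TangentSpace I x)] {J : OrthogonalComplexStructure I M}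

theorem toFun (hD : IsComplexConnection J D) (hσ : HasCovDerivAt D σ x σ') :
    HasCovDerivAt D (fun y ↦ J.toFun y (σ y)) x (fun u ↦ J.toFun x (σ' u)) :=
  ⟨J.mdifferentiableAt_toFun hσ.1, fun u ↦ by rw [hD σ x hσ.1, hσ.2]⟩

theorem mvfderiv_inner (hD : IsMetricConnection D) (hσ : HasCovDerivAt D σ x σ')
    (hτ : HasCovDerivAt D τ x τ') (u : TangentSpace I x) :
    mvfderiv I (fun y ↦ (inner ℝ (σ y) (τ y) : ℝ)) x u
      = inner ℝ (σ' u) (τ x) + inner ℝ (σ x) (τ' u) := by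
  rw [hD σ τ x hσ.1 hτ.1, hσ.2, hτ.2]

end Riemannian

end HasCovDerivAt

theorem hasCovDerivAt_extend (v : TangentSpace I x) :
    HasCovDerivAt D (FiberBundle.extend E v) x (fun u ↦ D (FiberBundle.extend E v) x u) :=
  hasCovDerivAt (FiberBundle.mdifferentiableAt_extend ..)

variable {S T : ∀ x : M, TangentSpace I x →ₗ[ℝ] TangentSpace I x →ₗ[ℝ] TangentSpace I x}
  {S' T' : TangentSpace I x → TangentSpace I x →ₗ[ℝ] TangentSpace I x →ₗ[ℝ] TangentSpace I x}

/-- The tensor field `S` is differentiable at `x`, with `D_u S = S' u` there. This is expressed by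
the Leibniz rule for the vector fields `S_V W`. -/
def HasTensorDerivAt (D : CovariantDerivative I E (TangentSpace I : M → Type _))
    (S : ∀ x : M, TangentSpace I x →ₗ[ℝ] TangentSpace I x →ₗ[ℝ] TangentSpace I x) (x : M)
    (S' : TangentSpace I x → TangentSpace I x →ₗ[ℝ] TangentSpace I x →ₗ[ℝ] TangentSpace I x) :
    Prop :=
  ∀ ⦃V W : ∀ y : M, TangentSpace I y⦄ ⦃V' W' : TangentSpace I x → TangentSpace I x⦄,
    HasCovDerivAt D V x V' → HasCovDerivAt D W x W' →
    HasCovDerivAt D (fun y ↦ S y (V y) (W y)) x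
      (fun u ↦ S' u (V x) (W x) + S x (V' u) (W x) + S x (V x) (W' u))

theorem HasTensorDerivAt.tensorDeriv_eq (h : HasTensorDerivAt D S x S') :
    tensorDeriv D S x = fun u v w ↦ S' u v w := by
  funext u v w
  simp only [tensorDeriv]
  rw [(h (hasCovDerivAt_extend v) (hasCovDerivAt_extend w)).eq]
  simp only [FiberBundle.extend_apply_self]
  abel

/-- The vector `(D_u S)_V W` at `x`, as an operator on the vector fields `V` and `W`. -/
def tensorDerivOp (D : CovariantDerivative I E (TangentSpace I : M → Type _))
    (S : ∀ x : M, TangentSpace I x →ₗ[ℝ] TangentSpace I x →ₗ[ℝ] TangentSpace I x) {x : M}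
    (u : TangentSpace I x) (V W : ∀ y : M, TangentSpace I y) : TangentSpace I x :=
  D (fun y ↦ S y (V y) (W y)) x u - S x (D V x u) (W x) - S x (V x) (D W x u)

theorem tensorialAt_tensorDerivOp_left (hS : IsDiffTensorAt S x) (u : TangentSpace I x)
    {W : ∀ y : M, TangentSpace I y} (hW : MDiffAt (T% W) x) :
    TensorialAt I E (tensorDerivOp D S u · W) x where
  smul {f V} hf hV := by
    have hSV := ((hasCovDerivAt (D := D) (hS V W hV hW)).smul hf).eq u
    have hfV := ((hasCovDerivAt (D := D) hV).smul hf).eq u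
    change D (fun y ↦ S y (f y • V y) (W y)) x u - S x (D (fun y ↦ f y • V y) x u) (W x)
      - S x (f x • V x) (D W x u) = f x • tensorDerivOp D S u V W
    simp only [map_smul, LinearMap.smul_apply, hSV, hfV, map_add, LinearMap.add_apply,
      tensorDerivOp]
    module
  add {V₁ V₂} hV₁ hV₂ := by
    have hSV := ((hasCovDerivAt (D := D) (hS V₁ W hV₁ hW)).add
      (hasCovDerivAt (hS V₂ W hV₂ hW))).eq u
    have hV := ((hasCovDerivAt (D := D) hV₁).add (hasCovDerivAt hV₂)).eq u
    change D (fun y ↦ S y (V₁ y + V₂ y) (W y)) x u - S x (D (fun y ↦ V₁ y + V₂ y) x u) (W x)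
      - S x (V₁ x + V₂ x) (D W x u) = tensorDerivOp D S u V₁ W + tensorDerivOp D S u V₂ W
    simp only [map_add, LinearMap.add_apply, hSV, hV, tensorDerivOp]
    module

theorem tensorialAt_tensorDerivOp_right (hS : IsDiffTensorAt S x) (u : TangentSpace I x)
    {V : ∀ y : M, TangentSpace I y} (hV : MDiffAt (T% V) x) :
    TensorialAt I E (tensorDerivOp D S u V) x := by
  have hflip : tensorDerivOp D S u V = (tensorDerivOp D (fun y ↦ (S y).flip) u · V) :=
    funext fun W ↦ sub_right_comm ..
  rw [hflip]
  exact tensorialAt_tensorDerivOp_left (fun V W hV hW ↦ hS W V hW hV) u hV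

theorem exists_hasTensorDerivAt [FiniteDimensional ℝ E]
    (D : CovariantDerivative I E (TangentSpace I : M → Type _))
    (hS : IsDiffTensorAt S x) :
    ∃ S' : TangentSpace I x →ₗ[ℝ] TangentSpace I x →ₗ[ℝ] TangentSpace I x →ₗ[ℝ] TangentSpace I x,
      HasTensorDerivAt D S x (fun u ↦ S' u) := by
  have hleft := fun u W ↦ tensorialAt_tensorDerivOp_left (D := D) hS u (W := W)
  have hright := fun u V ↦ tensorialAt_tensorDerivOp_right (D := D) hS u (V := V)
  let B : TangentSpace I x → TangentSpace I x →ₗ[ℝ] TangentSpace I x →ₗ[ℝ] TangentSpace I x :=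
    fun u ↦ (ContinuousLinearMap.coeLM ℝ).comp
      (TensorialAt.mkHom₂ (tensorDerivOp D S u) x (hleft u) (hright u)).toLinearMap
  have hB : ∀ u V W, MDiffAt (T% V) x → MDiffAt (T% W) x →
      B u (V x) (W x) = tensorDerivOp D S u V W :=
    fun u V W hV hW ↦ TensorialAt.mkHom₂_apply (hleft u) (hright u) hV hW
  have hB_extend : ∀ u v w,
      B u v w = tensorDerivOp D S u (FiberBundle.extend E v) (FiberBundle.extend E w) :=
    fun u v w ↦ rfl
  refine ⟨{ toFun := B, map_add' := fun u u' ↦ ?_, map_smul' := fun c u ↦ ?_ }, ?_⟩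
  · ext v w
    simp only [LinearMap.add_apply, hB_extend, tensorDerivOp, map_add]
    abel
  · ext v w
    simp only [LinearMap.smul_apply, hB_extend, tensorDerivOp, map_smul, RingHom.id_apply]
    module
  · intro V W V' W' hV hW
    refine ⟨hS V W hV.1 hW.1, fun u ↦ ?_⟩
    change _ = B u (V x) (W x) + _ + _
    rw [hB u V W hV.1 hW.1, ← hV.2, ← hW.2, tensorDerivOp]
    abel

namespace HasTensorDerivAt

theorem add (hS : HasTensorDerivAt D S x S') (hT : HasTensorDerivAt D T x T') :
    HasTensorDerivAt D (fun y ↦ S y + T y) x (fun u ↦ S' u + T' u) := fun _ _ _ _ hV hW ↦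
  ((hS hV hW).add (hT hV hW)).congr_deriv fun u ↦ by
    simp only [LinearMap.add_apply]
    abel

theorem const_smul (c : ℝ) (hS : HasTensorDerivAt D S x S') :
    HasTensorDerivAt D (fun y ↦ c • S y) x (fun u ↦ c • S' u) := fun _ _ _ _ hV hW ↦
  ((hS hV hW).const_smul c).congr_deriv fun u ↦ by
    simp only [LinearMap.smul_apply]
    module

theorem sub (hS : HasTensorDerivAt D S x S') (hT : HasTensorDerivAt D T x T') :
    HasTensorDerivAt D (fun y ↦ S y - T y) x (fun u ↦ S' u - T' u) := fun _ _ _ _ hV hW ↦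
  ((hS hV hW).sub (hT hV hW)).congr_deriv fun u ↦ by
    simp only [LinearMap.sub_apply]
    abel

variable [RiemannianBundle (fun x : M ↦ TangentSpace I x)] {J : OrthogonalComplexStructure I M}

theorem compl₁₂ (hD : IsComplexConnection J D) (hS : HasTensorDerivAt D S x S') :
    HasTensorDerivAt D (fun y ↦ (S y).compl₁₂ (J.at y) (J.at y)) x
      (fun u ↦ (S' u).compl₁₂ (J.at x) (J.at x)) := fun _ _ _ _ hV hW ↦
  hS (hV.toFun hD) (hW.toFun hD)

theorem part₁₂ (hD : IsComplexConnection J D) (hS : HasTensorDerivAt D S x S') :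
    HasTensorDerivAt D (fun y ↦ part₁₂ (J.at y) (S y)) x (fun u ↦ part₁₂ (J.at x) (S' u)) :=
  (hS.sub (hS.compl₁₂ hD)).const_smul _

theorem part₃₄ (hD : IsComplexConnection J D) (hS : HasTensorDerivAt D S x S') :
    HasTensorDerivAt D (fun y ↦ part₃₄ (J.at y) (S y)) x (fun u ↦ part₃₄ (J.at x) (S' u)) :=
  (hS.add (hS.compl₁₂ hD)).const_smul _

theorem isSkew (hm : IsMetricConnection D) (hS : HasTensorDerivAt D S x S')
    (h : ∀ y, IsSkew (S y)) (u : TangentSpace I x) : IsSkew (S' u) := by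
  intro v w z
  have hv := hasCovDerivAt_extend (D := D) v
  have hw := hasCovDerivAt_extend (D := D) w
  have hz := hasCovDerivAt_extend (D := D) z
  have hleft := (hS hv hw).mvfderiv_inner hm hz u
  have hright := hw.mvfderiv_inner hm (hS hv hz) u
  simp only [fun y ↦ h y (FiberBundle.extend E v y)] at hleft
  rw [mvfderiv_fun_neg, neg_apply, hright] at hleft
  simp only [FiberBundle.extend_apply_self, inner_add_left, inner_add_right, h x v,
    h x (D (FiberBundle.extend E v) x u)] at hleft
  linarith

theorem apply_toFun (hD : IsComplexConnection J D) (hS : HasTensorDerivAt D S x S')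
    (h : ∀ y v w, S y v (J.toFun y w) = -J.toFun y (S y v w)) (u v w : TangentSpace I x) :
    S' u v (J.toFun x w) = -J.toFun x (S' u v w) := by
  have hv := hasCovDerivAt_extend (D := D) v
  have hw := hasCovDerivAt_extend (D := D) w
  have hleft := (hS hv (hw.toFun hD)).eq u
  have hright := (((hS hv hw).toFun hD).const_smul (-1)).eq u
  simp only [h, ← neg_one_smul ℝ (J.toFun _ _)] at hleft
  rw [hright] at hleft
  simpa only [FiberBundle.extend_apply_self, map_add, h, neg_one_smul, neg_add, add_left_inj]
    using hleft.symm

theorem mem_torsionSpace (hm : IsMetricConnection D) (hD : IsComplexConnection J D)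
    (hS : HasTensorDerivAt D S x S') (h : ∀ y, S y ∈ torsionSpace (J.at y))
    (u : TangentSpace I x) : S' u ∈ torsionSpace (J.at x) :=
  ⟨hS.isSkew hm (fun y ↦ (h y).1) u, hS.apply_toFun hD (fun y ↦ (h y).2) u⟩

end HasTensorDerivAt

section ContMDiffMetric

variable [RiemannianBundle (fun x : M ↦ TangentSpace I x)]
  [IsContMDiffRiemannianBundle I ∞ E (fun x : M ↦ TangentSpace I x)]
  {J : OrthogonalComplexStructure I M}

theorem HasCovDerivAt.vectorTensor (hm : IsMetricConnection D) (hD : IsComplexConnection J D)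
    (hσ : HasCovDerivAt D σ x σ') :
    HasTensorDerivAt D (fun y ↦ vectorTensor (J.at y) (σ y)) x
      (fun u ↦ vectorTensor (J.at x) (σ' u)) := by
  intro V W V' W' hV hW
  have hJW := hW.toFun hD
  have h := (((hσ.smul (mdifferentiableAt_inner hV.1 hW.1)).sub
    (hV.smul (mdifferentiableAt_inner hσ.1 hW.1))).add
    ((hσ.toFun hD).smul (mdifferentiableAt_inner hV.1 hJW.1))).sub
    ((hV.toFun hD).smul (mdifferentiableAt_inner hσ.1 hJW.1))
  refine h.congr_deriv fun u ↦ ?_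
  rw [hV.mvfderiv_inner hm hW, hσ.mvfderiv_inner hm hW, hV.mvfderiv_inner hm hJW,
    hσ.mvfderiv_inner hm hJW]
  simp only [vectorTensor_apply, OrthogonalComplexStructure.at, ContinuousLinearMap.coe_coe]
  module

variable [FiniteDimensional ℝ E]

theorem hasCovDerivAt_of_inner (hm : IsMetricConnection D)
    (hdiff : ∀ Z : ∀ y : M, TangentSpace I y, MDiffAt (T% Z) x →
      MDiffAt (fun y ↦ (inner ℝ (σ y) (Z y) : ℝ)) x)
    (hderiv : ∀ Z : ∀ y : M, TangentSpace I y, MDiffAt (T% Z) x → ∀ u,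
      mvfderiv I (fun y ↦ (inner ℝ (σ y) (Z y) : ℝ)) x u
        = inner ℝ (σ' u) (Z x) + inner ℝ (σ x) (D Z x u)) :
    HasCovDerivAt D σ x σ' := by
  obtain ⟨F, hF⟩ := exists_isOrthonormalFrameAt (I := I) x
  have hσ : MDiffAt (T% σ) x := hF.mdifferentiableAt_of_inner fun i ↦ by
    simpa only [real_inner_comm] using hdiff (F i) (hF.mdifferentiableAt_apply i)
  refine ⟨hσ, fun u ↦ ext_inner_right ℝ fun z ↦ ?_⟩
  have hz := hasCovDerivAt_extend (D := D) z
  have h := hderiv _ hz.1 u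
  rw [(hasCovDerivAt hσ).mvfderiv_inner hm hz] at h
  simpa only [FiberBundle.extend_apply_self, add_left_inj] using h

namespace HasTensorDerivAt

theorem adjoint_flip (hm : IsMetricConnection D) (hS : HasTensorDerivAt D S x S')
    {V W : ∀ y : M, TangentSpace I y} {V' W' : TangentSpace I x → TangentSpace I x}
    (hV : HasCovDerivAt D V x V') (hW : HasCovDerivAt D W x W') :
    HasCovDerivAt D (fun y ↦ LinearMap.adjoint ((S y).flip (V y)) (W y)) x
      (fun u ↦ LinearMap.adjoint ((S' u).flip (V x)) (W x)
        + LinearMap.adjoint ((S x).flip (V' u)) (W x)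
        + LinearMap.adjoint ((S x).flip (V x)) (W' u)) := by
  refine hasCovDerivAt_of_inner hm (fun Z hZ ↦ ?_) fun Z hZ u ↦ ?_
  · simp only [LinearMap.adjoint_inner_left, LinearMap.flip_apply]
    exact mdifferentiableAt_inner hW.1 (hS (hasCovDerivAt hZ) hV).1
  · simp only [inner_add_left, LinearMap.adjoint_inner_left, LinearMap.flip_apply]
    rw [hW.mvfderiv_inner hm (hS (hasCovDerivAt hZ) hV)]
    simp only [inner_add_right]
    ring

theorem cyclicPart (hm : IsMetricConnection D) (hS : HasTensorDerivAt D S x S') :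
    HasTensorDerivAt D (fun y ↦ cyclicPart (S y)) x (fun u ↦ cyclicPart (S' u)) :=
  fun V W _ _ hV hW ↦
    ((((hS hV hW).sub (hS hW hV)).add (hS.adjoint_flip hm hV hW)).const_smul (1 / 3)).congr_deriv
      fun u ↦ by
        simp only [AlmostHermitian.cyclicPart, LinearMap.mk₂_apply]
        module

theorem traceVector (hm : IsMetricConnection D) (hS : HasTensorDerivAt D S x S') :
    HasCovDerivAt D (fun y ↦ traceVector (S y)) x (fun u ↦ traceVector (S' u)) := by
  obtain ⟨F, hF⟩ := exists_isOrthonormalFrameAt (I := I) x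
  have hd := fun i ↦ hasCovDerivAt (D := D) (hF.mdifferentiableAt_apply i)
  have hsum := (HasCovDerivAt.sum Finset.univ fun i ↦ hS (hd i) (hd i)).congr
    (τ := fun y ↦ AlmostHermitian.traceVector (S y)) (by
      filter_upwards [hF.basis] with y ⟨b, hb⟩
      simp only [traceVector_eq_metricTrace, metricTrace_eq_sum b, hb])
  refine hsum.congr_deriv fun u ↦ ?_
  obtain ⟨b, hb⟩ := hF.basis.self_of_nhds
  have hskew : ∀ i j, (inner ℝ (D (F i) x u) (b j) : ℝ) = -inner ℝ (D (F j) x u) (b i) :=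
    fun i j ↦ by
      simpa only [hb] using (hm.eventually_inner_frame_eq_neg hF i j).self_of_nhds u
  have hzero := sum_apply_skew_variation_eq_zero b hskew (S x)
  simp only [hb] at hzero
  simp only [add_assoc]
  rw [Finset.sum_add_distrib, hzero, add_zero, traceVector_eq_metricTrace, metricTrace_eq_sum b]
  simp only [hb]

theorem comp₁ (hm : IsMetricConnection D) (hD : IsComplexConnection J D)
    (hS : HasTensorDerivAt D S x S') :
    HasTensorDerivAt D (fun y ↦ comp₁ (J.at y) (S y)) x (fun u ↦ comp₁ (J.at x) (S' u)) :=
  (hS.part₁₂ hD).cyclicPart hm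

theorem comp₂ (hm : IsMetricConnection D) (hD : IsComplexConnection J D)
    (hS : HasTensorDerivAt D S x S') :
    HasTensorDerivAt D (fun y ↦ comp₂ (J.at y) (S y)) x (fun u ↦ comp₂ (J.at x) (S' u)) :=
  (hS.part₁₂ hD).sub (hS.comp₁ hm hD)

theorem comp₄ (hm : IsMetricConnection D) (hD : IsComplexConnection J D) (n : ℕ)
    (hS : HasTensorDerivAt D S x S') :
    HasTensorDerivAt D (fun y ↦ comp₄ n (J.at y) (S y)) x (fun u ↦ comp₄ n (J.at x) (S' u)) :=
  ((hS.traceVector hm).vectorTensor hm hD).const_smul _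

theorem comp₃ (hm : IsMetricConnection D) (hD : IsComplexConnection J D) (n : ℕ)
    (hS : HasTensorDerivAt D S x S') :
    HasTensorDerivAt D (fun y ↦ comp₃ n (J.at y) (S y)) x (fun u ↦ comp₃ n (J.at x) (S' u)) :=
  (hS.part₃₄ hD).sub (hS.comp₄ hm hD n)

end HasTensorDerivAt

end ContMDiffMetric

end TensorCalculus

/-! ### Lie brackets and iterated derivatives -/

section LieBracket

open Filter Topology VectorField

variable {E : Type*} [NormedAddCommGroup E] [NormedSpace ℝ E]
  {H : Type*} [TopologicalSpace H] {I : ModelWithCorners ℝ E H}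
  {M : Type*} [TopologicalSpace M] [ChartedSpace H M] [IsManifold I ∞ M]
  {U V W : ∀ y : M, TangentSpace I y} {f : M → ℝ} {x : M}

/-- The constant vector field on `E` with value `c`. -/
def constantField (c : E) (z : E) : TangentSpace 𝓘(ℝ, E) z := c

theorem mdifferentiableAt_constantField (c z : E) : MDiffAt (T% (constantField c)) z := by
  have hsmooth : CMDiffAt 1 (T% (constantField c)) z :=
    contMDiffAt_vectorSpace_iff_contDiffAt.2 contDiffAt_const
  exact hsmooth.mdifferentiableAt one_ne_zero

theorem mlieBracket_constantField (c d : E) :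
    mlieBracket 𝓘(ℝ, E) (constantField c) (constantField d) = 0 := by
  rw [← mlieBracketWithin_univ, mlieBracketWithin_eq_lieBracketWithin]
  funext z
  change fderivWithin ℝ (fun _ ↦ d) Set.univ z c - fderivWithin ℝ (fun _ ↦ c) Set.univ z d = 0
  simp

theorem eventually_extend_eq_mpullback (v : TangentSpace I x) :
    ∀ᶠ y in 𝓝 x, FiberBundle.extend E v y = mpullback I 𝓘(ℝ, E) (extChartAt I x)
      (constantField (trivializationAt E (TangentSpace I) x ⟨x, v⟩).2) y := by
  filter_upwards [extChartAt_source_mem_nhds (I := I) x] with y hy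
  have hchart : y ∈ (chartAt H x).source := by rwa [extChartAt_source] at hy
  have hbase : y ∈ (trivializationAt E (TangentSpace I : M → Type _) x).baseSet := by
    simpa using hchart
  refine ((isInvertible_mfderiv_extChartAt hy).inverse_apply_eq.2 ?_).symm
  rw [← TangentBundle.continuousLinearMapAt_trivializationAt hchart]
  have hcoord := (trivializationAt E (TangentSpace I : M → Type _) x).continuousLinearMapAt_symmL
    (R := ℝ) hbase (trivializationAt E (TangentSpace I) x ⟨x, v⟩).2
  rw [Trivialization.symmL_apply _ hbase] at hcoord
  exact hcoord.symm

variable [CompleteSpace E]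

theorem mlieBracket_mlieBracket_smul (hV : CMDiffAt ∞ (T% V) x)
    (hW : CMDiffAt ∞ (T% W) x) (hf : CMDiffAt ∞ f x) :
    mlieBracket I U (mlieBracket I V (f • W)) x
      = mvfderiv I (fun y ↦ mvfderiv I f y (V y)) x (U x) • W x
        + mvfderiv I f x (V x) • mlieBracket I U W x
        + (mvfderiv I f x (U x) • mlieBracket I V W x
          + f x • mlieBracket I U (mlieBracket I V W) x) := by
  have hVfW : mlieBracket I V (f • W) =ᶠ[𝓝 x]
      (fun y ↦ mvfderiv I f y (V y)) • W + f • mlieBracket I V W := by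
    filter_upwards [eventually_mdifferentiableAt hW, eventually_mdifferentiableAt hf] with y hy hfy
    exact mlieBracket_smul_right hfy hy
  have hVf := (contMDiffAt_mvfderiv hf hV).mdifferentiableAt (by simp)
  have hVW := (contMDiffAt_mlieBracket hV hW).mdifferentiableAt (by simp)
  have hW' := hW.mdifferentiableAt (by simp)
  have hf' := hf.mdifferentiableAt (by simp)
  rw [EventuallyEq.mlieBracket_vectorField_eq (.refl _ U) hVfW,
    mlieBracket_add_right (hVf.smul_section hW') (hf'.smul_section hVW),
    mlieBracket_smul_right hVf hW', mlieBracket_smul_right hf' hVW]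

-- Compare the coefficients of `W` in the Jacobi identities for `U, V, f W` and for `U, V, W`.
theorem mvfderiv_mlieBracket (hU : CMDiffAt ∞ (T% U) x) (hV : CMDiffAt ∞ (T% V) x)
    (hf : CMDiffAt ∞ f x) :
    mvfderiv I f x (mlieBracket I U V x)
      = mvfderiv I (fun y ↦ mvfderiv I f y (V y)) x (U x)
        - mvfderiv I (fun y ↦ mvfderiv I f y (U y)) x (V x) := by
  rcases subsingleton_or_nontrivial (TangentSpace I x) with hE | hE
  · simp only [Subsingleton.elim _ (0 : TangentSpace I x), map_zero, sub_zero]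
  obtain ⟨w, hw⟩ := exists_ne (0 : TangentSpace I x)
  have : IsManifold I (minSmoothness ℝ 3) M := by
    rw [minSmoothness_of_isRCLikeNormedField]
    exact IsManifold.of_le (n := ∞) (by norm_cast)
  have hle : minSmoothness ℝ 2 ≤ (∞ : ℕ∞ω) := by
    rw [minSmoothness_of_isRCLikeNormedField]
    norm_cast
  have jacobi {Z : ∀ y : M, TangentSpace I y} (hZ : CMDiffAt ∞ (T% Z) x) :=
    leibniz_identity_mlieBracket_apply (hU.of_le hle) (hV.of_le hle) (hZ.of_le hle)
  have hW : CMDiffAt ∞ (T% (FiberBundle.extend E w)) x := FiberBundle.contMDiffAt_extend ..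
  have hfW : mlieBracket I U (mlieBracket I V (f • FiberBundle.extend E w)) x = _ :=
    jacobi (hf.smul_section hW)
  rw [mlieBracket_mlieBracket_smul hV hW hf, mlieBracket_mlieBracket_smul hU hW hf,
    mlieBracket_smul_right (hf.mdifferentiableAt (by simp)) (hW.mdifferentiableAt (by simp)),
    jacobi hW, FiberBundle.extend_apply_self] at hfW
  refine (sub_eq_zero.1 ((smul_eq_zero.1 (?_ : _ • w = 0)).resolve_right hw)).symm
  rw [← sub_eq_zero.2 hfW]
  module

theorem mvfderiv_comm (hU : CMDiffAt ∞ (T% U) x) (hV : CMDiffAt ∞ (T% V) x)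
    (hf : CMDiffAt ∞ f x) (h : mlieBracket I U V x = 0) :
    mvfderiv I (fun y ↦ mvfderiv I f y (V y)) x (U x)
      = mvfderiv I (fun y ↦ mvfderiv I f y (U y)) x (V x) := by
  rw [← sub_eq_zero, ← mvfderiv_mlieBracket hU hV hf, h, map_zero]

theorem eventually_mlieBracket_extend_eq_zero (u v : TangentSpace I x) :
    ∀ᶠ y in 𝓝 x, mlieBracket I (FiberBundle.extend E u) (FiberBundle.extend E v) y = 0 := by
  have : IsManifold I (minSmoothness ℝ 2) M := by
    rw [minSmoothness_of_isRCLikeNormedField]; infer_instance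
  have hle : minSmoothness ℝ 2 ≤ (∞ : ℕ∞ω) := by
    rw [minSmoothness_of_isRCLikeNormedField]
    norm_cast
  filter_upwards [(eventually_extend_eq_mpullback u).eventually_nhds,
    (eventually_extend_eq_mpullback v).eventually_nhds,
    extChartAt_source_mem_nhds (I := I) x] with y hu hv hy
  have hchart : y ∈ (chartAt H x).source := by rwa [extChartAt_source] at hy
  rw [EventuallyEq.mlieBracket_vectorField_eq hu hv,
    ← mpullback_mlieBracket (n := ∞) (mdifferentiableAt_constantField _ _)
      (mdifferentiableAt_constantField _ _) (contMDiffAt_extChartAt' hchart) hle,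
    mlieBracket_constantField]
  exact map_zero _

end LieBracket

/-! ### The exterior derivatives of the Kähler form -/

section ExteriorDerivative

open Filter Topology VectorField

variable {E : Type*} [NormedAddCommGroup E] [NormedSpace ℝ E]
  {H : Type*} [TopologicalSpace H] {I : ModelWithCorners ℝ E H}
  {M : Type*} [TopologicalSpace M] [ChartedSpace H M]

/-- The invariant formula for `dα(U, V, W)` at `x`, for a `2`-form `α` and arbitrary vector
fields. -/
def extDeriv₂Fields (α : ∀ x : M, TangentSpace I x → TangentSpace I x → ℝ)
    (U V W : ∀ y : M, TangentSpace I y) (x : M) : ℝ :=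
  mvfderiv I (fun y ↦ α y (V y) (W y)) x (U x)
    - mvfderiv I (fun y ↦ α y (U y) (W y)) x (V x)
    + mvfderiv I (fun y ↦ α y (U y) (V y)) x (W x)
    - α x (mlieBracket I U V x) (W x)
    + α x (mlieBracket I U W x) (V x)
    - α x (mlieBracket I V W x) (U x)

theorem extDeriv₂Fields_extend [IsManifold I 1 M]
    (α : ∀ x : M, TangentSpace I x → TangentSpace I x → ℝ) {x : M} (u v w : TangentSpace I x) :
    extDeriv₂Fields α (FiberBundle.extend E u) (FiberBundle.extend E v) (FiberBundle.extend E w) x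
      = extDeriv₂ α x u v w := by
  simp only [extDeriv₂Fields, extDeriv₂, FiberBundle.extend_apply_self]

variable [IsManifold I ∞ M] [RiemannianBundle (fun x : M ↦ TangentSpace I x)]
  {J : OrthogonalComplexStructure I M} {x : M} {U V W : ∀ y : M, TangentSpace I y}

section Smooth

variable [IsContMDiffRiemannianBundle I ∞ E (fun x : M ↦ TangentSpace I x)]

theorem contMDiffAt_kahlerForm_extend (u v : TangentSpace I x) :
    CMDiffAt ∞ (fun y ↦ kahlerForm J y (FiberBundle.extend E u y) (FiberBundle.extend E v y)) x :=
  contMDiffAt_inner (FiberBundle.contMDiffAt_extend ..)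
    (J.contMDiffAt_toFun (FiberBundle.contMDiffAt_extend ..))

theorem mvfderiv_cyclicForm {C : CovariantDerivative I E (TangentSpace I : M → Type _)}
    (hm : IsMetricConnection C) (hc : IsComplexConnection J C)
    {S : ∀ x : M, TangentSpace I x →ₗ[ℝ] TangentSpace I x →ₗ[ℝ] TangentSpace I x}
    {D : TangentSpace I x →ₗ[ℝ] TangentSpace I x →ₗ[ℝ] TangentSpace I x →ₗ[ℝ] TangentSpace I x}
    (hS : HasTensorDerivAt C S x (fun u ↦ D u))
    {U' V' W' : TangentSpace I x → TangentSpace I x} (hU : HasCovDerivAt C U x U')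
    (hV : HasCovDerivAt C V x V') (hW : HasCovDerivAt C W x W') (t : TangentSpace I x) :
    mvfderiv I (fun y ↦ cyclicForm (J.at y) (S y) (U y) (V y) (W y)) x t
      = cyclicForm (J.at x) (D t) (U x) (V x) (W x)
        + cyclicForm (J.at x) (S x) (U' t) (V x) (W x)
        + cyclicForm (J.at x) (S x) (U x) (V' t) (W x)
        + cyclicForm (J.at x) (S x) (U x) (V x) (W' t) := by
  let φ (X Y Z : ∀ y : M, TangentSpace I y) (y : M) : ℝ :=
    inner ℝ (S y (X y) (Y y)) (J.toFun y (Z y))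
  have hφ {X Y Z : ∀ y : M, TangentSpace I y} {X' Y' Z' : TangentSpace I x → TangentSpace I x}
      (hX : HasCovDerivAt C X x X') (hY : HasCovDerivAt C Y x Y') (hZ : HasCovDerivAt C Z x Z') :
      MDiffAt (φ X Y Z) x :=
    mdifferentiableAt_inner (hS hX hY).1 (J.mdifferentiableAt_toFun hZ.1)
  have hφ' {X Y Z : ∀ y : M, TangentSpace I y} {X' Y' Z' : TangentSpace I x → TangentSpace I x}
      (hX : HasCovDerivAt C X x X') (hY : HasCovDerivAt C Y x Y') (hZ : HasCovDerivAt C Z x Z') :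
      mvfderiv I (φ X Y Z) x t = _ :=
    (hS hX hY).mvfderiv_inner hm (hZ.toFun hc) t
  change mvfderiv I ((fun _ ↦ (2 : ℝ)) * (φ U V W + φ V W U + φ W U V)) x t = _
  rw [mvfderiv_mul mdifferentiableAt_const
      (((hφ hU hV hW).add (hφ hV hW hU)).add (hφ hW hU hV)), mvfderiv_const,
    mvfderiv_add ((hφ hU hV hW).add (hφ hV hW hU)) (hφ hW hU hV),
    mvfderiv_add (hφ hU hV hW) (hφ hV hW hU)]
  simp only [add_apply, smul_apply, smul_eq_mul, smul_zero, add_zero, hφ' hU hV hW,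
    hφ' hV hW hU, hφ' hW hU hV, cyclicForm, J.at_apply, inner_add_left]
  ring

end Smooth

variable [FiniteDimensional ℝ E] {nabla : CovariantDerivative I E (TangentSpace I : M → Type _)}

theorem IsLeviCivita.mlieBracket_eq_minimalConnection (h : IsLeviCivita nabla)
    (J : OrthogonalComplexStructure I M) (hU : MDiffAt (T% U) x) (hV : MDiffAt (T% V) x) :
    mlieBracket I U V x
      = minimalConnection J nabla V x (U x) - minimalConnection J nabla U x (V x)
        - (intrinsicTorsion J nabla x (U x) (V x) - intrinsicTorsion J nabla x (V x) (U x)) := by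
  rw [h.mlieBracket_eq hU hV, minimalConnection_eq_add, minimalConnection_eq_add]
  abel

theorem IsLeviCivita.extDeriv₂Fields_kahlerForm (h : IsLeviCivita nabla)
    (hU : MDiffAt (T% U) x) (hV : MDiffAt (T% V) x) (hW : MDiffAt (T% W) x) :
    extDeriv₂Fields (kahlerForm J) U V W x
      = cyclicForm (J.at x) (intrinsicTorsion J nabla x) (U x) (V x) (W x) := by
  have hleibniz {A B : ∀ y : M, TangentSpace I y} (hA : MDiffAt (T% A) x) (hB : MDiffAt (T% B) x)
      (u : TangentSpace I x) : mvfderiv I (fun y ↦ kahlerForm J y (A y) (B y)) x u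
        = inner ℝ (minimalConnection J nabla A x u) (J.toFun x (B x))
          + inner ℝ (A x) (J.toFun x (minimalConnection J nabla B x u)) :=
    (hasCovDerivAt hA).mvfderiv_inner (IsMetricConnection.minimalConnection h.metric)
      ((hasCovDerivAt hB).toFun isComplexConnection_minimalConnection) u
  have hξ (a b c : TangentSpace I x) : inner ℝ (intrinsicTorsion J nabla x a b) (J.toFun x c)
      = -inner ℝ (intrinsicTorsion J nabla x a c) (J.toFun x b) :=
    inner_apply_map_swap (J.isOrthogonalComplex_at x)
      (intrinsicTorsion_mem_torsionSpace h.metric x) a b c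
  have hJ (a b : TangentSpace I x) : inner ℝ a (J.toFun x b) = -inner ℝ b (J.toFun x a) := by
    rw [← J.inner_toFun_left, real_inner_comm]
  rw [extDeriv₂Fields, hleibniz hV hW, hleibniz hU hW, hleibniz hU hV,
    h.mlieBracket_eq_minimalConnection J hU hV, h.mlieBracket_eq_minimalConnection J hU hW,
    h.mlieBracket_eq_minimalConnection J hV hW, hJ (V x), hJ (U x), hJ (U x)]
  simp only [kahlerForm, cyclicForm, J.at_apply, inner_sub_left]
  linarith [hξ (V x) (U x) (W x), hξ (U x) (W x) (V x), hξ (W x) (V x) (U x)]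

theorem IsLeviCivita.extDeriv₂_kahlerForm (h : IsLeviCivita nabla) (x : M) :
    extDeriv₂ (kahlerForm J) x = cyclicForm (J.at x) (intrinsicTorsion J nabla x) := by
  funext u v w
  rw [← extDeriv₂Fields_extend, h.extDeriv₂Fields_kahlerForm
    (FiberBundle.mdifferentiableAt_extend ..) (FiberBundle.mdifferentiableAt_extend ..)
    (FiberBundle.mdifferentiableAt_extend ..)]
  simp only [FiberBundle.extend_apply_self]

theorem IsLeviCivita.eventually_extDeriv₂_kahlerForm_extend (h : IsLeviCivita nabla)
    (u v w : TangentSpace I x) :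
    let U := FiberBundle.extend E u
    let V := FiberBundle.extend E v
    let W := FiberBundle.extend E w
    ∀ᶠ y in 𝓝 x, extDeriv₂ (kahlerForm J) y (U y) (V y) (W y)
      = mvfderiv I (fun y ↦ kahlerForm J y (V y) (W y)) y (U y)
        - mvfderiv I (fun y ↦ kahlerForm J y (U y) (W y)) y (V y)
        + mvfderiv I (fun y ↦ kahlerForm J y (U y) (V y)) y (W y) := by
  intro U V W
  have hdiff (a : TangentSpace I x) :=
    eventually_mdifferentiableAt (FiberBundle.contMDiffAt_extend (k := ∞) I E a)
  have : CompleteSpace E := FiniteDimensional.complete ℝ E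
  filter_upwards [eventually_mlieBracket_extend_eq_zero u v,
    eventually_mlieBracket_extend_eq_zero u w, eventually_mlieBracket_extend_eq_zero v w,
    hdiff u, hdiff v, hdiff w] with y huv huw hvw hu hv hw
  rw [h.extDeriv₂_kahlerForm, ← h.extDeriv₂Fields_kahlerForm hu hv hw, extDeriv₂Fields, huv, huw,
    hvw]
  simp only [kahlerForm, inner_zero_left, sub_zero, add_zero, U, V, W]

variable [IsContMDiffRiemannianBundle I ∞ E (fun x : M ↦ TangentSpace I x)]

theorem IsLeviCivita.extDeriv₃_extDeriv₂_kahlerForm (h : IsLeviCivita nabla)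
    {D : TangentSpace I x →ₗ[ℝ] TangentSpace I x →ₗ[ℝ] TangentSpace I x →ₗ[ℝ] TangentSpace I x}
    (hD : HasTensorDerivAt (minimalConnection J nabla) (intrinsicTorsion J nabla) x (fun u ↦ D u)) :
    extDeriv₃ (extDeriv₂ (kahlerForm J)) x
      = cyclicFormDeriv (J.at x) D (intrinsicTorsion J nabla x) := by
  funext t u v w
  have hderiv (a b c z : TangentSpace I x) := mvfderiv_cyclicForm (J := J)
    (IsMetricConnection.minimalConnection h.metric) isComplexConnection_minimalConnection hD
    (hasCovDerivAt_extend a) (hasCovDerivAt_extend b) (hasCovDerivAt_extend c) z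
  have hbracket (a b : TangentSpace I x) := h.mlieBracket_eq_minimalConnection J
    (FiberBundle.mdifferentiableAt_extend I E a) (FiberBundle.mdifferentiableAt_extend I E b)
  have hswap := cyclicForm_swap (J.isOrthogonalComplex_at x)
    (intrinsicTorsion_mem_torsionSpace (J := J) h.metric x)
  rw [show extDeriv₂ (kahlerForm J) = _ from funext fun y ↦ h.extDeriv₂_kahlerForm y]
  simp only [extDeriv₃, hderiv, hbracket, FiberBundle.extend_apply_self, cyclicFormDeriv,
    (isLinearMap_cyclicForm _ _).map_sub]
  -- move the derivatives of the extensions into the first argument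
  simp only [hswap _ (minimalConnection J nabla (FiberBundle.extend E _) x _) _,
    ← cyclicForm_rotate (minimalConnection J nabla (FiberBundle.extend E _) x _) _ _]
  ring

theorem IsLeviCivita.mvfderiv_extDeriv₂_kahlerForm_extend (h : IsLeviCivita nabla)
    (u v w t : TangentSpace I x) :
    let U := FiberBundle.extend E u
    let V := FiberBundle.extend E v
    let W := FiberBundle.extend E w
    mvfderiv I (fun y ↦ extDeriv₂ (kahlerForm J) y (U y) (V y) (W y)) x t
      = mvfderiv I (fun y ↦ mvfderiv I (fun y ↦ kahlerForm J y (V y) (W y)) y (U y)) x t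
        - mvfderiv I (fun y ↦ mvfderiv I (fun y ↦ kahlerForm J y (U y) (W y)) y (V y)) x t
        + mvfderiv I (fun y ↦ mvfderiv I (fun y ↦ kahlerForm J y (U y) (V y)) y (W y)) x t := by
  intro U V W
  let φ (A B C : ∀ y : M, TangentSpace I y) (y : M) : ℝ :=
    mvfderiv I (fun z ↦ kahlerForm J z (A z) (B z)) y (C y)
  have hφ (a b c : TangentSpace I x) :
      MDiffAt (φ (FiberBundle.extend E a) (FiberBundle.extend E b) (FiberBundle.extend E c)) x :=
    (contMDiffAt_mvfderiv (contMDiffAt_kahlerForm_extend (J := J) a b)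
      (FiberBundle.contMDiffAt_extend ..)).mdifferentiableAt (by simp)
  have hd : (fun y ↦ extDeriv₂ (kahlerForm J) y (U y) (V y) (W y))
      =ᶠ[𝓝 x] φ V W U - φ U W V + φ U V W := h.eventually_extDeriv₂_kahlerForm_extend u v w
  rw [mvfderiv_congr hd, mvfderiv_add ((hφ v w u).sub (hφ u w v)) (hφ u v w),
    mvfderiv_sub (hφ v w u) (hφ u w v)]
  rfl

theorem IsLeviCivita.extDeriv₃_extDeriv₂_kahlerForm_eq_zero (h : IsLeviCivita nabla)
    (t u v w : TangentSpace I x) :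
    extDeriv₃ (extDeriv₂ (kahlerForm J)) x t u v w = 0 := by
  have : CompleteSpace E := FiniteDimensional.complete ℝ E
  have hbracket (a b : TangentSpace I x) :
      mlieBracket I (FiberBundle.extend E a) (FiberBundle.extend E b) x = 0 :=
    (eventually_mlieBracket_extend_eq_zero a b).self_of_nhds
  have hzero (a b : TangentSpace I x) : extDeriv₂ (kahlerForm J) x 0 a b = 0 := by
    rw [h.extDeriv₂_kahlerForm]
    exact (isLinearMap_cyclicForm a b).map_zero
  have hcomm (a b c z : TangentSpace I x) := mvfderiv_comm
    (FiberBundle.contMDiffAt_extend I E c) (FiberBundle.contMDiffAt_extend I E z)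
    (contMDiffAt_kahlerForm_extend (J := J) a b) (hbracket c z)
  simp only [FiberBundle.extend_apply_self] at hcomm
  simp only [extDeriv₃, hbracket, hzero, h.mvfderiv_extDeriv₂_kahlerForm_extend]
  rw [hcomm v w t u, hcomm u w t v, hcomm u v t w, hcomm t w u v, hcomm t v u w, hcomm t u v w]
  ring

end ExteriorDerivative

section Coefficients

variable {n : ℕ}

theorem relationCoeff_eq_zero_iff (hn : 3 ≤ n) (k : Fin 8) :
    relationCoeff n k = 0 ↔ n = 5 ∧ k = 4 := by
  have hn₁ : (n : ℝ) - 1 ≠ 0 := sub_ne_zero.2 (by norm_cast; lia)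
  have hn₂ : (n : ℝ) - 2 ≠ 0 := sub_ne_zero.2 (by norm_cast; lia)
  have hn₅ : (n : ℝ) - 5 = 0 ↔ n = 5 := sub_eq_zero.trans (by norm_cast)
  fin_cases k <;> simp [relationCoeff, hn₁, hn₂, hn₅]

theorem ricciStarCoeff_sub (hn : n ≠ 1) (k : Fin 8) :
    ricciStarCoeff n k - ricciStarCoeff' k = relationCoeff n k := by
  have hn' : (n : ℝ) - 1 ≠ 0 := sub_ne_zero.2 (mod_cast hn)
  fin_cases k <;> simp [relationCoeff, ricciStarCoeff, ricciStarCoeff'] <;> field_simp <;> ring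

theorem ricciStarCoeffElim_eq (hn : n ≠ 1) (k : Fin 8) :
    ricciStarCoeffElim n k = ricciStarCoeff n k - 2 / 3 * relationCoeff n k := by
  have hn' : (n : ℝ) - 1 ≠ 0 := sub_ne_zero.2 (mod_cast hn)
  fin_cases k <;> simp [relationCoeff, ricciStarCoeff, ricciStarCoeffElim] <;> field_simp <;> ring

theorem ricciStarCoeffElim_eq_zero_iff (hn : n ≠ 1) (k : Fin 8) :
    ricciStarCoeffElim n k = 0 ↔ k = 0 := by
  have hn₁ : (n : ℝ) - 1 ≠ 0 := sub_ne_zero.2 (mod_cast hn)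
  have hn₂ : (n : ℝ) + 1 ≠ 0 := by positivity
  have hn₃ : 2 * (n : ℝ) - 1 ≠ 0 := sub_ne_zero.2 (by norm_cast; lia)
  fin_cases k <;> simp [ricciStarCoeffElim, hn₁, hn₂, hn₃]

theorem eq_neg_sum_erase_of_sum_eq_zero {𝕜 ι : Type*} [Field 𝕜] [Fintype ι] [DecidableEq ι]
    {c a : ι → 𝕜} (h : ∑ k, c k * a k = 0) {k : ι} (hk : c k ≠ 0) :
    a k = -∑ j ∈ Finset.univ.erase k, c j / c k * a j := by
  rw [← Finset.add_sum_erase _ _ (Finset.mem_univ k)] at h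
  simp only [div_mul_eq_mul_div, ← Finset.sum_div]
  rw [← neg_div, eq_div_iff hk, mul_comm]
  exact eq_neg_of_add_eq_zero_left h

end Coefficients

/-! ### The relation on the manifold -/

section Relation

variable {E : Type*} [NormedAddCommGroup E] [NormedSpace ℝ E] [FiniteDimensional ℝ E]
  {H : Type*} [TopologicalSpace H] {I : ModelWithCorners ℝ E H}
  {M : Type*} [TopologicalSpace M] [ChartedSpace H M] [IsManifold I ∞ M]
  [RiemannianBundle (fun x : M ↦ TangentSpace I x)]
  [IsContMDiffRiemannianBundle I ∞ E (fun x : M ↦ TangentSpace I x)]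
  {J : OrthogonalComplexStructure I M}
  {nabla : CovariantDerivative I E (TangentSpace I : M → Type _)} {x : M} {n : ℕ}
  {ι : Type*} [Fintype ι] (e : OrthonormalBasis ι ℝ (TangentSpace I x))

theorem IsLeviCivita.exists_hasTensorDerivAt_intrinsicTorsion (h : IsLeviCivita nabla)
    (J : OrthogonalComplexStructure I M) (x : M) :
    ∃ D : TangentSpace I x →ₗ[ℝ] TangentSpace I x →ₗ[ℝ] TangentSpace I x →ₗ[ℝ] TangentSpace I x,
      HasTensorDerivAt (minimalConnection J nabla) (intrinsicTorsion J nabla) x (fun u ↦ D u) ∧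
      ∀ u, D u ∈ torsionSpace (J.at x) := by
  obtain ⟨D, hD⟩ := exists_hasTensorDerivAt (minimalConnection J nabla)
    (h.isDiffTensorAt_intrinsicTorsion (J := J) x)
  exact ⟨D, hD, hD.mem_torsionSpace (IsMetricConnection.minimalConnection h.metric)
    isComplexConnection_minimalConnection (intrinsicTorsion_mem_torsionSpace h.metric)⟩

section Components

variable {S' : TangentSpace I x → TangentSpace I x →ₗ[ℝ] TangentSpace I x →ₗ[ℝ] TangentSpace I x}

theorem relationTerm_eq (hm : IsMetricConnection nabla)
    (hD : HasTensorDerivAt (minimalConnection J nabla) (intrinsicTorsion J nabla) x S') :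
    relationTerm J nabla n x e
      = ![divTerm e (fun u v w ↦ comp₁ (J.at x) (S' u) v w),
        divTerm e (fun u v w ↦ comp₃ n (J.at x) (S' u) v w),
        divTerm e (fun u v w ↦ comp₄ n (J.at x) (S' u) v w),
        mixedTerm e (xi₃ J nabla n x) (xi₁ J nabla x),
        traceTerm e (xi₁ J nabla x) (xi₄ J nabla n x),
        mixedTerm e (xi₃ J nabla n x) (xi₂ J nabla x),
        traceTerm e (xi₂ J nabla x) (xi₄ J nabla n x),
        traceTerm e (xi₃ J nabla n x) (xi₄ J nabla n x)] := by
  have hm' := hm.minimalConnection (J := J)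
  have hJ := isComplexConnection_minimalConnection (J := J) (nabla := nabla)
  have h₁ : tensorDeriv _ (xi₁ J nabla) x = _ := (hD.comp₁ hm' hJ).tensorDeriv_eq
  have h₃ : tensorDeriv _ (xi₃ J nabla n) x = _ := (hD.comp₃ hm' hJ n).tensorDeriv_eq
  have h₄ : tensorDeriv _ (xi₄ J nabla n) x = _ := (hD.comp₄ hm' hJ n).tensorDeriv_eq
  rw [relationTerm, h₁, h₃, h₄]

theorem divXi₂_eq (hm : IsMetricConnection nabla)
    (hD : HasTensorDerivAt (minimalConnection J nabla) (intrinsicTorsion J nabla) x S') :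
    divXi₂ J nabla x e = divTerm e (fun u v w ↦ comp₂ (J.at x) (S' u) v w) :=
  congrArg _ (hD.comp₂ hm.minimalConnection isComplexConnection_minimalConnection).tensorDeriv_eq

end Components

theorem IsLeviCivita.isLambda20_relationTerm (h : IsLeviCivita nabla) (k : Fin 8) :
    IsLambda20 (J.at x) (relationTerm J nabla n x e k) := by
  obtain ⟨D, hD, hDt⟩ := h.exists_hasTensorDerivAt_intrinsicTorsion J x
  have hJ := J.isOrthogonalComplex_at x
  have hT := intrinsicTorsion_mem_torsionSpace (J := J) h.metric x
  have h₁ : xi₁ J nabla x ∈ torsionSpace (J.at x) := comp₁_mem_torsionSpace hJ hT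
  have h₂ : xi₂ J nabla x ∈ torsionSpace (J.at x) := comp₂_mem_torsionSpace hJ hT
  have h₃ : xi₃ J nabla n x ∈ torsionSpace (J.at x) := comp₃_mem_torsionSpace hJ hT
  have h₃' : IsInvariant (J.at x) (xi₃ J nabla n x) := isInvariant_comp₃ hJ
  rw [relationTerm_eq e h.metric hD]
  revert k
  simp only [Fin.forall_fin_succ, Matrix.cons_val_zero, Matrix.cons_val_succ, IsEmpty.forall_iff,
    and_true]
  exact ⟨isLambda20_divTerm e hJ fun u ↦ comp₁_mem_torsionSpace hJ (hDt u),
    isLambda20_divTerm e hJ fun u ↦ comp₃_mem_torsionSpace hJ (hDt u),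
    isLambda20_divTerm e hJ fun u ↦ comp₄_mem_torsionSpace hJ,
    isLambda20_mixedTerm e hJ h₃.1 h₃' h₁, isLambda20_traceTerm e hJ h₁ _,
    isLambda20_mixedTerm e hJ h₃.1 h₃' h₂, isLambda20_traceTerm e hJ h₂ _,
    isLambda20_traceTerm e hJ h₃ _⟩

theorem IsLeviCivita.lambda20Part_extDeriv₃ (h : IsLeviCivita nabla) (hn : n ≠ 1)
    (hE : Module.finrank ℝ E = 2 * n) (X Y : TangentSpace I x) :
    lambda20Part (J.at x) e (extDeriv₃ (extDeriv₂ (kahlerForm J)) x) X Y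
      = 4 * ∑ k, relationCoeff n k * relationTerm J nabla n x e k X Y := by
  obtain ⟨D, hD, hDt⟩ := h.exists_hasTensorDerivAt_intrinsicTorsion J x
  rw [h.extDeriv₃_extDeriv₂_kahlerForm hD,
    lambda20Part_cyclicFormDeriv e (J.isOrthogonalComplex_at x)
      (intrinsicTorsion_mem_torsionSpace h.metric x) hDt hn hE,
    relationTerm_eq e h.metric hD]
  simp only [Fin.sum_univ_eight, relationCoeff, xi₁, xi₂, xi₃, xi₄, Matrix.cons_val]
  ring

theorem IsLeviCivita.sum_relationCoeff_mul_relationTerm (h : IsLeviCivita nabla) (hn : n ≠ 1)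
    (hE : Module.finrank ℝ E = 2 * n) (X Y : TangentSpace I x) :
    ∑ k, relationCoeff n k * relationTerm J nabla n x e k X Y = 0 := by
  have hpart := h.lambda20Part_extDeriv₃ (J := J) e hn hE X Y
  simp only [lambda20Part, h.extDeriv₃_extDeriv₂_kahlerForm_eq_zero, mul_zero,
    Finset.sum_const_zero, sub_zero] at hpart
  linarith

theorem IsLeviCivita.ricciStarExpr_intrinsicTorsion (h : IsLeviCivita nabla) (hn : n ≠ 1)
    (hE : Module.finrank ℝ E = 2 * n) (X Y : TangentSpace I x) :
    ricciStarExpr (J.at x) e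
        (tensorDeriv (minimalConnection J nabla) (intrinsicTorsion J nabla) x)
        (intrinsicTorsion J nabla x) X Y
      = -divXi₂ J nabla x e X Y
        + ∑ k, ricciStarCoeff n k * relationTerm J nabla n x e k X Y := by
  obtain ⟨D, hD, hDt⟩ := h.exists_hasTensorDerivAt_intrinsicTorsion J x
  rw [hD.tensorDeriv_eq, ricciStarExpr_eq e X Y (J.isOrthogonalComplex_at x)
    (intrinsicTorsion_mem_torsionSpace h.metric x) hDt hn hE, divXi₂_eq e h.metric hD,
    relationTerm_eq e h.metric hD]
  simp only [Fin.sum_univ_eight, ricciStarCoeff, xi₁, xi₂, xi₃, xi₄, Matrix.cons_val]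
  ring

theorem IsLeviCivita.ricciStarExpr'_intrinsicTorsion (h : IsLeviCivita nabla) (hn : n ≠ 1)
    (hE : Module.finrank ℝ E = 2 * n) (X Y : TangentSpace I x) :
    ricciStarExpr' (J.at x) e
        (tensorDeriv (minimalConnection J nabla) (intrinsicTorsion J nabla) x)
        (intrinsicTorsion J nabla x) X Y
      = -divXi₂ J nabla x e X Y
        + ∑ k, ricciStarCoeff' k * relationTerm J nabla n x e k X Y := by
  obtain ⟨D, hD, hDt⟩ := h.exists_hasTensorDerivAt_intrinsicTorsion J x
  rw [hD.tensorDeriv_eq, ricciStarExpr'_eq e X Y (J.isOrthogonalComplex_at x)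
    (intrinsicTorsion_mem_torsionSpace h.metric x) hDt hn hE, divXi₂_eq e h.metric hD,
    relationTerm_eq e h.metric hD]
  simp only [Fin.sum_univ_eight, ricciStarCoeff', xi₁, xi₂, xi₃, xi₄, Matrix.cons_val]
  ring

theorem IsLeviCivita.ricciStarExpr_eq_ricciStarExpr' (h : IsLeviCivita nabla) (hn : n ≠ 1)
    (hE : Module.finrank ℝ E = 2 * n) (X Y : TangentSpace I x) :
    ricciStarExpr (J.at x) e
        (tensorDeriv (minimalConnection J nabla) (intrinsicTorsion J nabla) x)
        (intrinsicTorsion J nabla x) X Y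
      = ricciStarExpr' (J.at x) e
        (tensorDeriv (minimalConnection J nabla) (intrinsicTorsion J nabla) x)
        (intrinsicTorsion J nabla x) X Y := by
  have hrel := h.sum_relationCoeff_mul_relationTerm (J := J) e hn hE X Y
  simp only [← ricciStarCoeff_sub hn, sub_mul, Finset.sum_sub_distrib] at hrel
  rw [h.ricciStarExpr_intrinsicTorsion e hn hE, h.ricciStarExpr'_intrinsicTorsion e hn hE,
    sub_eq_zero.1 hrel]

theorem IsLeviCivita.ricciStarExpr_intrinsicTorsion_elim (h : IsLeviCivita nabla) (hn : n ≠ 1)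
    (hE : Module.finrank ℝ E = 2 * n) (X Y : TangentSpace I x) :
    ricciStarExpr (J.at x) e
        (tensorDeriv (minimalConnection J nabla) (intrinsicTorsion J nabla) x)
        (intrinsicTorsion J nabla x) X Y
      = -divXi₂ J nabla x e X Y
        + ∑ k, ricciStarCoeffElim n k * relationTerm J nabla n x e k X Y := by
  simp only [ricciStarCoeffElim_eq hn, sub_mul, mul_assoc, Finset.sum_sub_distrib,
    ← Finset.mul_sum, h.sum_relationCoeff_mul_relationTerm e hn hE X Y, mul_zero, sub_zero]
  exact h.ricciStarExpr_intrinsicTorsion e hn hE X Y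

end Relation

end AlmostHermitian

end

theorem mainTheorem7_general {n : ℕ} (hn : n ≠ 1) {E : Type*} [NormedAddCommGroup E]
    [NormedSpace ℝ E] [FiniteDimensional ℝ E] (hE : Module.finrank ℝ E = 2 * n)
    {H : Type*} [TopologicalSpace H] {I : ModelWithCorners ℝ E H}
    {M : Type*} [TopologicalSpace M] [ChartedSpace H M] [IsManifold I ∞ M]
    [RiemannianBundle (fun x : M ↦ TangentSpace I x)]
    [IsContMDiffRiemannianBundle I ∞ E (fun x : M ↦ TangentSpace I x)]
    (J : OrthogonalComplexStructure I M)
    (nabla : CovariantDerivative I E (TangentSpace I : M → Type _))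
    (hnabla : IsLeviCivita nabla)
    (x : M) {ι : Type*} [Fintype ι] (e : OrthonormalBasis ι ℝ (TangentSpace I x)) :
    (xi₁ J nabla x ∈ W₁ (J.at x) ∧ xi₂ J nabla x ∈ W₂ (J.at x) ∧
      xi₃ J nabla n x ∈ W₃ (J.at x) ∧ xi₄ J nabla n x ∈ W₄ (J.at x) ∧
      intrinsicTorsion J nabla x
        = xi₁ J nabla x + xi₂ J nabla x + xi₃ J nabla n x + xi₄ J nabla n x) ∧
    (∀ k, IsLambda20 (J.at x) (relationTerm J nabla n x e k)) ∧
    (∀ t u v w, extDeriv₃ (extDeriv₂ (kahlerForm J)) x t u v w = 0) ∧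
    (∀ X Y, lambda20Part (J.at x) e (extDeriv₃ (extDeriv₂ (kahlerForm J)) x) X Y
      = 4 * ∑ k, relationCoeff n k * relationTerm J nabla n x e k X Y) ∧
    (∀ X Y, ∑ k, relationCoeff n k * relationTerm J nabla n x e k X Y = 0) ∧
    (3 ≤ n → ∀ k, relationCoeff n k = 0 ↔ n = 5 ∧ k = 4) ∧
    (∀ k, relationCoeff n k ≠ 0 → ∀ X Y, relationTerm J nabla n x e k X Y
      = -∑ j ∈ Finset.univ.erase k,
          relationCoeff n j / relationCoeff n k * relationTerm J nabla n x e j X Y) ∧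
    (∀ X Y,
      let A := ricciStarExpr (J.at x) e
        (tensorDeriv (minimalConnection J nabla) (intrinsicTorsion J nabla) x)
        (intrinsicTorsion J nabla x) X Y
      let B := ricciStarExpr' (J.at x) e
        (tensorDeriv (minimalConnection J nabla) (intrinsicTorsion J nabla) x)
        (intrinsicTorsion J nabla x) X Y
      A = -divXi₂ J nabla x e X Y
          + ∑ k, ricciStarCoeff n k * relationTerm J nabla n x e k X Y ∧
      B = -divXi₂ J nabla x e X Y
          + ∑ k, ricciStarCoeff' k * relationTerm J nabla n x e k X Y ∧
      (∀ k, ricciStarCoeff n k - ricciStarCoeff' k = relationCoeff n k) ∧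
      A = B ∧
      A = -divXi₂ J nabla x e X Y
          + ∑ k, ricciStarCoeffElim n k * relationTerm J nabla n x e k X Y ∧
      (∀ k, ricciStarCoeffElim n k = 0 ↔ k = 0)) := by
  have hJ := J.isOrthogonalComplex_at x
  have hξ := intrinsicTorsion_mem_torsionSpace (J := J) hnabla.metric x
  have hrel := hnabla.sum_relationCoeff_mul_relationTerm (J := J) e hn hE
  exact ⟨⟨comp₁_mem_W₁ hJ hξ, comp₂_mem_W₂ hJ hξ, comp₃_mem_W₃ hJ hξ hn hE, comp₄_mem_W₄,
      eq_sum_comp⟩,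
    hnabla.isLambda20_relationTerm e,
    hnabla.extDeriv₃_extDeriv₂_kahlerForm_eq_zero,
    hnabla.lambda20Part_extDeriv₃ e hn hE,
    hrel,
    relationCoeff_eq_zero_iff,
    fun k hk X Y ↦ eq_neg_sum_erase_of_sum_eq_zero (hrel X Y) hk,
    fun X Y ↦ ⟨hnabla.ricciStarExpr_intrinsicTorsion e hn hE X Y,
      hnabla.ricciStarExpr'_intrinsicTorsion e hn hE X Y,
      ricciStarCoeff_sub hn,
      hnabla.ricciStarExpr_eq_ricciStarExpr' e hn hE X Y,
      hnabla.ricciStarExpr_intrinsicTorsion_elim e hn hE X Y,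
      ricciStarCoeffElim_eq_zero_iff hn⟩⟩

theorem mainTheorem7 (n : ℕ) (hn : 2 ≤ n)
    {M : Type*} [TopologicalSpace M] [T2Space M] [SecondCountableTopology M]
    [ChartedSpace (EuclideanSpace ℝ (Fin (2 * n))) M] [IsManifold (𝓡 (2 * n)) ∞ M]
    [RiemannianBundle (fun x : M ↦ TangentSpace (𝓡 (2 * n)) x)]
    [IsContMDiffRiemannianBundle (𝓡 (2 * n)) ∞ (EuclideanSpace ℝ (Fin (2 * n)))
      (fun x : M ↦ TangentSpace (𝓡 (2 * n)) x)]
    (J : OrthogonalComplexStructure (𝓡 (2 * n)) M)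
    (nabla : CovariantDerivative (𝓡 (2 * n)) (EuclideanSpace ℝ (Fin (2 * n)))
      (TangentSpace (𝓡 (2 * n)) : M → Type _))
    (hnabla : IsLeviCivita nabla)
    (x : M) {ι : Type*} [Fintype ι]
    (e : OrthonormalBasis ι ℝ (TangentSpace (𝓡 (2 * n)) x)) :
    -- `ξ_i` is the component of `ξ` in `𝒲_i`
    (xi₁ J nabla x ∈ W₁ (J.at x) ∧ xi₂ J nabla x ∈ W₂ (J.at x) ∧
      xi₃ J nabla n x ∈ W₃ (J.at x) ∧ xi₄ J nabla n x ∈ W₄ (J.at x) ∧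
      intrinsicTorsion J nabla x
        = xi₁ J nabla x + xi₂ J nabla x + xi₃ J nabla n x + xi₄ J nabla n x) ∧
    -- each term of the relation lies in `⟦λ^{2,0}⟧`
    (∀ k, IsLambda20 (J.at x) (relationTerm J nabla n x e k)) ∧
    -- `d²ω = 0`, and its `⟦λ^{2,0}⟧`-component expressed through the torsion
    (∀ t u v w, extDeriv₃ (extDeriv₂ (kahlerForm J)) x t u v w = 0) ∧
    (∀ X Y, lambda20Part (J.at x) e (extDeriv₃ (extDeriv₂ (kahlerForm J)) x) X Y
      = 4 * ∑ k, relationCoeff n k * relationTerm J nabla n x e k X Y) ∧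
    -- the linear relation
    (∀ X Y, ∑ k, relationCoeff n k * relationTerm J nabla n x e k X Y = 0) ∧
    -- no coefficient vanishes, except for `n = 2` and for that of `ξ_1 ⊙ ξ_4` when `n = 5`
    (3 ≤ n → ∀ k, relationCoeff n k = 0 ↔ n = 5 ∧ k = 4) ∧
    -- so that every term is a linear combination of the others
    (∀ k, relationCoeff n k ≠ 0 → ∀ X Y, relationTerm J nabla n x e k X Y
      = -∑ j ∈ Finset.univ.erase k,
          relationCoeff n j / relationCoeff n k * relationTerm J nabla n x e j X Y) ∧
    -- the two expressions for the `𝒞₆`-component differ exactly by the relation, and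
    -- the relation trades the `∇̃ξ_1`-term for those in `∇̃ξ_3` and `ξ_3 ⊙ ξ_4`
    (∀ X Y,
      let A := ricciStarExpr (J.at x) e
        (tensorDeriv (minimalConnection J nabla) (intrinsicTorsion J nabla) x)
        (intrinsicTorsion J nabla x) X Y
      let B := ricciStarExpr' (J.at x) e
        (tensorDeriv (minimalConnection J nabla) (intrinsicTorsion J nabla) x)
        (intrinsicTorsion J nabla x) X Y
      A = -divXi₂ J nabla x e X Y
          + ∑ k, ricciStarCoeff n k * relationTerm J nabla n x e k X Y ∧
      B = -divXi₂ J nabla x e X Y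
          + ∑ k, ricciStarCoeff' k * relationTerm J nabla n x e k X Y ∧
      (∀ k, ricciStarCoeff n k - ricciStarCoeff' k = relationCoeff n k) ∧
      A = B ∧
      A = -divXi₂ J nabla x e X Y
          + ∑ k, ricciStarCoeffElim n k * relationTerm J nabla n x e k X Y ∧
      (∀ k, ricciStarCoeffElim n k = 0 ↔ k = 0)) :=
  mainTheorem7_general (by lia) finrank_euclideanSpace_fin J nabla hnabla x e
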